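/- Setting. Let $\Omega\subset\mathbb R^{n}$ be a bounded open set and let $A$ be a densely defined, self-adjoint, positive linear operator in $L^2(\Omega)$ with compact resolvent. For $s\in\mathbb R$ let $D(A^{s})$ be the space with norm $\|A^{s}\cdot\|$ (for $s<0$, the completion of $L^2(\Omega)$ in this norm), where $\|\cdot\|$ is the norm of $L^2(\Omega)$; $\langle\cdot,\cdot\rangle$ is the inner product of $L^2(\Omega)$ and its extension to the duality between $D(A^s)$ and $D(A^{-s})$. Let $r>0$, $d\ge 0$, let $b:\mathbb R\to\mathbb R$ be Lipschitz and bounded, let $B:D(A^{-1/2})\to L^2(\Omega)$ satisfy $\|Bu-Bv\|\le L_B\|A^{-1/2}(u-v)\|$ for all $u,v$, with some $L_B>0$, put $$H=\{\varphi\in C([-r,0];D(A^{-1/2})):\ \varphi(0)\in D(A^{1/2})\},$$ and let $\eta:H\to[0,r]$ be such that, for some $L_\eta>0$, $q\ge0$ and all $\varphi,\psi\in H$, $$|\eta(\varphi)-\eta(\psi)|\le L_\eta\Big(q\|A^{1/2}(\varphi(0)-\psi(0))\|^2+\int_{-r}^0\|A^{-1/2}(\varphi(\theta)-\psi(\theta))\|^2\,d\theta\Big)^{1/2}.$$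 Put $F_1(\varphi)(x)=b\big([B\varphi(-\eta(\varphi))](x)\big)$, so that $F_1:H\to L^2(\Omega)$, and $u_t(\theta)=u(t+\theta)$ for $\theta\in[-r,0]$. For $\varphi\in H$ and $T>0$, a strong solution on $[0,T]$ of $\dot u(t)+Au(t)+du(t)=F_1(u_t)$, $u|_{[-r,0]}=\varphi$, is a function $u\in C([-r,T];D(A^{-1/2}))\cap C([0,T];D(A^{1/2}))\cap L^2(0,T;D(A))$ with $\dot u\in L^\infty(0,T;D(A^{-1/2}))$, $u=\varphi$ on $[-r,0]$, and $$-\int_0^T\langle u,\dot v\rangle\,dt+\int_0^T\langle A^{1/2}u,A^{1/2}v\rangle\,dt=\langle\varphi(0),v(0)\rangle+\int_0^T\langle F_1(u_t)-du(t),v(t)\rangle\,dt$$ for all $v\in L^2(0,T;L^2(\Omega))$ with $\dot v\in L^2(0,T;D(A^{-1}))$ and $v(T)=0$. Let $$X=\{\varphi\in C^1([-r,0];D(A^{-1/2})):\ \varphi(0)\in D(A^{1/2}),\ \dot\varphi(0)+A\varphi(0)+d\varphi(0)=F_1(\varphi)\}$$ (equality in $D(A^{-1/2})$), with the metric of the norm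 $\|\varphi\|_X=\max_{s}\|A^{-1/2}\varphi(s)\|+\max_{s}\|A^{-1/2}\dot\varphi(s)\|+\|A^{1/2}\varphi(0)\|$. Lemma 3. (i) For every $\varphi\in C^1([-r,0];D(A^{-1/2}))$ with $\varphi(0)\in D(A^{1/2})$ and every $T>0$ there is a unique strong solution $u$ on $[0,T]$, and it satisfies $\dot u\in C([0,T];D(A^{-1/2}))$. (ii) Consequently, $S_t\varphi=u_t$ ($t\ge0$) defines maps $S_t:X\to X$ (that is, $X$ is invariant), and $(S_t,X)$ is a dynamical system: $X$ is a complete metric space, $S_0=\mathrm{id}$, $S_{t+s}=S_tS_s$, every $S_t:X\to X$ is continuous, and $t\mapsto S_t\varphi$ is continuous from $[0,\infty)$ to $X$ for every $\varphi\in X$, all in the metric of $\|\cdot\|_X$. -/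

import Mathlib

open MeasureTheory Set Topology
open scoped NNReal ENNReal

noncomputable section

namespace DelayPDE

section HilbertScale

variable {H : Type*} [NormedAddCommGroup H] [InnerProductSpace ℝ H] [CompleteSpace H]

/-- The operator `A`: a densely defined, self-adjoint, positive, unbounded operator on a real
Hilbert space, with compact resolvent (for some, equivalently every, point `μ` of the resolvent
set, `(A - μ)⁻¹` is an everywhere defined compact operator). -/
structure PosOp (H : Type*) [NormedAddCommGroup H] [InnerProductSpace ℝ H] [CompleteSpace H] where
  op : H →ₗ.[ℝ] H
  dense : Dense (op.domain : Set H)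
  selfAdjoint : IsSelfAdjoint op
  pos : ∀ u : op.domain, u ≠ 0 → 0 < inner ℝ (op u) (u : H)
  compactResolvent : ∃ (μ : ℝ) (R : H →L[ℝ] H), IsCompactOperator R ∧
    (∀ f : H, ∃ h : R f ∈ op.domain, op ⟨R f, h⟩ - μ • R f = f) ∧
    ∀ u : op.domain, R (op u - μ • (u : H)) = u

/-- The eigenspace `ker (A - l)` (it is `{0}` when `l` is not an eigenvalue). -/
def eigenspace (A : PosOp H) (l : ℝ) : Submodule ℝ H where
  carrier := {u | ∃ h : u ∈ A.op.domain, A.op ⟨u, h⟩ = l • u}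
  zero_mem' := ⟨A.op.domain.zero_mem, by
    have : (⟨0, A.op.domain.zero_mem⟩ : A.op.domain) = 0 := rfl
    rw [this, LinearPMap.map_zero, smul_zero]⟩
  add_mem' := by
    rintro u v ⟨hu, eu⟩ ⟨hv, ev⟩
    refine ⟨A.op.domain.add_mem hu hv, ?_⟩
    have : (⟨u + v, A.op.domain.add_mem hu hv⟩ : A.op.domain) = ⟨u, hu⟩ + ⟨v, hv⟩ := rfl
    rw [this, LinearPMap.map_add, eu, ev, smul_add]
  smul_mem' := by
    rintro c u ⟨hu, eu⟩
    refine ⟨A.op.domain.smul_mem c hu, ?_⟩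
    have : (⟨c • u, A.op.domain.smul_mem c hu⟩ : A.op.domain) = c • ⟨u, hu⟩ := rfl
    rw [this, LinearPMap.map_smul, eu, smul_comm]

theorem isClosed_eigenspace (A : PosOp H) (l : ℝ) : IsClosed (eigenspace A l : Set H) := by
  have hcl : A.op.IsClosed := A.selfAdjoint.isClosed
  have : (eigenspace A l : Set H) = (fun u : H => (u, l • u)) ⁻¹' (A.op.graph : Set (H × H)) := by
    ext u
    simp only [mem_preimage, SetLike.mem_coe, LinearPMap.mem_graph_iff]
    constructor
    · rintro ⟨h, e⟩
      exact ⟨⟨u, h⟩, rfl, e⟩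
    · rintro ⟨y, e1, e2⟩
      subst e1
      exact ⟨y.2, e2⟩
  rw [this]
  exact hcl.preimage (by fun_prop)

instance (A : PosOp H) (l : ℝ) : CompleteSpace (eigenspace A l) :=
  (isClosed_eigenspace A l).completeSpace_coe

/-- Formal expansions `w = ∑ w_l` along the eigenspaces of `A` (`l > 0`, as `A` is positive).
This is the common ambient vector space of all the spaces `D(A^s)`, `s ∈ ℝ`. -/
abbrev Formal (A : PosOp H) : Type _ := ∀ l : Ioi (0 : ℝ), eigenspace A (l : ℝ)

/-- The expansion of a vector `u ∈ H`: its orthogonal projections on the eigenspaces. -/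
def expand (A : PosOp H) (u : H) : Formal A :=
  fun l => (eigenspace A (l : ℝ)).orthogonalProjectionOnto u

/-- The power `A^s`, acting as `l^s` on `ker (A - l)`. -/
def powA (A : PosOp H) (s : ℝ) : Formal A →ₗ[ℝ] Formal A where
  toFun w := fun l => ((l : ℝ) ^ s) • w l
  map_add' w z := by ext l; simp
  map_smul' c w := by ext l; simp [smul_comm c]

/-- The duality pairing `⟨f, g⟩`, extending the inner product of `H` to pairs `f ∈ D(A^s)`,
`g ∈ D(A^(-s))`. -/
def dualPair (A : PosOp H) (f g : Formal A) : ℝ :=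
  ∑' l, inner ℝ (f l : H) (g l : H)

/-- `D(A^s) = {w | ∑ l^(2s) ‖w_l‖² < ∞}` as a subspace of the formal expansions. For `s < 0` it
is the completion of `H` for the norm `‖A^s u‖`. -/
def powDomain (A : PosOp H) (s : ℝ) : Submodule ℝ (Formal A) where
  carrier := {w | Memℓp (powA A s w) 2}
  zero_mem' := by
    change Memℓp (powA A s 0) 2
    rw [map_zero]; exact zero_memℓp
  add_mem' := by
    intro w z hw hz
    change Memℓp (powA A s (w + z)) 2
    rw [map_add]; exact hw.add hz
  smul_mem' := by
    intro c w hw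
    change Memℓp (powA A s (c • w)) 2
    rw [map_smul]; exact hw.const_smul c

/-- The space `D(A^s)`, a normed space with norm `‖w‖ = ‖A^s w‖`. -/
def Scale (A : PosOp H) (s : ℝ) : Type _ := powDomain A s

instance (A : PosOp H) (s : ℝ) : AddCommGroup (Scale A s) :=
  inferInstanceAs (AddCommGroup (powDomain A s))

instance (A : PosOp H) (s : ℝ) : Module ℝ (Scale A s) :=
  inferInstanceAs (Module ℝ (powDomain A s))

/-- The inclusion of `D(A^s)` into the formal expansions. -/
def Scale.formal {A : PosOp H} {s : ℝ} : Scale A s →ₗ[ℝ] Formal A :=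
  (powDomain A s).subtype

/-- `w ↦ A^s w`, from `D(A^s)` to the square-summable expansions. -/
def Scale.toLp (A : PosOp H) (s : ℝ) :
    Scale A s →ₗ[ℝ] lp (fun l : Ioi (0 : ℝ) => eigenspace A (l : ℝ)) 2 where
  toFun w := ⟨powA A s w.formal, w.2⟩
  map_add' w z := Subtype.ext <|
    show powA A s (w + z).formal = powA A s w.formal + powA A s z.formal by
      rw [map_add, map_add]
  map_smul' c w := Subtype.ext <|
    show powA A s (c • w).formal = c • powA A s w.formal by
      rw [map_smul, map_smul]

theorem Scale.toLp_bijective (A : PosOp H) (s : ℝ) : Function.Bijective (Scale.toLp A s) := by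
  constructor
  · intro w z h
    apply Subtype.ext
    funext l
    have h1 : ((l : ℝ) ^ s) • w.formal l = ((l : ℝ) ^ s) • z.formal l :=
      congrFun (congrArg Subtype.val h) l
    exact smul_right_injective _ (Real.rpow_pos_of_pos l.2 s).ne' h1
  · intro x
    have h1 : powA A s (fun l => ((l : ℝ) ^ s)⁻¹ • x l) = x := by
      funext l
      exact smul_inv_smul₀ (Real.rpow_pos_of_pos l.2 s).ne' _
    refine ⟨⟨fun l => ((l : ℝ) ^ s)⁻¹ • x l, ?_⟩, ?_⟩
    · change Memℓp (powA A s _) 2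
      rw [h1]; exact x.2
    · exact Subtype.ext h1

instance (A : PosOp H) (s : ℝ) : NormedAddCommGroup (Scale A s) :=
  NormedAddCommGroup.induced _ _ (Scale.toLp A s) (Scale.toLp_bijective A s).1

instance (A : PosOp H) (s : ℝ) : NormedSpace ℝ (Scale A s) :=
  NormedSpace.induced ℝ _ _ (Scale.toLp A s)

instance (A : PosOp H) (s : ℝ) : CompleteSpace (Scale A s) := by
  have hi : Isometry (Scale.toLp A s) :=
    AddMonoidHomClass.isometry_of_norm _ fun _ => rfl
  refine (completeSpace_iff_isComplete_range hi.isUniformInducing).2 ?_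
  rw [(Scale.toLp_bijective A s).2.range_eq]
  exact completeSpace_iff_isComplete_univ.1 inferInstance

/-- Functions `[-r,0] → D(A^(-1/2))` (continuity is imposed separately). -/
abbrev Hist (A : PosOp H) (r : ℝ≥0) : Type _ := Icc (-(r : ℝ)) 0 → Scale A (-(1 / 2))

/-- The point `0` of `[-r,0]`. -/
def zeroPt (r : ℝ≥0) : Icc (-(r : ℝ)) 0 := ⟨0, by simp⟩

/-- The point `-τ` of `[-r,0]`, for `τ ∈ [0,r]`. -/
def negPt {r : ℝ≥0} (τ : Icc (0 : ℝ) r) : Icc (-(r : ℝ)) 0 :=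
  ⟨-(τ : ℝ), neg_le_neg τ.2.2, neg_nonpos.2 τ.2.1⟩

/-- The segment `u_t`, `u_t(θ) = u(t + θ)`. -/
def seg {A : PosOp H} (r : ℝ≥0) (u : ℝ → Scale A (-(1 / 2))) (t : ℝ) : Hist A r :=
  fun θ => u (t + θ)

/-- The Lipschitz condition on the state-dependent delay on the space of all
`φ ∈ C([-r,0]; D(A^(-1/2)))` with `φ(0) ∈ D(A^(1/2))`. Here `φ₀`, `ψ₀` are `φ(0)`, `ψ(0)` as
elements of `D(A^(1/2))`. The values of `η` off that space play no role. -/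
def HypDelay {A : PosOp H} {r : ℝ≥0} (η : Hist A r → Icc (0 : ℝ) r) : Prop :=
  ∃ L > (0 : ℝ), ∃ q ≥ (0 : ℝ), ∀ (φ ψ : Hist A r) (φ₀ ψ₀ : Scale A (1 / 2)),
    Continuous φ → Continuous ψ →
    φ₀.formal = (φ (zeroPt r)).formal → ψ₀.formal = (ψ (zeroPt r)).formal →
    |(η φ : ℝ) - η ψ| ≤ L * Real.sqrt (q * ‖φ₀ - ψ₀‖ ^ 2 + 
      ∫ θ, ‖φ θ - ψ θ‖ ^ 2 ∂(Measure.comap Subtype.val volume))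

/-- The space of `φ ∈ C¹([-r,0]; D(A^(-1/2)))` with `φ(0) ∈ D(A^(1/2))`. The fields `deriv` and
`init` (`φ'`, and `φ(0)` as an element of `D(A^(1/2))`) are determined by `φ` when `r > 0`. -/
@[ext] structure C1Hist (A : PosOp H) (r : ℝ≥0) where
  fn : C(Icc (-(r : ℝ)) 0, Scale A (-(1 / 2)))
  deriv : C(Icc (-(r : ℝ)) 0, Scale A (-(1 / 2)))
  init : Scale A (1 / 2)
  hasDeriv : ∀ θ, HasDerivWithinAt (Function.extend Subtype.val fn 0) (deriv θ)
    (Icc (-(r : ℝ)) 0) (θ : ℝ)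
  init_eq : init.formal = (fn (zeroPt r)).formal

/-- The metric of the norm
`max ‖A^(-1/2) φ(s)‖ + max ‖A^(-1/2) φ'(s)‖ + ‖A^(1/2) φ(0)‖`. -/
instance (A : PosOp H) (r : ℝ≥0) : MetricSpace (C1Hist A r) where
  dist φ ψ := ‖φ.fn - ψ.fn‖ + ‖φ.deriv - ψ.deriv‖ + ‖φ.init - ψ.init‖
  dist_self φ := by simp
  dist_comm φ ψ := by
    simp only [norm_sub_rev ψ.fn, norm_sub_rev ψ.deriv, norm_sub_rev ψ.init]
  dist_triangle φ ψ χ := by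
    have h1 := norm_sub_le_norm_sub_add_norm_sub φ.fn ψ.fn χ.fn
    have h2 := norm_sub_le_norm_sub_add_norm_sub φ.deriv ψ.deriv χ.deriv
    have h3 := norm_sub_le_norm_sub_add_norm_sub φ.init ψ.init χ.init
    linarith
  eq_of_dist_eq_zero := by
    intro φ ψ h
    change ‖φ.fn - ψ.fn‖ + ‖φ.deriv - ψ.deriv‖ + ‖φ.init - ψ.init‖ = 0 at h
    have h1 := norm_nonneg (φ.fn - ψ.fn)
    have h2 := norm_nonneg (φ.deriv - ψ.deriv)
    have h3 := norm_nonneg (φ.init - ψ.init)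
    ext1
    · exact sub_eq_zero.1 (norm_eq_zero.1 (by linarith))
    · exact sub_eq_zero.1 (norm_eq_zero.1 (by linarith))
    · exact sub_eq_zero.1 (norm_eq_zero.1 (by linarith))

end HilbertScale

/-- `w` is an absolutely continuous function on `[0,T]` with time derivative `g`. For integrable
`g`, this is the statement that `g` is the distributional derivative of `w` on `(0,T)`, for the
continuous representative `w`. -/
def HasTimeDeriv {E : Type*} [NormedAddCommGroup E] [NormedSpace ℝ E] (T : ℝ) (w g : ℝ → E) :
    Prop :=
  ∀ t ∈ Icc 0 T, w t = w 0 + ∫ s in (0 : ℝ)..t, g s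

/-- The Hilbert space `L²(Ω)`. -/
abbrev L2 {n : ℕ} (Ω : Set (EuclideanSpace ℝ (Fin n))) : Type :=
  Lp ℝ 2 (volume.restrict Ω)

section Equation

variable {n : ℕ} {Ω : Set (EuclideanSpace ℝ (Fin n))} {A : PosOp (L2 Ω)} {r : ℝ≥0}

open Classical in
/-- `F₁(φ)(x) = b([B φ(-η(φ))](x))` as an element of `L²(Ω)`. The first case always applies when
`b` is bounded and continuous and `Ω` is bounded. -/
def F₁ (b : ℝ → ℝ) (B : Scale A (-(1 / 2)) → L2 Ω) (η : Hist A r → Icc (0 : ℝ) r)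
    (φ : Hist A r) : L2 Ω :=
  if h : MemLp (fun x => b (B (φ (negPt (η φ))) x)) 2 (volume.restrict Ω) then h.toLp else 0

/-- Strong solutions on `[0,T]`. In the weak equation, the test function is
`v ∈ L²(0,T; L²(Ω))` with `v' = w' ∈ L²(0,T; D(A⁻¹))`, and `w` is its continuous representative,
with `w(T) = 0`. -/
structure IsStrongSolution (d : ℝ) (b : ℝ → ℝ) (B : Scale A (-(1 / 2)) → L2 Ω)
    (η : Hist A r → Icc (0 : ℝ) r) (T : ℝ) (φ : Hist A r) (u : ℝ → Scale A (-(1 / 2))) :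
    Prop where
  continuousOn : ContinuousOn u (Icc (-(r : ℝ)) T)
  continuousOn_half : ∃ w : ℝ → Scale A (1 / 2), ContinuousOn w (Icc 0 T) ∧
    ∀ t ∈ Icc 0 T, (w t).formal = (u t).formal
  memLp_one : ∃ w : ℝ → Scale A 1, MemLp w 2 (volume.restrict (Ioc 0 T)) ∧
    ∀ᵐ t ∂volume.restrict (Ioc 0 T), (w t).formal = (u t).formal
  deriv_bounded : ∃ g : ℝ → Scale A (-(1 / 2)), MemLp g ∞ (volume.restrict (Ioc 0 T)) ∧
    HasTimeDeriv T u g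
  initial : ∀ θ : Icc (-(r : ℝ)) 0, u θ = φ θ
  weak : ∀ (v : ℝ → L2 Ω) (w w' : ℝ → Scale A (-1)),
    MemLp v 2 (volume.restrict (Ioc 0 T)) → MemLp w' 2 (volume.restrict (Ioc 0 T)) →
    HasTimeDeriv T w w' →
    (∀ᵐ t ∂volume.restrict (Ioc 0 T), (w t).formal = expand A (v t)) → w T = 0 →
    -(∫ t in (0 : ℝ)..T, dualPair A (u t).formal (w' t).formal)
      + ∫ t in (0 : ℝ)..T, dualPair A (powA A (1 / 2) (u t).formal) (powA A (1 / 2) (expand A (v t)))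
    = dualPair A (φ (zeroPt r)).formal (w 0).formal
      + ∫ t in (0 : ℝ)..T,
          dualPair A (expand A (F₁ b B η (seg r u t)) - d • (u t).formal) (expand A (v t))

/-- The set `X` of those `φ ∈ C¹([-r,0]; D(A^(-1/2)))`, `φ(0) ∈ D(A^(1/2))`, with
`φ'(0) + A φ(0) + d φ(0) = F₁(φ)` in `D(A^(-1/2))`. -/
def X (d : ℝ) (b : ℝ → ℝ) (B : Scale A (-(1 / 2)) → L2 Ω) (η : Hist A r → Icc (0 : ℝ) r) :
    Set (C1Hist A r) :=
  {φ | (φ.deriv (zeroPt r)).formal + powA A 1 (φ.fn (zeroPt r)).formal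
      + d • (φ.fn (zeroPt r)).formal = expand A (F₁ b B η φ.fn)}

end Equation

/-- A (continuous-time) dynamical system: a semigroup of continuous maps of a complete metric
space, continuous in time. -/
structure IsDynamicalSystem {M : Type*} [MetricSpace M] (S : ℝ≥0 → M → M) : Prop where
  complete : CompleteSpace M
  zero : ∀ x, S 0 x = x
  add : ∀ s t x, S (s + t) x = S s (S t x)
  continuous_state : ∀ t, Continuous (S t)
  continuous_time : ∀ x, Continuous fun t => S t x

end DelayPDE

end

open DelayPDE

/-!
The eigenspaces of `A` split the problem. On `ker (A - l)` the linear equation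
`u' + A u + d u = f` is the scalar linear ordinary differential equation, solved by variation of
constants (`expSol`). For `u(0) ∈ D(A^(1/2))` and continuous `f : ℝ → D(A^0)`, multiplying by `A u`
in each eigenspace and summing gives the energy estimate
`‖A^(1/2) u(t)‖² + ∫ ‖A u‖² ≤ ‖A^(1/2) u(0)‖² + ∫ ‖f‖²` over `[0,t]`. So the
mild solution `sol` is continuous into `D(A^(1/2))` and square-integrable into `D(A)`
(`continuous_sol`, `exists_memLp_scale_one`), and `u' = f - A u - d u` is continuous into
`D(A^(-1/2))` (`solNeg_eq_integral`). `L²(Ω)` is separable, so there are only countably many eigenvalues; testing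
the weak equation with an eigenvector times a scalar solution of the adjoint equation shows that
the mild solution is its only continuous solution (`isWeakSolution_sol`, `IsWeakSolution.eq_sol`).

A history `φ` and a forcing term `f` thus determine a trajectory (`traj`), and strong solutions of
the delay equation correspond to fixed points `f(t) = Φ(u_t)`, where `u` is the trajectory of `f`
and `Φ(φ)` is the expansion of `F₁(φ)` (`IsForcing.isStrongSolution`,
`IsStrongSolution.exists_isForcing`). As the delay depends on the state, `Φ` is not Lipschitz on
continuous histories: `φ(-η(φ)) - ψ(-η(ψ))` contains `φ(-η(φ)) - φ(-η(ψ))`. But `φ` is `C¹` and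
`Φ` is bounded, so all trajectories with bounded forcing are Lipschitz in time with values in
`D(A^(-1/2))` (`exists_norm_traj_sub_le`), and along these `Φ` satisfies a Lipschitz estimate
(`IsDelayForcing`, `exists_isDelayForcing`). It turns into
`‖Φ(u_t) - Φ(v_t)‖² ≤ L (dist φ ψ² + ∫₀ᵗ ‖f - g‖²)` (`IsDelayForcing.exists_sub_sq_le`), from which
Picard iteration gives existence (`exists_isForcing`), and Gronwall's inequality gives uniqueness
and Lipschitz dependence on the history (`IsDelayForcing.exists_forcing_sub_le`).

The compatibility condition that defines `X` says that the left derivative `φ'(0)` equals the right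
derivative `f(0) - A φ(0) - d φ(0)` of the trajectory. So the segments `u_t` are `C¹`, and they
satisfy the same condition because the equation holds at time `t` (`evolve`, `evolve_mem`). The
semigroup law follows from uniqueness, and `X` is complete because it is closed in the complete
space of `C¹` histories.
-/

noncomputable section

namespace DelayPDE

open Filter

section HilbertScale

variable {H : Type*} [NormedAddCommGroup H] [InnerProductSpace ℝ H] [CompleteSpace H]

/-! ### Eigenspaces of the operator -/

theorem PosOp.inner_op_comm (A : PosOp H) (u v : A.op.domain) :
    inner ℝ (A.op u) (v : H) = inner ℝ (u : H) (A.op v) := by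
  have h := A.op.adjoint_isFormalAdjoint A.dense
  have e : A.op.adjoint = A.op := A.selfAdjoint
  rw [e] at h
  exact h u v

theorem inner_eq_zero_of_mem_eigenspace (A : PosOp H) {l k : ℝ} (hlk : l ≠ k) {u v : H}
    (hu : u ∈ eigenspace A l) (hv : v ∈ eigenspace A k) : inner ℝ u v = 0 := by
  obtain ⟨hu, eu⟩ := hu
  obtain ⟨hv, ev⟩ := hv
  have h := A.inner_op_comm ⟨u, hu⟩ ⟨v, hv⟩
  rw [eu, ev, real_inner_smul_left, real_inner_smul_right] at h
  have : (l - k) * inner ℝ u v = 0 := by linarith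
  exact (mul_eq_zero.1 this).resolve_left (sub_ne_zero.2 hlk)

theorem orthogonalFamily_eigenspace (A : PosOp H) :
    OrthogonalFamily ℝ (fun l : Ioi (0 : ℝ) => eigenspace A (l : ℝ))
      fun l => (eigenspace A (l : ℝ)).subtypeₗᵢ := by
  intro l k hlk u v
  exact inner_eq_zero_of_mem_eigenspace A (fun h => hlk (Subtype.ext h)) u.2 v.2

/-- The eigenvalues of `A` are bounded away from `0`: otherwise compactness of the resolvent
yields a limit of unit eigenvectors that lies in the kernel of `A`. -/
theorem exists_spectral_gap (A : PosOp H) :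
    ∃ c > (0 : ℝ), ∀ l : Ioi (0 : ℝ), ∀ x : eigenspace A (l : ℝ), x ≠ 0 → c ≤ l := by
  by_contra! hcon
  obtain ⟨μ, R, hR, -, hR2⟩ := A.compactResolvent
  have hpos (k : ℕ) : (0 : ℝ) < 1 / ((k : ℝ) + 1) := by positivity
  choose l x hx hl using fun k : ℕ => hcon _ (hpos k)
  have hn (k : ℕ) : ‖(x k : H)‖ ≠ 0 := by
    simpa using hx k
  let e : ℕ → H := fun k => ‖(x k : H)‖⁻¹ • (x k : H)
  have he1 (k : ℕ) : ‖e k‖ = 1 := by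
    simp only [e, norm_smul, norm_inv, norm_norm]
    exact inv_mul_cancel₀ (hn k)
  have hem (k : ℕ) : e k ∈ eigenspace A (l k) := (eigenspace A (l k : ℝ)).smul_mem _ (x k).2
  have hRe (k : ℕ) : ((l k : ℝ) - μ) • R (e k) = e k := by
    obtain ⟨h1, h2⟩ := hem k
    have h3 := hR2 ⟨e k, h1⟩
    rw [h2] at h3
    simpa [← sub_smul] using h3
  have hl0 : Tendsto (fun k => (l k : ℝ)) atTop (𝓝 0) :=
    squeeze_zero (fun k => (l k).2.le) (fun k => (hl k).le) tendsto_one_div_add_atTop_nhds_zero_nat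
  have hK := hR.isCompact_closure_image_closedBall (f := (R : H →ₗ[ℝ] H)) 1
  obtain ⟨y, -, j, hj, hy⟩ := hK.tendsto_subseq (x := fun k => R (e k)) fun k =>
    subset_closure ⟨e k, by simp [he1], rfl⟩
  have hl0' := hl0.comp hj.tendsto_atTop
  have hez : Tendsto (fun k => e (j k)) atTop (𝓝 (-μ • y)) := by
    have h := (hl0'.sub_const μ).smul hy
    rw [zero_sub] at h
    exact h.congr fun k => hRe (j k)
  have hz1 : ‖-μ • y‖ = 1 := tendsto_nhds_unique hez.norm (by simp [he1])
  have hcl : A.op.IsClosed := A.selfAdjoint.isClosed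
  have hlim : Tendsto (fun k => (e (j k), (l (j k) : ℝ) • e (j k))) atTop (𝓝 (-μ • y, 0)) := by
    have h := hl0'.smul hez
    rw [zero_smul] at h
    exact hez.prodMk_nhds h
  have hmem : (-μ • y, (0 : H)) ∈ A.op.graph := by
    refine hcl.mem_of_tendsto hlim (Eventually.of_forall fun k => ?_)
    obtain ⟨h1, h2⟩ := hem (j k)
    exact (LinearPMap.mem_graph_iff _).2 ⟨⟨_, h1⟩, rfl, h2⟩
  obtain ⟨z, hz, hz0⟩ := (LinearPMap.mem_graph_iff _).1 hmem
  have hzne : z ≠ 0 := by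
    rintro rfl
    simp only [Submodule.coe_zero] at hz
    rw [← hz] at hz1
    simp at hz1
  have := A.pos z hzne
  rw [hz0] at this
  simp at this

/-- The (positive) eigenvalues of `A`. -/
def eigenvalues (A : PosOp H) : Set (Ioi (0 : ℝ)) :=
  {l | ∃ x : eigenspace A (l : ℝ), x ≠ 0}

/-- Unit vectors from different eigenspaces have distance `√2`, so the balls of radius `1 / 2`
around them are disjoint. -/
theorem countable_eigenvalues [TopologicalSpace.SeparableSpace H] (A : PosOp H) :
    (eigenvalues A).Countable := by
  have hunit (l : Ioi (0 : ℝ)) (hl : ∃ x : eigenspace A (l : ℝ), x ≠ 0) :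
      ∃ e ∈ eigenspace A (l : ℝ), ‖e‖ = 1 := by
    obtain ⟨x, hx⟩ := hl
    refine ⟨‖(x : H)‖⁻¹ • (x : H), (eigenspace A (l : ℝ)).smul_mem _ x.2, ?_⟩
    rw [norm_smul, norm_inv, norm_norm]
    exact inv_mul_cancel₀ (by simpa using hx)
  choose! e he he1 using hunit
  refine PairwiseDisjoint.countable_of_isOpen (s := fun l => Metric.ball (e l) (1 / 2)) ?_
    (fun l _ => Metric.isOpen_ball) (fun l _ => ⟨e l, Metric.mem_ball_self (by norm_num)⟩)
  intro l hl k hk hlk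
  refine Metric.ball_disjoint_ball ?_
  have h0 := inner_eq_zero_of_mem_eigenspace A (fun h => hlk (Subtype.ext h)) (he l hl) (he k hk)
  have h1 : ‖e l - e k‖ ^ 2 = 2 := by
    rw [norm_sub_sq_real, h0, he1 l hl, he1 k hk]; norm_num
  rw [dist_eq_norm]
  nlinarith [norm_nonneg (e l - e k)]

/-! ### The scale of spaces -/

variable {A : PosOp H} {s s' : ℝ}

theorem Scale.formal_injective : Function.Injective (Scale.formal (A := A) (s := s)) :=
  Subtype.val_injective

theorem Scale.norm_def (w : Scale A s) : ‖w‖ = ‖Scale.toLp A s w‖ := rfl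

theorem Scale.toLp_apply (w : Scale A s) (l : Ioi (0 : ℝ)) :
    Scale.toLp A s w l = (l : ℝ) ^ s • w.formal l := rfl

theorem Scale.norm_toLp_apply (w : Scale A s) (l : Ioi (0 : ℝ)) :
    ‖Scale.toLp A s w l‖ = (l : ℝ) ^ s * ‖w.formal l‖ := by
  rw [Scale.toLp_apply, norm_smul, Real.norm_of_nonneg (Real.rpow_pos_of_pos l.2 s).le]

theorem Scale.hasSum_norm_sq (w : Scale A s) :
    HasSum (fun l : Ioi (0 : ℝ) => ((l : ℝ) ^ s * ‖w.formal l‖) ^ 2) (‖w‖ ^ 2) := by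
  have h := lp.hasSum_norm (p := 2) (by norm_num) (Scale.toLp A s w)
  simpa only [ENNReal.toReal_ofNat, Real.rpow_ofNat, Scale.norm_toLp_apply, Scale.norm_def] using h

theorem Scale.sum_le_norm_sq (w : Scale A s) (F : Finset (Ioi (0 : ℝ))) :
    ∑ l ∈ F, ((l : ℝ) ^ s * ‖w.formal l‖) ^ 2 ≤ ‖w‖ ^ 2 :=
  sum_le_hasSum F (fun _ _ => sq_nonneg _) w.hasSum_norm_sq

theorem Scale.norm_formal_le (w : Scale A s) (l : Ioi (0 : ℝ)) :
    (l : ℝ) ^ s * ‖w.formal l‖ ≤ ‖w‖ := by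
  rw [← Scale.norm_toLp_apply]
  exact lp.norm_apply_le_norm two_ne_zero _ l

theorem mem_powDomain_of_summable {x : Formal A}
    (h : Summable fun l : Ioi (0 : ℝ) => ((l : ℝ) ^ s * ‖x l‖) ^ 2) : x ∈ powDomain A s := by
  change Memℓp (powA A s x) 2
  refine memℓp_gen ?_
  refine h.congr fun l => ?_
  simp only [powA, LinearMap.coe_mk, AddHom.coe_mk, norm_smul, ENNReal.toReal_ofNat,
    Real.rpow_ofNat, Real.norm_of_nonneg (Real.rpow_pos_of_pos l.2 s).le]

theorem mem_powDomain_of_sum_le {x : Formal A} {C : ℝ}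
    (h : ∀ F : Finset (Ioi (0 : ℝ)), ∑ l ∈ F, ((l : ℝ) ^ s * ‖x l‖) ^ 2 ≤ C) :
    x ∈ powDomain A s :=
  mem_powDomain_of_summable (summable_of_sum_le (fun _ => sq_nonneg _) h)

/-- A formal expansion that belongs to `D(A^s)`, as an element of this space. -/
def Scale.mk (x : Formal A) (hx : x ∈ powDomain A s) : Scale A s := ⟨x, hx⟩

@[simp] theorem Scale.formal_mk (x : Formal A) (hx : x ∈ powDomain A s) :
    (Scale.mk x hx).formal = x := rfl

theorem Scale.norm_sq_le_of_sum_le (w : Scale A s) {C : ℝ}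
    (h : ∀ F : Finset (Ioi (0 : ℝ)), ∑ l ∈ F, ((l : ℝ) ^ s * ‖w.formal l‖) ^ 2 ≤ C) :
    ‖w‖ ^ 2 ≤ C :=
  le_of_tendsto w.hasSum_norm_sq (Eventually.of_forall h)

/-- The component of an element of `D(A^s)` in an eigenspace. -/
def Scale.comp (A : PosOp H) (s : ℝ) (l : Ioi (0 : ℝ)) : Scale A s →L[ℝ] eigenspace A (l : ℝ) :=
  LinearMap.mkContinuous
    { toFun := fun w => w.formal l
      map_add' := fun w z => by rw [map_add, Pi.add_apply]
      map_smul' := fun c w => by rw [map_smul, Pi.smul_apply, RingHom.id_apply] }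
    ((l : ℝ) ^ s)⁻¹ fun w => by
      have h := w.norm_formal_le l
      rw [inv_mul_eq_div, le_div_iff₀ (Real.rpow_pos_of_pos l.2 s), mul_comm]
      exact h

@[simp] theorem Scale.comp_apply (w : Scale A s) (l : Ioi (0 : ℝ)) :
    Scale.comp A s l w = w.formal l := rfl

theorem Scale.ext_formal {w z : Scale A s} (h : ∀ l, w.formal l = z.formal l) : w = z :=
  Scale.formal_injective (funext h)

/-- `m` acts as a bounded diagonal operator from `D(A^s)` to `D(A^s')`. Only the values of `m` at
the eigenvalues matter. -/
structure IsMultiplier (A : PosOp H) (s s' : ℝ) (m : Ioi (0 : ℝ) → ℝ) : Prop where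
  exists_bound : ∃ C, 0 ≤ C ∧ ∀ (l : Ioi (0 : ℝ)) (x : eigenspace A (l : ℝ)), x ≠ 0 →
    |m l| * (l : ℝ) ^ s' ≤ C * (l : ℝ) ^ s

theorem IsMultiplier.exists_sum_le {m : Ioi (0 : ℝ) → ℝ} (h : IsMultiplier A s s' m) :
    ∃ C, 0 ≤ C ∧ ∀ (w : Scale A s) (F : Finset (Ioi (0 : ℝ))),
      ∑ l ∈ F, ((l : ℝ) ^ s' * ‖m l • w.formal l‖) ^ 2 ≤ (C * ‖w‖) ^ 2 := by
  obtain ⟨C, hC, h⟩ := h.exists_bound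
  refine ⟨C, hC, fun w F => ?_⟩
  calc ∑ l ∈ F, ((l : ℝ) ^ s' * ‖m l • w.formal l‖) ^ 2
      ≤ ∑ l ∈ F, C ^ 2 * ((l : ℝ) ^ s * ‖w.formal l‖) ^ 2 := by
        refine Finset.sum_le_sum fun l _ => ?_
        rw [← mul_pow]
        have hp := (Real.rpow_pos_of_pos l.2 s').le
        refine pow_le_pow_left₀ (by positivity) ?_ 2
        rcases eq_or_ne (w.formal l) 0 with h0 | h0
        · simp [h0]
        · have := mul_le_mul_of_nonneg_right (h l _ h0) (norm_nonneg (w.formal l))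
          rw [norm_smul, Real.norm_eq_abs]
          calc _ = |m l| * (l : ℝ) ^ s' * ‖w.formal l‖ := by ring
            _ ≤ _ := this
            _ = _ := by ring
    _ = C ^ 2 * ∑ l ∈ F, ((l : ℝ) ^ s * ‖w.formal l‖) ^ 2 := by rw [Finset.mul_sum]
    _ ≤ C ^ 2 * ‖w‖ ^ 2 := mul_le_mul_of_nonneg_left (w.sum_le_norm_sq F) (sq_nonneg C)
    _ = _ := by ring

theorem IsMultiplier.mem_powDomain {m : Ioi (0 : ℝ) → ℝ} (h : IsMultiplier A s s' m)
    (w : Scale A s) : (fun l => m l • w.formal l) ∈ powDomain A s' := by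
  obtain ⟨C, -, hC⟩ := h.exists_sum_le
  exact mem_powDomain_of_sum_le (hC w)

/-- The diagonal operator `D(A^s) → D(A^s')` with multiplier `m`, as a linear map. -/
def IsMultiplier.toLinearMap {m : Ioi (0 : ℝ) → ℝ} (h : IsMultiplier A s s' m) :
    Scale A s →ₗ[ℝ] Scale A s' where
  toFun w := Scale.mk (fun l => m l • w.formal l) (h.mem_powDomain w)
  map_add' w z := by
    refine Scale.ext_formal fun l => ?_
    simp only [Scale.formal_mk, map_add, Pi.add_apply, smul_add]
  map_smul' c w := by
    refine Scale.ext_formal fun l => ?_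
    simp only [Scale.formal_mk, map_smul, Pi.smul_apply, RingHom.id_apply, smul_comm c]

/-- The bounded diagonal operator `D(A^s) → D(A^s')` with multiplier `m`. -/
def IsMultiplier.toCLM {m : Ioi (0 : ℝ) → ℝ} (h : IsMultiplier A s s' m) :
    Scale A s →L[ℝ] Scale A s' :=
  h.toLinearMap.mkContinuousOfExistsBound <| by
    obtain ⟨C, hC, hsum⟩ := h.exists_sum_le
    exact ⟨C, fun w => (sq_le_sq₀ (norm_nonneg _) (mul_nonneg hC (norm_nonneg _))).1
      (Scale.norm_sq_le_of_sum_le _ (hsum w))⟩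

@[simp] theorem IsMultiplier.formal_toCLM {m : Ioi (0 : ℝ) → ℝ} (h : IsMultiplier A s s' m)
    (w : Scale A s) (l : Ioi (0 : ℝ)) : (h.toCLM w).formal l = m l • w.formal l := rfl

/-- `D(A^s)` embeds in `D(A^s')` because the eigenvalues are bounded away from `0`. -/
theorem isMultiplier_one (A : PosOp H) (h : s' ≤ s) : IsMultiplier A s s' 1 := by
  obtain ⟨c, hc, hgap⟩ := exists_spectral_gap A
  refine ⟨⟨c ^ (s' - s), (Real.rpow_pos_of_pos hc _).le, fun l x hx => ?_⟩⟩
  have h1 : (l : ℝ) ^ (s' - s) ≤ c ^ (s' - s) :=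
    Real.rpow_le_rpow_of_nonpos hc (hgap l x hx) (by linarith)
  have h2 : (l : ℝ) ^ s' = (l : ℝ) ^ (s' - s) * (l : ℝ) ^ s := by
    rw [← Real.rpow_add l.2]; ring_nf
  simp only [Pi.one_apply, abs_one, one_mul]
  rw [h2]
  exact mul_le_mul_of_nonneg_right h1 (Real.rpow_pos_of_pos l.2 s).le

/-- The inclusion `D(A^s) → D(A^s')` for `s' ≤ s`. -/
def Scale.incl (A : PosOp H) (h : s' ≤ s) : Scale A s →L[ℝ] Scale A s' :=
  (isMultiplier_one A h).toCLM

@[simp] theorem Scale.formal_incl (h : s' ≤ s) (w : Scale A s) :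
    (Scale.incl A h w).formal = w.formal := by
  funext l
  simp [Scale.incl]

theorem isMultiplier_id (A : PosOp H) (h : s = s' + 1) :
    IsMultiplier A s s' (fun l => (l : ℝ)) := by
  refine ⟨⟨1, zero_le_one, fun l x _ => ?_⟩⟩
  rw [h, Real.rpow_add l.2, Real.rpow_one, abs_of_pos l.2, one_mul, mul_comm]

/-- The operator `A` from `D(A^(s'+1))` to `D(A^s')`. -/
def Scale.opA (A : PosOp H) (h : s = s' + 1) : Scale A s →L[ℝ] Scale A s' :=
  (isMultiplier_id A h).toCLM

@[simp] theorem Scale.formal_opA (h : s = s' + 1) (w : Scale A s) (l : Ioi (0 : ℝ)) :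
    (Scale.opA A h w).formal l = (l : ℝ) • w.formal l := rfl

/-- Dominated convergence in `D(A^s)`: convergence of all components, with a summable bound for the
squared weighted norms of the components. -/
theorem Scale.tendsto_of_dominated {α : Type*} {𝓕 : Filter α} {w : α → Scale A s} {z : Scale A s}
    {β : Ioi (0 : ℝ) → ℝ} (hβ : Summable β)
    (hlim : ∀ l, Tendsto (fun a => (w a).formal l) 𝓕 (𝓝 (z.formal l)))
    (hw : ∀ᶠ a in 𝓕, ∀ l : Ioi (0 : ℝ), ((l : ℝ) ^ s * ‖(w a).formal l‖) ^ 2 ≤ β l) :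
    Tendsto w 𝓕 (𝓝 z) := by
  have hz := z.hasSum_norm_sq.summable
  have key : Tendsto (fun a => ∑' l : Ioi (0 : ℝ), ((l : ℝ) ^ s * ‖(w a - z).formal l‖) ^ 2) 𝓕
      (𝓝 (∑' l : Ioi (0 : ℝ), (0 : ℝ))) := by
    refine tendsto_tsum_of_dominated_convergence
      (bound := fun l => 2 * β l + 2 * ((l : ℝ) ^ s * ‖z.formal l‖) ^ 2)
      ((hβ.mul_left 2).add (hz.mul_left 2)) (fun l => ?_) ?_
    · have h1 : Tendsto (fun a => (w a - z).formal l) 𝓕 (𝓝 0) := by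
        have := (hlim l).sub_const (z.formal l)
        rw [sub_self] at this
        refine this.congr fun a => ?_
        rw [map_sub, Pi.sub_apply]
      have h2 := ((h1.norm.const_mul ((l : ℝ) ^ s)).pow 2)
      simpa using h2
    · filter_upwards [hw] with a ha l
      have hp := (Real.rpow_pos_of_pos l.2 s).le
      rw [Real.norm_of_nonneg (sq_nonneg _), map_sub, Pi.sub_apply]
      have h1 := mul_le_mul_of_nonneg_left (norm_sub_le ((w a).formal l) (z.formal l)) hp
      have h2 : 0 ≤ (l : ℝ) ^ s * ‖(w a).formal l - z.formal l‖ := by positivity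
      have h3 := ha l
      nlinarith [sq_nonneg ((l : ℝ) ^ s * ‖(w a).formal l‖ - (l : ℝ) ^ s * ‖z.formal l‖)]
  rw [tsum_zero] at key
  have key2 : Tendsto (fun a => ‖w a - z‖ ^ 2) 𝓕 (𝓝 0) :=
    key.congr fun a => (w a - z).hasSum_norm_sq.tsum_eq
  rw [tendsto_iff_norm_sub_tendsto_zero]
  have h := key2.sqrt
  simpa [Real.sqrt_sq (norm_nonneg _)] using h

open Classical in
/-- An eigenvector, as an element of `D(A^s)`. -/
def Scale.single (s : ℝ) (l : Ioi (0 : ℝ)) (x : eigenspace A (l : ℝ)) : Scale A s :=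
  Scale.mk (Pi.single l x) <| mem_powDomain_of_summable <|
    summable_of_ne_finset_zero (s := {l}) fun k hk => by
      rw [Pi.single_eq_of_ne (by simpa using hk)]; simp

@[simp] theorem Scale.formal_single_self (l : Ioi (0 : ℝ)) (x : eigenspace A (l : ℝ)) :
    (Scale.single s l x).formal l = x := by
  simp [Scale.single]

theorem Scale.formal_single_of_ne {l k : Ioi (0 : ℝ)} (x : eigenspace A (l : ℝ)) (h : k ≠ l) :
    (Scale.single s l x).formal k = 0 := by
  simp [Scale.single, h]

/-! ### Expansions of vectors -/

/-- Taking orthogonal projections is the adjoint of summing square-summable families. Hence the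
expansion of a vector is square-summable with norm at most that of the vector; it need not be known
here that the eigenspaces span `H`. -/
theorem expand_eq (A : PosOp H) (u : H) :
    expand A u =
      (orthogonalFamily_eigenspace A).linearIsometry.toContinuousLinearMap.adjoint u := by
  classical
  funext l
  refine ext_inner_right ℝ fun x => ?_
  have h1 : inner ℝ (expand A u l) x = inner ℝ u (x : H) := by
    simp [expand]
  rw [h1, ← lp.inner_single_right, ContinuousLinearMap.adjoint_inner_left]
  simp

theorem expand_mem_powDomain (A : PosOp H) (u : H) : expand A u ∈ powDomain A 0 := by
  refine mem_powDomain_of_summable ?_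
  have h := (lp.memℓp
    ((orthogonalFamily_eigenspace A).linearIsometry.toContinuousLinearMap.adjoint u)).summable
    (by norm_num)
  refine h.congr fun l => ?_
  rw [expand_eq]; simp

/-- The expansion of a vector along the eigenspaces, as a linear map `H → D(A^0)`. -/
def expandLinearMap (A : PosOp H) : H →ₗ[ℝ] Scale A 0 where
  toFun u := Scale.mk (expand A u) (expand_mem_powDomain A u)
  map_add' u v := Scale.ext_formal fun l => by simp [expand]
  map_smul' c u := Scale.ext_formal fun l => by simp [expand]

theorem norm_expandLinearMap_le (u : H) : ‖expandLinearMap A u‖ ≤ 1 * ‖u‖ := by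
  have h : ‖expandLinearMap A u‖ =
      ‖(orthogonalFamily_eigenspace A).linearIsometry.toContinuousLinearMap.adjoint u‖ := by
    rw [Scale.norm_def]
    congr 1
    refine lp.ext (funext fun l => ?_)
    rw [← expand_eq, Scale.toLp_apply, Real.rpow_zero, one_smul]
    rfl
  rw [h]
  refine (ContinuousLinearMap.le_opNorm _ u).trans ?_
  refine mul_le_mul_of_nonneg_right ?_ (norm_nonneg _)
  rw [LinearIsometryEquiv.norm_map]
  exact LinearIsometry.norm_toContinuousLinearMap_le _

/-- The expansion of a vector along the eigenspaces, as a bounded map `H → D(A^0)`. -/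
def expandCLM (A : PosOp H) : H →L[ℝ] Scale A 0 :=
  (expandLinearMap A).mkContinuous 1 norm_expandLinearMap_le

@[simp] theorem formal_expandCLM (u : H) : (expandCLM A u).formal = expand A u := rfl

theorem norm_expandCLM_le (u : H) : ‖expandCLM A u‖ ≤ ‖u‖ := by
  have h := norm_expandLinearMap_le (A := A) u
  rw [one_mul] at h
  exact h

theorem expand_eigenvector (l : Ioi (0 : ℝ)) (x : eigenspace A (l : ℝ)) :
    expand A (x : H) = (Scale.single s l x).formal := by
  funext k
  rcases eq_or_ne k l with rfl | hk
  · rw [Scale.formal_single_self]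
    simp [expand]
  · rw [Scale.formal_single_of_ne x hk]
    refine ext_inner_right ℝ fun y => ?_
    simp only [expand, inner_zero_left]
    rw [Submodule.inner_orthogonalProjectionOnto_eq_of_mem_right]
    exact inner_eq_zero_of_mem_eigenspace A (fun h => hk (Subtype.ext h.symm)) x.2 y.2

/-! ### The duality pairing -/

theorem Scale.sum_abs_inner_le (p : Scale A s) (q : Scale A (-s)) (F : Finset (Ioi (0 : ℝ))) :
    ∑ l ∈ F, |inner ℝ (p.formal l : H) (q.formal l : H)| ≤ ‖p‖ * ‖q‖ := by
  calc ∑ l ∈ F, |inner ℝ (p.formal l : H) (q.formal l : H)|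
      ≤ ∑ l ∈ F, ((l : ℝ) ^ s * ‖p.formal l‖) * ((l : ℝ) ^ (-s) * ‖q.formal l‖) := by
        refine Finset.sum_le_sum fun l _ => ?_
        have h := (Real.rpow_pos_of_pos l.2 s).ne'
        refine (abs_real_inner_le_norm _ _).trans (le_of_eq ?_)
        rw [Real.rpow_neg l.2.out.le, Submodule.coe_norm, Submodule.coe_norm]
        field_simp
    _ ≤ √(∑ l ∈ F, ((l : ℝ) ^ s * ‖p.formal l‖) ^ 2) *
        √(∑ l ∈ F, ((l : ℝ) ^ (-s) * ‖q.formal l‖) ^ 2) := Real.sum_mul_le_sqrt_mul_sqrt _ _ _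
    _ ≤ ‖p‖ * ‖q‖ := by
        refine mul_le_mul ?_ ?_ (Real.sqrt_nonneg _) (norm_nonneg _)
        · exact Real.sqrt_le_iff.2 ⟨norm_nonneg _, p.sum_le_norm_sq F⟩
        · exact Real.sqrt_le_iff.2 ⟨norm_nonneg _, q.sum_le_norm_sq F⟩

end HilbertScale

/-! ### The scalar linear equation in one eigenspace -/

section Component

variable {G : Type*} [NormedAddCommGroup G] [InnerProductSpace ℝ G]

/-- The solution of `u' + a u = f`, `u(0) = x`. -/
def expSol (a : ℝ) (x : G) (f : ℝ → G) (t : ℝ) : G :=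
  Real.exp (-(a * t)) • (x + ∫ s in (0 : ℝ)..t, Real.exp (a * s) • f s)

@[simp] theorem expSol_zero (a : ℝ) (x : G) (f : ℝ → G) : expSol a x f 0 = x := by
  simp [expSol]

theorem expSol_congr (a : ℝ) (x : G) {f g : ℝ → G} {t : ℝ} (ht : 0 ≤ t)
    (h : ∀ s ∈ Icc 0 t, f s = g s) : expSol a x f t = expSol a x g t := by
  unfold expSol
  congr 2
  refine intervalIntegral.integral_congr fun s hs => ?_
  rw [uIcc_of_le ht] at hs
  simp only [h s hs]

theorem expSol_sub (a : ℝ) (x y : G) {f g : ℝ → G} (hf : Continuous f) (hg : Continuous g)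
    (t : ℝ) : expSol a (x - y) (fun s => f s - g s) t = expSol a x f t - expSol a y g t := by
  unfold expSol
  simp only [smul_sub]
  rw [intervalIntegral.integral_sub]
  · simp only [smul_add, smul_sub]; abel
  · exact Continuous.intervalIntegrable (by fun_prop) _ _
  · exact Continuous.intervalIntegrable (by fun_prop) _ _

/-- The semigroup property of variation of constants. -/
theorem expSol_add_time (a : ℝ) (x : G) {f : ℝ → G} (hf : Continuous f) (h t : ℝ) :
    expSol a x f (h + t) = expSol a (expSol a x f h) (fun s => f (h + s)) t := by
  unfold expSol
  have h1 : ∫ s in (0 : ℝ)..t, Real.exp (a * s) • f (h + s) =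
      Real.exp (-(a * h)) • ∫ s in h..(h + t), Real.exp (a * s) • f s := by
    have := intervalIntegral.integral_comp_add_left
      (fun s => Real.exp (-(a * h)) • Real.exp (a * s) • f s) h (a := 0) (b := t)
    rw [add_zero] at this
    rw [← intervalIntegral.integral_smul, ← this]
    refine intervalIntegral.integral_congr fun s _ => ?_
    simp only [smul_smul, ← Real.exp_add]
    ring_nf
  have h2 : Continuous fun s => Real.exp (a * s) • f s := by fun_prop
  have h3 := intervalIntegral.integral_add_adjacent_intervals
    (h2.intervalIntegrable (μ := volume) 0 h) (h2.intervalIntegrable h (h + t))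
  rw [h1, ← smul_add, smul_smul, ← Real.exp_add, ← h3, ← add_assoc]
  ring_nf

variable [CompleteSpace G]

theorem hasDerivAt_expSol (a : ℝ) (x : G) {f : ℝ → G} (hf : Continuous f) (t : ℝ) :
    HasDerivAt (expSol a x f) (-(a • expSol a x f t) + f t) t := by
  have hc : Continuous fun s => Real.exp (a * s) • f s := by fun_prop
  have h1 : HasDerivAt (fun t => ∫ s in (0 : ℝ)..t, Real.exp (a * s) • f s)
      (Real.exp (a * t) • f t) t :=
    intervalIntegral.integral_hasDerivAt_right (hc.intervalIntegrable _ _)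
      (hc.stronglyMeasurableAtFilter _ _) hc.continuousAt
  have h2 : HasDerivAt (fun t => Real.exp (-(a * t))) (Real.exp (-(a * t)) * -a) t := by
    have h := ((hasDerivAt_id t).const_mul a).neg.exp
    simpa using h
  refine (h2.smul (h1.const_add x)).congr_deriv ?_
  rw [smul_smul, ← Real.exp_add]
  simp only [expSol, neg_add_cancel, Real.exp_zero, one_smul, smul_smul]
  rw [add_comm, mul_neg, neg_smul, mul_comm a, mul_comm a]

theorem continuous_expSol (a : ℝ) (x : G) {f : ℝ → G} (hf : Continuous f) :
    Continuous (expSol a x f) :=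
  continuous_iff_continuousAt.2 fun t => (hasDerivAt_expSol a x hf t).continuousAt

theorem integral_deriv_expSol (a : ℝ) (x : G) {f : ℝ → G} (hf : Continuous f) (t : ℝ) :
    ∫ s in (0 : ℝ)..t, (-(a • expSol a x f s) + f s) = expSol a x f t - x := by
  have hc := continuous_expSol a x hf
  have h := intervalIntegral.integral_eq_sub_of_hasDerivAt (a := 0) (b := t)
    (fun s _ => hasDerivAt_expSol a x hf s) (Continuous.intervalIntegrable (by fun_prop) _ _)
  rwa [expSol_zero] at h

/-- The energy estimate. The energy minus the work has derivative
`-‖l u - f‖² - 2 l d ‖u‖² ≤ 0`. -/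
theorem expSol_energy {l d : ℝ} (hl : 0 ≤ l) (hd : 0 ≤ d) (x : G) {f : ℝ → G} (hf : Continuous f)
    {t : ℝ} (ht : 0 ≤ t) :
    l * ‖expSol (l + d) x f t‖ ^ 2 + ∫ s in (0 : ℝ)..t, (l * ‖expSol (l + d) x f s‖) ^ 2
      ≤ l * ‖x‖ ^ 2 + ∫ s in (0 : ℝ)..t, ‖f s‖ ^ 2 := by
  have hu := continuous_expSol (l + d) x hf
  set u := expSol (l + d) x f with hudef
  have hc : Continuous fun s => (l * ‖u s‖) ^ 2 - ‖f s‖ ^ 2 := by fun_prop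
  have hder (τ : ℝ) : HasDerivAt
      (fun τ => l * ‖u τ‖ ^ 2 + ∫ s in (0 : ℝ)..τ, ((l * ‖u s‖) ^ 2 - ‖f s‖ ^ 2))
      (l * (2 * inner ℝ (u τ) (-((l + d) • u τ) + f τ)) + ((l * ‖u τ‖) ^ 2 - ‖f τ‖ ^ 2)) τ :=
    ((hasDerivAt_expSol (l + d) x hf τ).norm_sq.const_mul l).add
      (intervalIntegral.integral_hasDerivAt_right (hc.intervalIntegrable _ _)
        (hc.stronglyMeasurableAtFilter _ _) hc.continuousAt)
  have hanti : Antitone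
      (fun τ => l * ‖u τ‖ ^ 2 + ∫ s in (0 : ℝ)..τ, ((l * ‖u s‖) ^ 2 - ‖f s‖ ^ 2)) := by
    refine antitone_of_deriv_nonpos (fun τ => (hder τ).differentiableAt) fun τ => ?_
    rw [(hder τ).deriv, inner_add_right, inner_neg_right, real_inner_smul_right,
      real_inner_self_eq_norm_sq]
    have h1 : ‖l • u τ - f τ‖ ^ 2 =
        l ^ 2 * ‖u τ‖ ^ 2 - 2 * (l * inner ℝ (u τ) (f τ)) + ‖f τ‖ ^ 2 := by
      rw [norm_sub_sq_real, norm_smul, real_inner_smul_left, Real.norm_of_nonneg hl, mul_pow]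
    have h2 : 0 ≤ l * d * ‖u τ‖ ^ 2 := by positivity
    nlinarith [sq_nonneg ‖l • u τ - f τ‖]
  have h := hanti ht
  simp only [intervalIntegral.integral_same, add_zero] at h
  have hu0 : u 0 = x := expSol_zero _ _ _
  rw [intervalIntegral.integral_sub (Continuous.intervalIntegrable (by fun_prop) _ _)
    (Continuous.intervalIntegrable (by fun_prop) _ _), hu0] at h
  linarith

end Component

/-! ### The linear equation in the scale -/

section Linear

variable {H : Type*} [NormedAddCommGroup H] [InnerProductSpace ℝ H] [CompleteSpace H]
variable {A : PosOp H} {d : ℝ}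

theorem Scale.continuous_formal {s : ℝ} {X : Type*} [TopologicalSpace X] {f : X → Scale A s}
    (hf : Continuous f) (l : Ioi (0 : ℝ)) : Continuous fun t => (f t).formal l :=
  (Scale.comp A s l).continuous.comp hf

/-- The formal solution of `u' + A u + d u = f`, `u(0) = x`. -/
def mildFormal (d : ℝ) (x : Scale A (1 / 2)) (f : C(ℝ, Scale A 0)) (t : ℝ) : Formal A :=
  fun l => expSol (l + d) (x.formal l) (fun s => (f s).formal l) t

theorem rpow_half_mul_sq {l : ℝ} (hl : 0 < l) (y : ℝ) : (l ^ (1 / 2 : ℝ) * y) ^ 2 = l * y ^ 2 := by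
  rw [mul_pow, ← Real.rpow_natCast, ← Real.rpow_mul hl.le]
  norm_num

theorem integral_sum_norm_formal_le (f : C(ℝ, Scale A 0)) {t : ℝ} (ht : 0 ≤ t)
    (F : Finset (Ioi (0 : ℝ))) :
    ∑ l ∈ F, ∫ s in (0 : ℝ)..t, ‖(f s).formal l‖ ^ 2 ≤ ∫ s in (0 : ℝ)..t, ‖f s‖ ^ 2 := by
  have hc (l : Ioi (0 : ℝ)) : Continuous fun s => ‖(f s).formal l‖ ^ 2 :=
    (Scale.continuous_formal f.continuous l).norm.pow 2
  rw [← intervalIntegral.integral_finsetSum fun l _ => (hc l).intervalIntegrable _ _]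
  refine intervalIntegral.integral_mono_on ht
    (Continuous.intervalIntegrable (continuous_finsetSum _ fun l _ => hc l) _ _)
    (Continuous.intervalIntegrable (by fun_prop) _ _) fun s _ => ?_
  simpa using (f s).sum_le_norm_sq F

theorem mildFormal_sum_le (hd : 0 ≤ d) (x : Scale A (1 / 2)) (f : C(ℝ, Scale A 0)) {t : ℝ}
    (ht : 0 ≤ t) (F : Finset (Ioi (0 : ℝ))) :
    ∑ l ∈ F, ((l : ℝ) ^ (1 / 2 : ℝ) * ‖mildFormal d x f t l‖) ^ 2 +
      ∑ l ∈ F, ∫ s in (0 : ℝ)..t, ((l : ℝ) * ‖mildFormal d x f s l‖) ^ 2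
      ≤ ‖x‖ ^ 2 + ∫ s in (0 : ℝ)..t, ‖f s‖ ^ 2 := by
  refine le_trans ?_ (add_le_add (x.sum_le_norm_sq F) (integral_sum_norm_formal_le f ht F))
  rw [← Finset.sum_add_distrib, ← Finset.sum_add_distrib]
  refine Finset.sum_le_sum fun l _ => ?_
  rw [rpow_half_mul_sq l.2, rpow_half_mul_sq l.2]
  exact expSol_energy l.2.out.le hd _ (Scale.continuous_formal f.continuous l) ht

theorem mildFormal_mem (hd : 0 ≤ d) (x : Scale A (1 / 2)) (f : C(ℝ, Scale A 0)) {t : ℝ}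
    (ht : 0 ≤ t) : mildFormal d x f t ∈ powDomain A (1 / 2) := by
  refine mem_powDomain_of_sum_le fun F => le_trans ?_ (mildFormal_sum_le hd x f ht F)
  refine le_add_of_nonneg_right (Finset.sum_nonneg fun l _ => ?_)
  exact intervalIntegral.integral_nonneg ht fun s _ => sq_nonneg _

open Classical in
/-- The mild solution of `u' + A u + d u = f`, `u(0) = x`, with values in `D(A^(1/2))`. It is
frozen at `x` for negative times, so that it is continuous on the whole line. -/
def sol (d : ℝ) (x : Scale A (1 / 2)) (f : C(ℝ, Scale A 0)) (t : ℝ) : Scale A (1 / 2) :=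
  if h : mildFormal d x f (max t 0) ∈ powDomain A (1 / 2) then Scale.mk _ h else 0

theorem formal_sol' (hd : 0 ≤ d) (x : Scale A (1 / 2)) (f : C(ℝ, Scale A 0)) (t : ℝ) :
    (sol d x f t).formal = mildFormal d x f (max t 0) := by
  rw [sol, dif_pos (mildFormal_mem hd x f (le_max_right _ _)), Scale.formal_mk]

theorem formal_sol (hd : 0 ≤ d) (x : Scale A (1 / 2)) (f : C(ℝ, Scale A 0)) {t : ℝ} (ht : 0 ≤ t) :
    (sol d x f t).formal = mildFormal d x f t := by
  rw [formal_sol' hd, max_eq_left ht]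

theorem sol_of_nonpos (hd : 0 ≤ d) (x : Scale A (1 / 2)) (f : C(ℝ, Scale A 0)) {t : ℝ}
    (ht : t ≤ 0) : sol d x f t = x := by
  refine Scale.ext_formal fun l => ?_
  rw [formal_sol' hd, max_eq_right ht, mildFormal, expSol_zero]

theorem norm_sol_sq_le (hd : 0 ≤ d) (x : Scale A (1 / 2)) (f : C(ℝ, Scale A 0)) {t : ℝ}
    (ht : 0 ≤ t) : ‖sol d x f t‖ ^ 2 ≤ ‖x‖ ^ 2 + ∫ s in (0 : ℝ)..t, ‖f s‖ ^ 2 := by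
  refine Scale.norm_sq_le_of_sum_le _ fun F => le_trans ?_ (mildFormal_sum_le hd x f ht F)
  rw [formal_sol hd x f ht]
  refine le_add_of_nonneg_right (Finset.sum_nonneg fun l _ => ?_)
  exact intervalIntegral.integral_nonneg ht fun s _ => sq_nonneg _

theorem sol_sub (hd : 0 ≤ d) (x y : Scale A (1 / 2)) (f g : C(ℝ, Scale A 0)) (t : ℝ) :
    sol d (x - y) (f - g) t = sol d x f t - sol d y g t := by
  refine Scale.ext_formal fun l => ?_
  rw [map_sub, Pi.sub_apply, formal_sol' hd, formal_sol' hd, formal_sol' hd]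
  simp only [mildFormal]
  rw [← expSol_sub _ _ _ (Scale.continuous_formal f.continuous l)
    (Scale.continuous_formal g.continuous l)]
  simp only [map_sub, Pi.sub_apply, ContinuousMap.sub_apply]

theorem sol_congr (hd : 0 ≤ d) (x : Scale A (1 / 2)) {f g : C(ℝ, Scale A 0)} {t : ℝ}
    (h : ∀ s ∈ Icc 0 t, f s = g s) : sol d x f t = sol d x g t := by
  rcases le_total t 0 with ht | ht
  · rw [sol_of_nonpos hd _ _ ht, sol_of_nonpos hd _ _ ht]
  refine Scale.ext_formal fun l => ?_
  rw [formal_sol hd _ _ ht, formal_sol hd _ _ ht]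
  exact expSol_congr _ _ ht fun s hs => by rw [h s hs]

theorem sol_add_time (hd : 0 ≤ d) (x : Scale A (1 / 2)) (f g : C(ℝ, Scale A 0)) {h t : ℝ}
    (hh : 0 ≤ h) (ht : 0 ≤ t) (hfg : ∀ s ∈ Icc 0 t, g s = f (h + s)) :
    sol d x f (h + t) = sol d (sol d x f h) g t := by
  refine Scale.ext_formal fun l => ?_
  rw [formal_sol hd _ _ ht, formal_sol hd _ _ (by positivity)]
  simp only [mildFormal]
  rw [formal_sol hd _ _ hh, expSol_add_time _ _ (Scale.continuous_formal f.continuous l)]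
  exact expSol_congr _ _ ht fun s hs => by rw [hfg s hs]

theorem continuous_formal_sol (hd : 0 ≤ d) (x : Scale A (1 / 2)) (f : C(ℝ, Scale A 0))
    (l : Ioi (0 : ℝ)) : Continuous fun t => (sol d x f t).formal l := by
  simp only [formal_sol' hd, mildFormal]
  exact (continuous_expSol _ _ (Scale.continuous_formal f.continuous l)).comp (by fun_prop)

/-- Each component is continuous, and by the energy estimate in each eigenspace the components are
dominated, locally uniformly in time. -/
theorem continuous_sol (hd : 0 ≤ d) (x : Scale A (1 / 2)) (f : C(ℝ, Scale A 0)) :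
    Continuous (sol d x f) := by
  rw [continuous_iff_continuousAt]
  intro t₀
  have hT : 0 ≤ max (t₀ + 1) 0 := le_max_right _ _
  set T := max (t₀ + 1) 0 with hTdef
  have hc (l : Ioi (0 : ℝ)) : Continuous fun s => ‖(f s).formal l‖ ^ 2 :=
    (Scale.continuous_formal f.continuous l).norm.pow 2
  refine Scale.tendsto_of_dominated
    (β := fun l => ((l : ℝ) ^ (1 / 2 : ℝ) * ‖x.formal l‖) ^ 2 +
      ∫ s in (0 : ℝ)..T, ‖(f s).formal l‖ ^ 2) ?_
    (fun l => (continuous_formal_sol hd x f l).tendsto t₀) ?_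
  · refine x.hasSum_norm_sq.summable.add ?_
    exact summable_of_sum_le
      (fun l => intervalIntegral.integral_nonneg hT fun s _ => sq_nonneg _)
      (integral_sum_norm_formal_le f hT)
  · filter_upwards [Iic_mem_nhds (lt_add_one t₀)] with t ht l
    have ht0 : 0 ≤ max t 0 := le_max_right _ _
    have htT : max t 0 ≤ T := max_le_max_right 0 ht
    rw [formal_sol' hd, rpow_half_mul_sq l.2, rpow_half_mul_sq l.2]
    have h1 := expSol_energy l.2.out.le hd (x.formal l) (Scale.continuous_formal f.continuous l) ht0
    have h2 : 0 ≤ ∫ s in (0 : ℝ)..(max t 0),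
        ((l : ℝ) * ‖expSol (l + d) (x.formal l) (fun s => (f s).formal l) s‖) ^ 2 :=
      intervalIntegral.integral_nonneg ht0 fun s _ => sq_nonneg _
    have h3 : ∫ s in (0 : ℝ)..(max t 0), ‖(f s).formal l‖ ^ 2 ≤
        ∫ s in (0 : ℝ)..T, ‖(f s).formal l‖ ^ 2 :=
      intervalIntegral.integral_mono_interval le_rfl ht0 htT
        (Eventually.of_forall fun s => sq_nonneg _) ((hc l).intervalIntegrable _ _)
    change (l : ℝ) * ‖expSol _ _ _ _‖ ^ 2 ≤ _
    linarith

/-- The solution as a curve in `D(A^(-1/2))`. -/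
def solNeg (d : ℝ) (x : Scale A (1 / 2)) (f : C(ℝ, Scale A 0)) (t : ℝ) : Scale A (-(1 / 2)) :=
  Scale.incl A (by norm_num) (sol d x f t)

/-- The time derivative `-A u - d u + f` of the solution, for times `t ≥ 0`. -/
def solDeriv (d : ℝ) (x : Scale A (1 / 2)) (f : C(ℝ, Scale A 0)) (t : ℝ) : Scale A (-(1 / 2)) :=
  -(Scale.opA A (by norm_num) (sol d x f t)) - d • solNeg d x f t + Scale.incl A (by norm_num) (f t)

theorem continuous_solNeg (hd : 0 ≤ d) (x : Scale A (1 / 2)) (f : C(ℝ, Scale A 0)) :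
    Continuous (solNeg d x f) :=
  (Scale.incl A _).continuous.comp (continuous_sol hd x f)

@[simp] theorem formal_solNeg (x : Scale A (1 / 2)) (f : C(ℝ, Scale A 0)) (t : ℝ) :
    (solNeg d x f t).formal = (sol d x f t).formal := Scale.formal_incl _ _

theorem continuous_solDeriv (hd : 0 ≤ d) (x : Scale A (1 / 2)) (f : C(ℝ, Scale A 0)) :
    Continuous (solDeriv d x f) :=
  (((Scale.opA A _).continuous.comp (continuous_sol hd x f)).neg.sub
    ((continuous_solNeg hd x f).const_smul d)).add ((Scale.incl A _).continuous.comp f.continuous)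

theorem formal_solDeriv (hd : 0 ≤ d) (x : Scale A (1 / 2)) (f : C(ℝ, Scale A 0)) {t : ℝ}
    (ht : 0 ≤ t) (l : Ioi (0 : ℝ)) : (solDeriv d x f t).formal l =
      -((l + d : ℝ) • expSol (l + d : ℝ) (x.formal l) (fun s => (f s).formal l) t) +
        (f t).formal l := by
  rw [solDeriv, map_add, map_sub, map_neg, map_smul, Pi.add_apply, Pi.sub_apply, Pi.neg_apply,
    Pi.smul_apply, Scale.formal_opA, formal_solNeg, formal_sol hd x f ht, Scale.formal_incl,
    mildFormal, add_smul, neg_add, sub_eq_add_neg]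

theorem solNeg_eq_integral (hd : 0 ≤ d) (x : Scale A (1 / 2)) (f : C(ℝ, Scale A 0)) {t : ℝ}
    (ht : 0 ≤ t) : solNeg d x f t = solNeg d x f 0 + ∫ s in (0 : ℝ)..t, solDeriv d x f s := by
  refine Scale.ext_formal fun l => ?_
  have hf := Scale.continuous_formal f.continuous l
  have hcomm := (Scale.comp A (-(1 / 2)) l).intervalIntegral_comp_comm
    ((continuous_solDeriv hd x f).intervalIntegrable (μ := volume) 0 t)
  have hftc := integral_deriv_expSol (l + d : ℝ) (x.formal l) hf t
  have hcongr : ∫ s in (0 : ℝ)..t, Scale.comp A (-(1 / 2)) l (solDeriv d x f s) =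
      ∫ s in (0 : ℝ)..t,
      (-((l + d : ℝ) • expSol (l + d : ℝ) (x.formal l) (fun s => (f s).formal l) s) +
        (f s).formal l) := by
    refine intervalIntegral.integral_congr fun s hs => ?_
    rw [uIcc_of_le ht] at hs
    exact formal_solDeriv hd x f hs.1 l
  rw [hcongr, hftc] at hcomm
  rw [map_add, Pi.add_apply, ← Scale.comp_apply (∫ s in (0 : ℝ)..t, solDeriv d x f s), ← hcomm,
    formal_solNeg, formal_solNeg, formal_sol hd _ _ ht, sol_of_nonpos hd _ _ le_rfl, mildFormal]
  abel

end Linear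

/-! ### Integration by parts -/

section Parts

variable {G : Type*} [NormedAddCommGroup G] [InnerProductSpace ℝ G] [CompleteSpace G]

/-- Integration by parts against a function `w` that is only absolutely continuous. Both sides are
the integral of `⟪u' t, w' s⟫` over the triangle `0 < t < s ≤ T`. -/
theorem integral_inner_deriv_eq {T : ℝ} (hT : 0 ≤ T) {u u' w w' : ℝ → G} (hu' : Continuous u')
    (hu : ∀ t, HasDerivAt u (u' t) t) (hw' : IntegrableOn w' (Ioc 0 T)) (hw : HasTimeDeriv T w w')
    (hwT : w T = 0) :
    ∫ t in (0 : ℝ)..T, inner ℝ (u t) (w' t) =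
      -inner ℝ (u 0) (w 0) - ∫ t in (0 : ℝ)..T, inner ℝ (u' t) (w t) := by
  have huc : Continuous u := continuous_iff_continuousAt.2 fun t => (hu t).continuousAt
  set μ : Measure ℝ := volume.restrict (Ioc 0 T) with hμ
  have hu'i : Integrable u' μ := hu'.integrableOn_Ioc
  have hS : MeasurableSet {p : ℝ × ℝ | p.1 < p.2} := measurableSet_lt measurable_fst measurable_snd
  have hint : Integrable ({p : ℝ × ℝ | p.1 < p.2}.indicator
      fun p => (inner ℝ (u' p.1) (w' p.2) : ℝ)) (μ.prod μ) := by
    refine Integrable.indicator ?_ hS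
    refine (hu'i.norm.mul_prod hw'.norm).mono
      (hu'i.aestronglyMeasurable.comp_fst.inner hw'.aestronglyMeasurable.comp_snd) ?_
    exact Eventually.of_forall fun p => by
      simpa using abs_real_inner_le_norm (u' p.1) (w' p.2)
  have hswap := integral_integral_swap (f := fun t s => {p : ℝ × ℝ | p.1 < p.2}.indicator
      (fun p => (inner ℝ (u' p.1) (w' p.2) : ℝ)) (t, s)) hint
  have hL : ∀ t ∈ Ioc 0 T, ∫ s, {p : ℝ × ℝ | p.1 < p.2}.indicator
      (fun p => (inner ℝ (u' p.1) (w' p.2) : ℝ)) (t, s) ∂μ = -inner ℝ (u' t) (w t) := by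
    intro t ht
    have h1 : (fun s => {p : ℝ × ℝ | p.1 < p.2}.indicator
        (fun p => (inner ℝ (u' p.1) (w' p.2) : ℝ)) (t, s)) =
        (Ioi t).indicator fun s => inner ℝ (u' t) (w' s) := by
      funext s
      simp [indicator]
    have h2 : Ioi t ∩ Ioc 0 T = Ioc t T := by
      ext s; simp only [mem_inter_iff, mem_Ioi, mem_Ioc]
      constructor
      · rintro ⟨h, _, h'⟩; exact ⟨h, h'⟩
      · rintro ⟨h, h'⟩; exact ⟨h, ht.1.trans h, h'⟩
    have hi1 : IntervalIntegrable w' volume 0 t :=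
      (intervalIntegrable_iff_integrableOn_Ioc_of_le ht.1.le).2
        (hw'.mono_set (Ioc_subset_Ioc_right ht.2))
    have hi2 : IntervalIntegrable w' volume t T :=
      (intervalIntegrable_iff_integrableOn_Ioc_of_le ht.2).2
        (hw'.mono_set (Ioc_subset_Ioc_left ht.1.le))
    have h3 : ∫ s in t..T, w' s = -w t := by
      have e1 := hw T ⟨hT, le_rfl⟩
      rw [hwT, ← intervalIntegral.integral_add_adjacent_intervals hi1 hi2, ← add_assoc,
        ← hw t ⟨ht.1.le, ht.2⟩] at e1
      exact (neg_eq_of_add_eq_zero_right e1.symm).symm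
    rw [h1, integral_indicator measurableSet_Ioi, hμ, Measure.restrict_restrict measurableSet_Ioi,
      h2, integral_inner ((intervalIntegrable_iff_integrableOn_Ioc_of_le ht.2).1 hi2),
      ← intervalIntegral.integral_of_le ht.2, h3, inner_neg_right]
  have hR : ∀ s ∈ Ioc 0 T, ∫ t, {p : ℝ × ℝ | p.1 < p.2}.indicator
      (fun p => (inner ℝ (u' p.1) (w' p.2) : ℝ)) (t, s) ∂μ = inner ℝ (u s - u 0) (w' s) := by
    intro s hs
    have h1 : (fun t => {p : ℝ × ℝ | p.1 < p.2}.indicator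
        (fun p => (inner ℝ (u' p.1) (w' p.2) : ℝ)) (t, s)) =
        (Iio s).indicator fun t => inner ℝ (w' s) (u' t) := by
      funext t
      simp [indicator, real_inner_comm]
    have h2 : Iio s ∩ Ioc 0 T = Ioo 0 s := by
      ext t; simp only [mem_inter_iff, mem_Iio, mem_Ioc, mem_Ioo]
      constructor
      · rintro ⟨h, h', _⟩; exact ⟨h', h⟩
      · rintro ⟨h, h'⟩; exact ⟨h', h, h'.le.trans hs.2⟩
    have hftc := intervalIntegral.integral_eq_sub_of_hasDerivAt (a := 0) (b := s)
      (fun t _ => hu t) (hu'.intervalIntegrable _ _)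
    rw [h1, integral_indicator measurableSet_Iio, hμ, Measure.restrict_restrict measurableSet_Iio,
      h2, ← integral_Ioc_eq_integral_Ioo, integral_inner hu'.integrableOn_Ioc,
      ← intervalIntegral.integral_of_le hs.1.le, hftc, real_inner_comm]
  have hL' := setIntegral_congr_fun (μ := volume) measurableSet_Ioc hL
  have hR' := setIntegral_congr_fun (μ := volume) measurableSet_Ioc hR
  rw [← hμ] at hL' hR'
  rw [hL', hR', integral_neg, hμ, ← intervalIntegral.integral_of_le hT,
    ← intervalIntegral.integral_of_le hT] at hswap
  have hw'I : IntervalIntegrable w' volume 0 T :=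
    (intervalIntegrable_iff_integrableOn_Ioc_of_le hT).2 hw'
  have hi1 : IntervalIntegrable (fun s => (inner ℝ (u s) (w' s) : ℝ)) volume 0 T := by
    rw [intervalIntegrable_iff_integrableOn_Ioc_of_le hT]
    obtain ⟨C, hC⟩ := (isCompact_Icc (a := (0 : ℝ)) (b := T)).exists_bound_of_continuousOn
      huc.continuousOn
    refine (hw'.norm.const_mul C).mono' (huc.aestronglyMeasurable.inner hw'.aestronglyMeasurable) ?_
    refine (ae_restrict_iff' measurableSet_Ioc).2 (Eventually.of_forall fun s hs => ?_)
    exact (norm_inner_le_norm _ _).trans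
      (mul_le_mul_of_nonneg_right (hC s ⟨hs.1.le, hs.2⟩) (norm_nonneg _))
  have hi2 : IntervalIntegrable (fun s => (inner ℝ (u 0) (w' s) : ℝ)) volume 0 T :=
    (intervalIntegrable_iff_integrableOn_Ioc_of_le hT).2 (hw'.const_inner _)
  have h0 : ∫ s in (0 : ℝ)..T, (inner ℝ (u 0) (w' s) : ℝ) = -inner ℝ (u 0) (w 0) := by
    have e1 := hw T ⟨hT, le_rfl⟩
    rw [hwT] at e1
    rw [intervalIntegral.integral_of_le hT, integral_inner hw',
      ← intervalIntegral.integral_of_le hT, ← inner_neg_right,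
      (neg_eq_of_add_eq_zero_right e1.symm)]
  simp only [inner_sub_left] at hswap
  rw [intervalIntegral.integral_sub hi1 hi2, h0] at hswap
  linarith

end Parts

section Weak

variable {H : Type*} [NormedAddCommGroup H] [InnerProductSpace ℝ H] [CompleteSpace H]
variable {A : PosOp H} {d : ℝ}

/-! ### Square integrability with values in `D(A)` -/

/-- The spectral cut-off at level `k` maps `D(A^(1/2))` to `D(A)`. -/
theorem isMultiplier_cutoff (A : PosOp H) (k : ℕ) :
    IsMultiplier A (1 / 2) 1 ((Iic (k : ℝ)).indicator 1 ∘ Subtype.val) := by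
  refine ⟨⟨(k : ℝ) ^ (1 / 2 : ℝ), by positivity, fun l x _ => ?_⟩⟩
  have hp := (Real.rpow_pos_of_pos l.2 (1 / 2)).le
  by_cases h : (l : ℝ) ≤ k
  · have h1 : (l : ℝ) ^ (1 : ℝ) = (l : ℝ) ^ (1 / 2 : ℝ) * (l : ℝ) ^ (1 / 2 : ℝ) := by
      rw [← Real.rpow_add l.2]; norm_num
    simp only [Function.comp_apply, indicator, mem_Iic, h, if_true, Pi.one_apply, abs_one, one_mul]
    rw [h1]
    exact mul_le_mul_of_nonneg_right (Real.rpow_le_rpow l.2.out.le h (by norm_num)) hp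
  · simp only [Function.comp_apply, indicator, mem_Iic, h, if_false, abs_zero, zero_mul]
    positivity

/-- Only the eigenvalues contribute to sums over `l > 0`. They are countable when `H` is separable,
as the exchange of sums and integrals requires. -/
theorem tsum_eigenvalues_eq {M : Type*} [AddCommMonoid M] [TopologicalSpace M]
    {g : Ioi (0 : ℝ) → M} (h : ∀ l : Ioi (0 : ℝ), (∀ x : eigenspace A (l : ℝ), x = 0) → g l = 0) :
    ∑' l : eigenvalues A, g (l : Ioi (0 : ℝ)) = ∑' l, g l := by
  refine tsum_subtype_eq_of_support_subset fun l hl => ?_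
  by_contra hcon
  simp only [eigenvalues, mem_ofPred_eq, not_exists, not_not] at hcon
  exact hl (h l hcon)

theorem lintegral_sq_formal_sol_le [TopologicalSpace.SeparableSpace H] (hd : 0 ≤ d)
    (x : Scale A (1 / 2)) (f : C(ℝ, Scale A 0)) {T : ℝ} (hT : 0 ≤ T) :
    ∫⁻ t in Ioc 0 T, ∑' l : Ioi (0 : ℝ), ENNReal.ofReal (((l : ℝ) * ‖(sol d x f t).formal l‖) ^ 2)
      ≤ ENNReal.ofReal (‖x‖ ^ 2 + ∫ s in (0 : ℝ)..T, ‖f s‖ ^ 2) := by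
  have hcount : Countable (eigenvalues A) :=
    (countable_eigenvalues A).to_subtype
  have hc (l : Ioi (0 : ℝ)) : Continuous fun t => ((l : ℝ) * ‖(sol d x f t).formal l‖) ^ 2 :=
    ((continuous_formal_sol hd x f l).norm.const_mul _).pow 2
  have h1 (t : ℝ) := tsum_eigenvalues_eq (A := A)
    (g := fun l => ENNReal.ofReal (((l : ℝ) * ‖(sol d x f t).formal l‖) ^ 2))
    fun l hl => by rw [hl ((sol d x f t).formal l)]; simp
  have h2 := tsum_eigenvalues_eq (A := A)
    (g := fun l => ∫⁻ t in Ioc 0 T, ENNReal.ofReal (((l : ℝ) * ‖(sol d x f t).formal l‖) ^ 2))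
    fun l hl => by
      have h0 (t : ℝ) : (sol d x f t).formal l = 0 := hl _
      simp [h0]
  simp only [← h1]
  rw [lintegral_tsum fun l : eigenvalues A => ((hc l).measurable.ennreal_ofReal).aemeasurable, h2]
  refine ENNReal.summable.tsum_le_of_sum_le fun (F : Finset (Ioi (0 : ℝ))) => ?_
  have h3 (l : Ioi (0 : ℝ)) :
      ∫⁻ t in Ioc 0 T, ENNReal.ofReal (((l : ℝ) * ‖(sol d x f t).formal l‖) ^ 2) =
      ENNReal.ofReal (∫ t in (0 : ℝ)..T, ((l : ℝ) * ‖mildFormal d x f t l‖) ^ 2) := by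
    rw [intervalIntegral.integral_congr (g := fun t => ((l : ℝ) * ‖(sol d x f t).formal l‖) ^ 2),
      intervalIntegral.integral_of_le hT, ofReal_integral_eq_lintegral_ofReal
      (hc l).integrableOn_Ioc (Eventually.of_forall fun t => sq_nonneg _)]
    intro t ht
    rw [uIcc_of_le hT] at ht
    simp only [formal_sol hd x f ht.1]
  simp only [h3]
  rw [← ENNReal.ofReal_sum_of_nonneg fun l _ =>
    intervalIntegral.integral_nonneg hT fun s _ => sq_nonneg _]
  refine ENNReal.ofReal_le_ofReal (le_trans ?_ (mildFormal_sum_le hd x f hT F))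
  exact le_add_of_nonneg_left (Finset.sum_nonneg fun l _ => sq_nonneg _)

theorem measurable_tsum_sq_formal_sol [TopologicalSpace.SeparableSpace H] (hd : 0 ≤ d)
    (x : Scale A (1 / 2)) (f : C(ℝ, Scale A 0)) : Measurable fun t =>
      ∑' l : Ioi (0 : ℝ), ENNReal.ofReal (((l : ℝ) * ‖(sol d x f t).formal l‖) ^ 2) := by
  have hcount : Countable (eigenvalues A) := (countable_eigenvalues A).to_subtype
  have h1 (t : ℝ) := tsum_eigenvalues_eq (A := A)
    (g := fun l => ENNReal.ofReal (((l : ℝ) * ‖(sol d x f t).formal l‖) ^ 2))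
    fun l hl => by rw [hl ((sol d x f t).formal l)]; simp
  simp only [← h1]
  refine Measurable.tsum fun l => ?_
  exact (((continuous_formal_sol hd x f l).norm.const_mul _).pow 2).measurable.ennreal_ofReal

theorem Scale.enorm_sq_eq {s : ℝ} (w : Scale A s) : ‖w‖ₑ ^ 2 =
    ∑' l : Ioi (0 : ℝ), ENNReal.ofReal (((l : ℝ) ^ s * ‖w.formal l‖) ^ 2) := by
  have h := w.hasSum_norm_sq
  rw [← ofReal_norm, ← ENNReal.ofReal_pow (norm_nonneg _), ← h.tsum_eq,
    ENNReal.ofReal_tsum_of_nonneg (fun l => sq_nonneg _) h.summable]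

theorem tendsto_cutoff {w : Scale A 1} {z : Scale A (1 / 2)} (h : w.formal = z.formal) :
    Tendsto (fun k : ℕ => (isMultiplier_cutoff A k).toCLM z) atTop (𝓝 w) := by
  refine Scale.tendsto_of_dominated w.hasSum_norm_sq.summable (fun l => ?_)
    (Eventually.of_forall fun k l => ?_)
  · refine tendsto_const_nhds.congr' ?_
    obtain ⟨k₀, hk₀⟩ := exists_nat_ge (l : ℝ)
    filter_upwards [eventually_ge_atTop k₀] with k hk
    have hlk : (l : ℝ) ∈ Iic (k : ℝ) := hk₀.trans (by exact_mod_cast hk)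
    rw [IsMultiplier.formal_toCLM, h, Function.comp_apply, indicator_of_mem hlk, Pi.one_apply,
      one_smul]
  · rw [h]
    have hp := (Real.rpow_pos_of_pos l.2 1).le
    refine pow_le_pow_left₀ (by positivity) (mul_le_mul_of_nonneg_left ?_ hp) 2
    rw [IsMultiplier.formal_toCLM, norm_smul, Function.comp_apply]
    refine mul_le_of_le_one_left (norm_nonneg _) ?_
    refine (norm_indicator_le_norm_self _ _).trans ?_
    simp

/-- The solution lies in `L²(0,T; D(A))`. It is measurable there as a limit of spectral
cut-offs. -/
theorem exists_memLp_scale_one [TopologicalSpace.SeparableSpace H] (hd : 0 ≤ d)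
    (x : Scale A (1 / 2)) (f : C(ℝ, Scale A 0)) {T : ℝ} (hT : 0 ≤ T) :
    ∃ w : ℝ → Scale A 1, MemLp w 2 (volume.restrict (Ioc 0 T)) ∧
      ∀ᵐ t ∂volume.restrict (Ioc 0 T), (w t).formal = (sol d x f t).formal := by
  have hfin := ((lintegral_sq_formal_sol_le hd x f hT).trans_lt ENNReal.ofReal_lt_top).ne
  have hae : ∀ᵐ t ∂volume.restrict (Ioc 0 T),
      ∃ w : Scale A 1, w.formal = (sol d x f t).formal := by
    filter_upwards [ae_lt_top (measurable_tsum_sq_formal_sol hd x f) hfin] with t ht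
    refine ⟨Scale.mk _ (mem_powDomain_of_summable ?_), Scale.formal_mk _ _⟩
    refine (ENNReal.summable_toReal ht.ne).congr fun l => ?_
    rw [ENNReal.toReal_ofReal (sq_nonneg _), Real.rpow_one]
  obtain ⟨w, hw⟩ := skolem.1 hae
  refine ⟨w, ⟨?_, ?_⟩, hw⟩
  · refine aestronglyMeasurable_of_tendsto_ae atTop
      (f := fun (k : ℕ) t => (isMultiplier_cutoff A k).toCLM (sol d x f t)) (fun k => ?_)
      (hw.mono fun t ht => tendsto_cutoff ht)
    exact ((isMultiplier_cutoff A k).toCLM.continuous.comp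
      (continuous_sol hd x f)).aestronglyMeasurable
  · rw [eLpNorm_lt_top_iff_lintegral_rpow_enorm_lt_top two_ne_zero ENNReal.ofNat_ne_top]
    refine lt_of_le_of_lt (lintegral_mono_ae ?_) hfin.lt_top
    filter_upwards [hw] with t ht
    rw [ENNReal.toReal_ofNat, ENNReal.rpow_ofNat, Scale.enorm_sq_eq, ht]
    simp only [Real.rpow_one, le_refl]

/-! ### The duality pairing of square-integrable curves -/

theorem integrable_inner_formal {s s' : ℝ} {μ : Measure ℝ} {p : ℝ → Scale A s} {q : ℝ → Scale A s'}
    (hp : MemLp p 2 μ) (hq : MemLp q 2 μ) (l : Ioi (0 : ℝ)) :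
    Integrable (fun t => (inner ℝ ((p t).formal l : H) ((q t).formal l : H) : ℝ)) μ := by
  have h1 : MemLp (fun t => (p t).formal l) 2 μ := (Scale.comp A s l).comp_memLp' hp
  have h2 : MemLp (fun t => (q t).formal l) 2 μ := (Scale.comp A s' l).comp_memLp' hq
  refine (MemLp.integrable_mul h1.norm h2.norm).mono
    (h1.aestronglyMeasurable.inner h2.aestronglyMeasurable) (Eventually.of_forall fun t => ?_)
  simpa using abs_real_inner_le_norm ((p t).formal l : H) ((q t).formal l : H)

/-- The integrated duality pairing of square-integrable curves is the sum over the eigenspaces of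
the integrals of the components. -/
theorem hasSum_integral_dualPair [TopologicalSpace.SeparableSpace H] {s s' : ℝ} (hs : s' = -s)
    {μ : Measure ℝ} {p : ℝ → Scale A s} {q : ℝ → Scale A s'} (hp : MemLp p 2 μ) (hq : MemLp q 2 μ) :
    HasSum (fun l => ∫ t, inner ℝ ((p t).formal l : H) ((q t).formal l : H) ∂μ)
      (∫ t, dualPair A (p t).formal (q t).formal ∂μ) := by
  subst hs
  have hcount : Countable (eigenvalues A) :=
    (countable_eigenvalues A).to_subtype
  have hzero (l : Ioi (0 : ℝ)) (hl : ∀ x : eigenspace A (l : ℝ), x = 0) (t : ℝ) :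
      inner ℝ ((p t).formal l : H) ((q t).formal l : H) = 0 := by
    rw [hl ((p t).formal l)]; simp
  have hsum : Summable fun l => ∫ t, ‖inner ℝ ((p t).formal l : H) ((q t).formal l : H)‖ ∂μ := by
    refine summable_of_sum_le (c := ∫ t, ‖p t‖ * ‖q t‖ ∂μ)
      (fun l => integral_nonneg fun t => norm_nonneg _) fun F => ?_
    rw [← integral_finsetSum F fun l _ => (integrable_inner_formal hp hq l).norm]
    refine integral_mono (integrable_finsetSum F fun l _ => (integrable_inner_formal hp hq l).norm)
      (MemLp.integrable_mul hp.norm hq.norm) fun t => ?_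
    exact Scale.sum_abs_inner_le (p t) (q t) F
  have h := hasSum_integral_of_summable_integral_norm
    (F := fun (l : eigenvalues A) t =>
      inner ℝ ((p t).formal (l : Ioi (0 : ℝ)) : H) ((q t).formal (l : Ioi (0 : ℝ)) : H))
    (fun l => integrable_inner_formal hp hq l) (hsum.comp_injective Subtype.val_injective)
  have h1 (t : ℝ) := tsum_eigenvalues_eq (A := A)
    (g := fun l => inner ℝ ((p t).formal l : H) ((q t).formal l : H)) fun l hl => hzero l hl t
  simp only [h1] at h
  refine (hasSum_subtype_iff_of_support_subset ?_).1 h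
  intro l hl
  by_contra hcon
  simp only [eigenvalues, mem_ofPred_eq, not_exists, not_not] at hcon
  refine hl ?_
  simp only [hzero l hcon, integral_zero]

end Weak

/-! ### The weak equation -/

section Weak

variable {H : Type*} [NormedAddCommGroup H] [InnerProductSpace ℝ H] [CompleteSpace H]
variable {A : PosOp H} {d : ℝ}

/-- `u` satisfies the weak form of `u' + A u + d u = f`, `u(0) = x`, on `[0,T]`. -/
def IsWeakSolution (A : PosOp H) (d T : ℝ) (x : Formal A) (f u : ℝ → Formal A) : Prop :=
  ∀ (v : ℝ → H) (w w' : ℝ → Scale A (-1)),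
    MemLp v 2 (volume.restrict (Ioc 0 T)) → MemLp w' 2 (volume.restrict (Ioc 0 T)) →
    HasTimeDeriv T w w' →
    (∀ᵐ t ∂volume.restrict (Ioc 0 T), (w t).formal = expand A (v t)) → w T = 0 →
    -(∫ t in (0 : ℝ)..T, dualPair A (u t) (w' t).formal)
      + ∫ t in (0 : ℝ)..T, dualPair A (powA A (1 / 2) (u t)) (powA A (1 / 2) (expand A (v t)))
    = dualPair A x (w 0).formal
      + ∫ t in (0 : ℝ)..T, dualPair A (f t - d • u t) (expand A (v t))

theorem dualPair_powA_half (y z : Formal A) :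
    dualPair A (powA A (1 / 2) y) (powA A (1 / 2) z) = dualPair A (fun l => (l : ℝ) • y l) z := by
  refine tsum_congr fun l => ?_
  have h : (l : ℝ) ^ (1 / 2 : ℝ) * (l : ℝ) ^ (1 / 2 : ℝ) = l := by
    rw [← Real.rpow_add l.2]; norm_num
  change inner ℝ ((l : ℝ) ^ (1 / 2 : ℝ) • (y l : H)) ((l : ℝ) ^ (1 / 2 : ℝ) • (z l : H)) =
    inner ℝ ((l : ℝ) • (y l : H)) (z l : H)
  rw [real_inner_smul_left, real_inner_smul_right, real_inner_smul_left, ← mul_assoc, h]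

theorem _root_.Continuous.memLp_restrict_Ioc {E : Type*} [NormedAddCommGroup E] {g : ℝ → E}
    (hg : Continuous g) (p : ℝ≥0∞) (a b : ℝ) : MemLp g p (volume.restrict (Ioc a b)) := by
  obtain ⟨C, hC⟩ := (isCompact_Icc (a := a) (b := b)).exists_bound_of_continuousOn hg.continuousOn
  refine MemLp.of_bound hg.aestronglyMeasurable C ?_
  exact (ae_restrict_iff' measurableSet_Ioc).2
    (Eventually.of_forall fun s hs => hC s ⟨hs.1.le, hs.2⟩)

theorem HasTimeDeriv.formal {s T : ℝ} {w w' : ℝ → Scale A s} (h : HasTimeDeriv T w w')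
    (hw' : IntegrableOn w' (Ioc 0 T)) (l : Ioi (0 : ℝ)) :
    HasTimeDeriv T (fun t => (w t).formal l) fun t => (w' t).formal l := by
  intro t ht
  have hi : IntervalIntegrable w' volume 0 t :=
    (intervalIntegrable_iff_integrableOn_Ioc_of_le ht.1).2
      (hw'.mono_set (Ioc_subset_Ioc_right ht.2))
  have h1 := (Scale.comp A s l).intervalIntegral_comp_comm hi
  have h2 := congrArg (Scale.comp A s l) (h t ht)
  rw [map_add, ← h1] at h2
  exact h2

/-- The weak equation in one eigenspace. -/
theorem expSol_weak {G : Type*} [NormedAddCommGroup G] [InnerProductSpace ℝ G] [CompleteSpace G]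
    (l : ℝ) {T : ℝ} (hT : 0 ≤ T) (x : G) {f : ℝ → G} (hf : Continuous f) {v w w' : ℝ → G}
    (hw' : IntegrableOn w' (Ioc 0 T)) (hw : HasTimeDeriv T w w') (hwT : w T = 0)
    (hv : IntegrableOn v (Ioc 0 T)) (hvw : ∀ᵐ t ∂volume.restrict (Ioc 0 T), w t = v t) :
    -(∫ t in (0 : ℝ)..T, inner ℝ (expSol (l + d) x f t) (w' t))
      + ∫ t in (0 : ℝ)..T, inner ℝ (l • expSol (l + d) x f t) (v t)
    = inner ℝ x (w 0)
      + ∫ t in (0 : ℝ)..T, inner ℝ (f t - d • expSol (l + d) x f t) (v t) := by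
  have hu := continuous_expSol (l + d) x hf
  have hder := hasDerivAt_expSol (l + d) x hf
  have h0 : expSol (l + d) x f 0 = x := expSol_zero _ _ _
  set u := expSol (l + d) x f
  have hint {g : ℝ → G} (hg : Continuous g) :
      IntervalIntegrable (fun t => (inner ℝ (g t) (v t) : ℝ)) volume 0 T := by
    rw [intervalIntegrable_iff_integrableOn_Ioc_of_le hT]
    obtain ⟨C, hC⟩ := (isCompact_Icc (a := (0 : ℝ)) (b := T)).exists_bound_of_continuousOn
      hg.continuousOn
    refine (hv.norm.const_mul C).mono' (hg.aestronglyMeasurable.inner hv.aestronglyMeasurable) ?_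
    refine (ae_restrict_iff' measurableSet_Ioc).2 (Eventually.of_forall fun s hs => ?_)
    exact (norm_inner_le_norm _ _).trans
      (mul_le_mul_of_nonneg_right (hC s ⟨hs.1.le, hs.2⟩) (norm_nonneg _))
  have hparts := integral_inner_deriv_eq hT (by fun_prop) hder hw' hw hwT
  have hcongr : ∫ t in (0 : ℝ)..T, (inner ℝ (-((l + d) • u t) + f t) (w t) : ℝ) =
      ∫ t in (0 : ℝ)..T, ((inner ℝ (f t - d • u t) (v t) : ℝ) - inner ℝ (l • u t) (v t)) := by
    refine intervalIntegral.integral_congr_ae_restrict ?_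
    rw [uIoc_of_le hT]
    filter_upwards [hvw] with t ht
    rw [ht, ← inner_sub_left]
    congr 1
    rw [add_smul]; abel
  rw [hcongr, intervalIntegral.integral_sub (hint (by fun_prop)) (hint (by fun_prop)), h0] at hparts
  linarith

/-- The mild solution satisfies the weak equation: sum the weak equations of the components over
the countably many eigenvalues. -/
theorem isWeakSolution_sol [TopologicalSpace.SeparableSpace H] (hd : 0 ≤ d) (x : Scale A (1 / 2))
    (f : C(ℝ, Scale A 0)) {T : ℝ} (hT : 0 ≤ T) :
    IsWeakSolution A d T x.formal (fun t => (f t).formal) fun t => (sol d x f t).formal := by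
  intro v w w' hv hw' hw hvw hwT
  obtain ⟨z, hz, hzu⟩ := exists_memLp_scale_one hd x f hT
  have hE : MemLp (fun t => expandCLM A (v t)) 2 (volume.restrict (Ioc 0 T)) :=
    (expandCLM A).comp_memLp' hv
  have hAz : MemLp (fun t => Scale.opA A (by norm_num : (1 : ℝ) = 0 + 1) (z t)) 2
      (volume.restrict (Ioc 0 T)) := (Scale.opA A _).comp_memLp' hz
  have hF : MemLp (fun t => f t - d • Scale.incl A (zero_le_one : (0 : ℝ) ≤ 1) (z t)) 2
      (volume.restrict (Ioc 0 T)) :=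
    (f.continuous.memLp_restrict_Ioc 2 0 T).sub
      (((Scale.incl A (zero_le_one : (0 : ℝ) ≤ 1)).comp_memLp' hz).const_smul d)
  have S1 := hasSum_integral_dualPair rfl hz hw'
  have S2 := hasSum_integral_dualPair neg_zero.symm hAz hE
  have S3 := hasSum_integral_dualPair neg_zero.symm hF hE
  have I1 : ∫ t in Ioc 0 T, dualPair A (z t).formal (w' t).formal =
      ∫ t in (0 : ℝ)..T, dualPair A (sol d x f t).formal (w' t).formal := by
    rw [intervalIntegral.integral_of_le hT]
    exact integral_congr_ae (hzu.mono fun t ht => by simp only [ht])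
  have I2 : ∫ t in Ioc 0 T, dualPair A (Scale.opA A (by norm_num : (1 : ℝ) = 0 + 1) (z t)).formal
        (expandCLM A (v t)).formal =
      ∫ t in (0 : ℝ)..T, dualPair A (powA A (1 / 2) (sol d x f t).formal)
        (powA A (1 / 2) (expand A (v t))) := by
    rw [intervalIntegral.integral_of_le hT]
    refine integral_congr_ae (hzu.mono fun t ht => ?_)
    simp only [dualPair_powA_half, formal_expandCLM, ← ht]
    rfl
  have I3 : ∫ t in Ioc 0 T, dualPair A
        (f t - d • Scale.incl A (zero_le_one : (0 : ℝ) ≤ 1) (z t)).formal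
        (expandCLM A (v t)).formal =
      ∫ t in (0 : ℝ)..T, dualPair A ((f t).formal - d • (sol d x f t).formal)
        (expand A (v t)) := by
    rw [intervalIntegral.integral_of_le hT]
    refine integral_congr_ae (hzu.mono fun t ht => ?_)
    simp only [map_sub, map_smul, Scale.formal_incl, formal_expandCLM, ht]
  rw [I1] at S1
  rw [I2] at S2
  rw [I3] at S3
  have S := (S1.neg.add S2).sub S3
  have hx := (S.congr_fun (g := fun l => inner ℝ (x.formal l : H) ((w 0).formal l : H))
    fun l => ?_).tsum_eq
  · change dualPair A x.formal (w 0).formal = _ at hx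
    rw [hx]; ring
  have hw'i : IntegrableOn w' (Ioc 0 T) := hw'.integrable one_le_two
  have hw'l : IntegrableOn (fun t => (w' t).formal l) (Ioc 0 T) :=
    (Scale.comp A (-1) l).integrable_comp hw'i
  have hvl : IntegrableOn (fun t => expand A (v t) l) (Ioc 0 T) :=
    (Scale.comp A 0 l).integrable_comp (hE.integrable one_le_two)
  have key := expSol_weak (d := d) l hT (x.formal l) (Scale.continuous_formal f.continuous l)
    hw'l (hw.formal hw'i l) (by rw [hwT]; simp) hvl (hvw.mono fun t ht => by rw [ht])
  rw [← sub_eq_iff_eq_add] at key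
  refine key.symm.trans ?_
  have hu : ∀ᵐ t ∂volume.restrict (Ioc 0 T), (z t).formal l =
      expSol (l + d) (x.formal l) (fun s => (f s).formal l) t := by
    filter_upwards [hzu, ae_restrict_mem measurableSet_Ioc] with t ht ht0
    rw [ht, formal_sol hd x f ht0.1.le, mildFormal]
  simp only [intervalIntegral.integral_of_le hT]
  congr 1
  · congr 1
    · congr 1
      exact integral_congr_ae (hu.mono fun t ht => by simp only [← ht, Submodule.coe_inner])
    · exact integral_congr_ae (hu.mono fun t ht => by
        simp only [← ht, Scale.formal_opA, formal_expandCLM, Submodule.coe_inner])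
  · exact integral_congr_ae (hu.mono fun t ht => by
      simp only [← ht, map_sub, map_smul, Pi.sub_apply, Pi.smul_apply, Scale.formal_incl,
        formal_expandCLM, Submodule.coe_inner])

theorem Scale.single_smul {s : ℝ} (l : Ioi (0 : ℝ)) (c : ℝ) (e : eigenspace A (l : ℝ)) :
    Scale.single s l (c • e) = c • Scale.single s l e := by
  refine Scale.ext_formal fun k => ?_
  rw [map_smul, Pi.smul_apply]
  rcases eq_or_ne k l with rfl | hk
  · rw [Scale.formal_single_self, Scale.formal_single_self]
  · rw [Scale.formal_single_of_ne _ hk, Scale.formal_single_of_ne _ hk, smul_zero]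

theorem dualPair_single {s : ℝ} (y : Formal A) (l : Ioi (0 : ℝ)) (e : eigenspace A (l : ℝ)) :
    dualPair A y (Scale.single s l e).formal = inner ℝ (y l) e := by
  refine (tsum_eq_single l fun k hk => ?_).trans ?_
  · rw [Scale.formal_single_of_ne _ hk]; simp
  · rw [Scale.formal_single_self, Submodule.coe_inner]

/-- The weak equation for the test function `θ(t) e`, with an eigenvector `e`. -/
theorem IsWeakSolution.single_test {T : ℝ} {x : Formal A} {f y : ℝ → Formal A}
    (hy : IsWeakSolution A d T x f y) (l : Ioi (0 : ℝ)) (e : eigenspace A (l : ℝ)) {θ θ' : ℝ → ℝ}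
    (hθ' : Continuous θ') (hθ : ∀ t, HasDerivAt θ (θ' t) t) (hθT : θ T = 0) :
    -(∫ t in (0 : ℝ)..T, θ' t * inner ℝ (y t l) e) +
      ∫ t in (0 : ℝ)..T, θ t * (l * inner ℝ (y t l) e) =
    θ 0 * inner ℝ (x l) e +
      ∫ t in (0 : ℝ)..T, θ t * (inner ℝ (f t l) e - d * inner ℝ (y t l) e) := by
  have hθc : Continuous θ := continuous_iff_continuousAt.2 fun t => (hθ t).continuousAt
  have hexp (t : ℝ) : expand A ((θ t • e : eigenspace A (l : ℝ)) : H) =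
      (Scale.single (-1) l (θ t • e)).formal := expand_eigenvector l _
  have hvc : Continuous fun t => ((θ t • e : eigenspace A (l : ℝ)) : H) :=
    continuous_subtype_val.comp (hθc.smul continuous_const)
  have hwc : Continuous fun t => Scale.single (A := A) (-1) l (θ' t • e) := by
    simp only [Scale.single_smul]
    exact hθ'.smul continuous_const
  have h := hy (fun t => ((θ t • e : eigenspace A (l : ℝ)) : H))
    (fun t => Scale.single (-1) l (θ t • e)) (fun t => Scale.single (-1) l (θ' t • e))
    (hvc.memLp_restrict_Ioc 2 0 T) (hwc.memLp_restrict_Ioc 2 0 T) ?_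
    (Eventually.of_forall fun t => (hexp t).symm) ?_
  · simp only [dualPair_powA_half, hexp, dualPair_single, real_inner_smul_right, Pi.sub_apply,
      Pi.smul_apply, inner_sub_left, real_inner_smul_left] at h
    simpa only [mul_sub] using h
  · intro t _
    simp only [Scale.single_smul]
    rw [intervalIntegral.integral_smul_const, ← add_smul,
      intervalIntegral.integral_eq_sub_of_hasDerivAt (fun s _ => hθ s)
      (hθ'.intervalIntegrable _ _), add_sub_cancel]
  · rw [hθT, Scale.single_smul, zero_smul]

/-- The duality argument in one component: if `Y` and `S` satisfy the weak equation for one test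
function `θ`, with `θ' = (l + d) θ - h` and `h = Y - S`, then `h = 0` in `L²`. -/
theorem integral_sq_eq_zero_of_adjoint {l x T : ℝ} (hT : 0 ≤ T) {θ h F S Y : ℝ → ℝ}
    (hθ : Continuous θ) (hh : Continuous h) (hF : Continuous F) (hS : Continuous S)
    (hY : ContinuousOn Y (Icc 0 T)) (hhz : ∀ s ∈ Icc 0 T, h s = Y s - S s)
    (e1 : -(∫ t in (0 : ℝ)..T, ((l + d) * θ t - h t) * Y t) + ∫ t in (0 : ℝ)..T, θ t * (l * Y t) =
      x + ∫ t in (0 : ℝ)..T, θ t * (F t - d * Y t))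
    (e2 : -(∫ t in (0 : ℝ)..T, ((l + d) * θ t - h t) * S t) + ∫ t in (0 : ℝ)..T, θ t * (l * S t) =
      x + ∫ t in (0 : ℝ)..T, θ t * (F t - d * S t)) :
    ∫ s in (0 : ℝ)..T, h s ^ 2 = 0 := by
  have hI {g : ℝ → ℝ} (hg : ContinuousOn g (Icc 0 T)) : IntervalIntegrable g volume 0 T :=
    ContinuousOn.intervalIntegrable (by rwa [uIcc_of_le hT])
  have e3 : ∫ s in (0 : ℝ)..T, h s ^ 2 =
      (-(∫ t in (0 : ℝ)..T, ((l + d) * θ t - h t) * Y t) + (∫ t in (0 : ℝ)..T, θ t * (l * Y t)) -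
        ∫ t in (0 : ℝ)..T, θ t * (F t - d * Y t)) -
      (-(∫ t in (0 : ℝ)..T, ((l + d) * θ t - h t) * S t) + (∫ t in (0 : ℝ)..T, θ t * (l * S t)) -
        ∫ t in (0 : ℝ)..T, θ t * (F t - d * S t)) := by
    simp only [← intervalIntegral.integral_neg]
    rw [← intervalIntegral.integral_add (hI (by fun_prop)) (hI (by fun_prop)),
      ← intervalIntegral.integral_add (hI (by fun_prop)) (hI (by fun_prop)),
      ← intervalIntegral.integral_sub (hI (by fun_prop)) (hI (by fun_prop)),
      ← intervalIntegral.integral_sub (hI (by fun_prop)) (hI (by fun_prop)),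
      ← intervalIntegral.integral_sub (hI (by fun_prop)) (hI (by fun_prop))]
    refine intervalIntegral.integral_congr fun s hs => ?_
    rw [uIcc_of_le hT] at hs
    simp only [hhz s hs]
    ring
  rw [e3]
  linarith

/-- Test functions with values in one eigenspace determine the components of a weak solution. Such
a test function solves the adjoint equation with the difference of the two solutions as source. -/
theorem IsWeakSolution.eq_sol [TopologicalSpace.SeparableSpace H] (hd : 0 ≤ d)
    {x : Scale A (1 / 2)} {f : C(ℝ, Scale A 0)} {T : ℝ} (hT : 0 < T) {y : ℝ → Formal A}
    (hy : IsWeakSolution A d T x.formal (fun t => (f t).formal) y)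
    (hc : ∀ l, ContinuousOn (fun t => y t l) (Icc 0 T)) {t : ℝ} (ht : t ∈ Icc 0 T) :
    y t = (sol d x f t).formal := by
  funext l
  refine ext_inner_right ℝ fun e => ?_
  rw [← sub_eq_zero]
  have hsc : Continuous fun t => inner ℝ ((sol d x f t).formal l) e :=
    (continuous_formal_sol hd x f l).inner continuous_const
  have hyc : ContinuousOn (fun t => inner ℝ (y t l) e) (Icc 0 T) :=
    (hc l).inner continuousOn_const
  have hzc := hyc.sub hsc.continuousOn
  let h : ℝ → ℝ := IccExtend hT.le
    ((Icc 0 T).domRestrict fun t => inner ℝ (y t l) e - inner ℝ ((sol d x f t).formal l) e)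
  have hh : Continuous h := (continuousOn_iff_continuous_domRestrict.1 hzc).Icc_extend'
  have hhz {s : ℝ} (hs : s ∈ Icc 0 T) :
      h s = inner ℝ (y s l) e - inner ℝ ((sol d x f s).formal l) e :=
    IccExtend_of_mem _ _ hs
  -- `θ` solves `θ' = (l + d) θ - h`, `θ(T) = 0`, by reversing time in the forward equation.
  let θ : ℝ → ℝ := fun s => expSol (l + d : ℝ) 0 (fun τ => h (T - τ)) (T - s)
  have hhT : Continuous fun τ => h (T - τ) := by fun_prop
  have hθ (s : ℝ) : HasDerivAt θ ((l + d) * θ s - h s) s := by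
    have h1 := (hasDerivAt_expSol (l + d : ℝ) 0 hhT (T - s)).scomp s
      ((hasDerivAt_id s).const_sub T)
    refine h1.congr_deriv ?_
    simp only [θ, smul_eq_mul, sub_sub_cancel]
    ring
  have hθc : Continuous θ := continuous_iff_continuousAt.2 fun t => (hθ t).continuousAt
  have hθ'c : Continuous fun s => (l + d) * θ s - h s := by fun_prop
  have hθT : θ T = 0 := by simp [θ]
  have e1 := hy.single_test l e hθ'c hθ hθT
  have e2 := (isWeakSolution_sol hd x f hT.le).single_test l e hθ'c hθ hθT
  have hfc : Continuous fun t => inner ℝ ((f t).formal l) e :=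
    (Scale.continuous_formal f.continuous l).inner continuous_const
  have hzero := integral_sq_eq_zero_of_adjoint hT.le hθc hh hfc hsc hyc (fun _ => hhz) e1 e2
  by_contra hne
  rw [← hhz ht] at hne
  have hpos := intervalIntegral.integral_pos hT (hh.pow 2).continuousOn
    (fun s _ => sq_nonneg (h s)) ⟨t, ht, sq_pos_iff.2 hne⟩
  exact hpos.ne' hzero

end Weak

/-! ### The delayed nonlinearity -/

section Abstract

variable {H : Type*} [NormedAddCommGroup H] [InnerProductSpace ℝ H] [CompleteSpace H]
variable {A : PosOp H} {r : ℝ≥0}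

/-- The properties of the nonlinearity on which the solution theory rests: it is bounded, it is
Lipschitz near Lipschitz histories (with a constant that grows with the Lipschitz constant of the
history), and it is continuous. The elements `φ₀`, `ψ₀` are the values at time `0` in
`D(A^(1/2))`. -/
structure IsDelayForcing (Φ : Hist A r → Scale A 0) (M C : ℝ) : Prop where
  bound : ∀ φ, ‖Φ φ‖ ≤ M
  lipschitz : ∀ (φ ψ : Hist A r) (φ₀ ψ₀ : Scale A (1 / 2)) (K D : ℝ), Continuous φ → Continuous ψ →
    φ₀.formal = (φ (zeroPt r)).formal → ψ₀.formal = (ψ (zeroPt r)).formal → 0 ≤ K →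
    (∀ θ θ' : Icc (-(r : ℝ)) 0, ‖φ θ - φ θ'‖ ≤ K * |(θ : ℝ) - θ'|) →
    (∀ θ, ‖φ θ - ψ θ‖ ≤ D) → ‖φ₀ - ψ₀‖ ≤ D → ‖Φ φ - Φ ψ‖ ≤ C * (1 + K) * D
  continuous : ∀ (φ : Hist A r) (φ₀ : Scale A (1 / 2)), Continuous φ →
    φ₀.formal = (φ (zeroPt r)).formal → ∀ ε > 0, ∃ δ > 0, ∀ (ψ : Hist A r) (ψ₀ : Scale A (1 / 2)),
    Continuous ψ → ψ₀.formal = (ψ (zeroPt r)).formal →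
    (∀ θ, ‖φ θ - ψ θ‖ ≤ δ) → ‖φ₀ - ψ₀‖ ≤ δ → ‖Φ φ - Φ ψ‖ < ε

/-- The continuity condition along a family of histories that depends
continuously on a parameter, jointly with the values at time `0` in `D(A^(1/2))`. -/
theorem IsDelayForcing.continuous_comp {Φ : Hist A r → Scale A 0} {M C : ℝ}
    (h : IsDelayForcing Φ M C) {Y : Type*} [TopologicalSpace Y]
    {p : Y → C(Icc (-(r : ℝ)) 0, Scale A (-(1 / 2)))} {p₀ : Y → Scale A (1 / 2)}
    (hp : Continuous p) (hp₀ : Continuous p₀)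
    (hpp : ∀ y, (p₀ y).formal = (p y (zeroPt r)).formal) : Continuous fun y => Φ (p y) := by
  rw [continuous_iff_continuousAt]
  intro y
  rw [ContinuousAt, Metric.tendsto_nhds]
  intro ε hε
  obtain ⟨δ, hδ, hδ'⟩ := h.continuous (p y) (p₀ y) (p y).continuous (hpp y) ε hε
  filter_upwards [Metric.tendsto_nhds.1 (hp.tendsto y) δ hδ,
    Metric.tendsto_nhds.1 (hp₀.tendsto y) δ hδ] with z hz hz₀
  rw [dist_comm, dist_eq_norm] at hz hz₀ ⊢
  refine hδ' _ _ (p z).continuous (hpp z) (fun θ => ?_) hz₀.le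
  exact ((p y - p z).norm_coe_le_norm θ).trans hz.le

/-- The hypothesis on the delay, with uniform distances on the right-hand side. -/
theorem HypDelay.abs_sub_le {η : Hist A r → Icc (0 : ℝ) r} (hη : HypDelay η) :
    ∃ L, 0 ≤ L ∧ ∀ (φ ψ : Hist A r) (φ₀ ψ₀ : Scale A (1 / 2)) (D : ℝ), 0 ≤ D →
      Continuous φ → Continuous ψ →
      φ₀.formal = (φ (zeroPt r)).formal → ψ₀.formal = (ψ (zeroPt r)).formal →
      (∀ θ, ‖φ θ - ψ θ‖ ≤ D) → ‖φ₀ - ψ₀‖ ≤ D → |(η φ : ℝ) - η ψ| ≤ L * D := by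
  obtain ⟨L, hL, q, hq, h⟩ := hη
  refine ⟨L * √(q + r), by positivity, fun φ ψ φ₀ ψ₀ D hD hφ hψ e1 e2 h1 h2 => ?_⟩
  refine (h φ ψ φ₀ ψ₀ hφ hψ e1 e2).trans ?_
  rw [mul_assoc]
  refine mul_le_mul_of_nonneg_left ?_ hL.le
  have hvol : (Measure.comap (Subtype.val : Icc (-(r : ℝ)) 0 → ℝ) volume) univ =
      ENNReal.ofReal r := by
    rw [comap_subtype_coe_apply measurableSet_Icc, image_univ, Subtype.range_coe,
      Real.volume_Icc, zero_sub, neg_neg]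
  have hfin : IsFiniteMeasure (Measure.comap (Subtype.val : Icc (-(r : ℝ)) 0 → ℝ) volume) :=
    ⟨by rw [hvol]; exact ENNReal.ofReal_lt_top⟩
  have hint : ∫ θ, ‖φ θ - ψ θ‖ ^ 2 ∂(Measure.comap (Subtype.val : Icc (-(r : ℝ)) 0 → ℝ) volume) ≤
      D ^ 2 * r := by
    refine (le_abs_self _).trans ?_
    have := norm_integral_le_of_norm_le_const
      (μ := Measure.comap (Subtype.val : Icc (-(r : ℝ)) 0 → ℝ) volume)
      (f := fun θ => ‖φ θ - ψ θ‖ ^ 2) (C := D ^ 2) (Eventually.of_forall fun θ => by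
        rw [Real.norm_of_nonneg (sq_nonneg _)]
        exact pow_le_pow_left₀ (norm_nonneg _) (h1 θ) 2)
    rwa [Measure.real, hvol, ENNReal.toReal_ofReal r.coe_nonneg] at this
  have hq2 : q * ‖φ₀ - ψ₀‖ ^ 2 ≤ q * D ^ 2 :=
    mul_le_mul_of_nonneg_left (pow_le_pow_left₀ (norm_nonneg _) h2 2) hq
  refine Real.sqrt_le_iff.2 ⟨by positivity, ?_⟩
  rw [mul_pow, Real.sq_sqrt (by positivity)]
  nlinarith

end Abstract

section Nemytskii

variable {n : ℕ} {Ω : Set (EuclideanSpace ℝ (Fin n))} {A : PosOp (L2 Ω)} {r : ℝ≥0}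

theorem memLp_comp_of_bounded [IsFiniteMeasure (volume.restrict Ω)] {b : ℝ → ℝ} (hb : Continuous b)
    {M : ℝ} (hbM : ∀ s, |b s| ≤ M) (g : L2 Ω) :
    MemLp (fun x => b (g x)) 2 (volume.restrict Ω) :=
  MemLp.of_bound (hb.comp_aestronglyMeasurable (Lp.aestronglyMeasurable g)) M
    (Eventually.of_forall fun _ => hbM _)

theorem norm_F₁_le [IsFiniteMeasure (volume.restrict Ω)] {b : ℝ → ℝ} (hb : Continuous b)
    {M : ℝ} (hbM : ∀ s, |b s| ≤ M) (B : Scale A (-(1 / 2)) → L2 Ω) (η : Hist A r → Icc (0 : ℝ) r)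
    (φ : Hist A r) :
    ‖F₁ b B η φ‖ ≤ measureUnivNNReal (volume.restrict Ω) ^ (2 : ℝ≥0∞).toReal⁻¹ * M := by
  have hM : 0 ≤ M := (abs_nonneg _).trans (hbM 0)
  have h := memLp_comp_of_bounded hb hbM (B (φ (negPt (η φ))))
  rw [F₁, dif_pos h]
  exact Lp.norm_le_of_ae_bound (f := h.toLp) hM (h.coeFn_toLp.mono fun x hx => by
    rw [hx]; exact hbM _)

theorem norm_F₁_sub_le [IsFiniteMeasure (volume.restrict Ω)] {b : ℝ → ℝ} {K : ℝ≥0}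
    (hb : LipschitzWith K b) {M : ℝ} (hbM : ∀ s, |b s| ≤ M) (B : Scale A (-(1 / 2)) → L2 Ω)
    (η : Hist A r → Icc (0 : ℝ) r) (φ ψ : Hist A r) :
    ‖F₁ b B η φ - F₁ b B η ψ‖ ≤ K * ‖B (φ (negPt (η φ))) - B (ψ (negPt (η ψ)))‖ := by
  have h1 := memLp_comp_of_bounded hb.continuous hbM (B (φ (negPt (η φ))))
  have h2 := memLp_comp_of_bounded hb.continuous hbM (B (ψ (negPt (η ψ))))
  rw [F₁, F₁, dif_pos h1, dif_pos h2]
  refine Lp.norm_le_mul_norm_of_ae_le_mul ?_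
  filter_upwards [h1.coeFn_toLp, h2.coeFn_toLp, Lp.coeFn_sub h1.toLp h2.toLp,
    Lp.coeFn_sub (B (φ (negPt (η φ)))) (B (ψ (negPt (η ψ))))] with x e1 e2 e3 e4
  rw [e3, e4, Pi.sub_apply, Pi.sub_apply, e1, e2]
  exact hb.norm_sub_le _ _

theorem abs_negPt_sub (a c : Icc (0 : ℝ) r) :
    |((negPt a : Icc (-(r : ℝ)) 0) : ℝ) - negPt c| = |(a : ℝ) - c| := by
  simp only [negPt]
  rw [neg_sub_neg, abs_sub_comm]

/-- The difference of `φ(-η(φ))` and `ψ(-η(ψ))` is split at `φ(-η(ψ))`; the first part is controlled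
by the modulus of continuity of `φ` and the estimate for `η`. -/
theorem exists_isDelayForcing (hΩb : Bornology.IsBounded Ω) {b : ℝ → ℝ}
    (hb : ∃ K : ℝ≥0, LipschitzWith K b) (hbM : ∃ M : ℝ, ∀ s, |b s| ≤ M)
    {B : Scale A (-(1 / 2)) → L2 Ω} (hB : ∃ L > (0 : ℝ), ∀ u v, ‖B u - B v‖ ≤ L * ‖u - v‖)
    {η : Hist A r → Icc (0 : ℝ) r} (hη : HypDelay η) :
    ∃ M C, IsDelayForcing (fun φ => expandCLM A (F₁ b B η φ)) M C := by
  obtain ⟨K, hK⟩ := hb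
  obtain ⟨M, hM⟩ := hbM
  obtain ⟨LB, hLB, hB⟩ := hB
  obtain ⟨L, hL, hη⟩ := hη.abs_sub_le
  have hfin : IsFiniteMeasure (volume.restrict Ω) :=
    ⟨by simpa using hΩb.measure_lt_top⟩
  have hF (φ ψ : Hist A r) : ‖expandCLM A (F₁ b B η φ) - expandCLM A (F₁ b B η ψ)‖ ≤
      K * LB * (‖φ (negPt (η φ)) - φ (negPt (η ψ))‖ + ‖φ (negPt (η ψ)) - ψ (negPt (η ψ))‖) := by
    rw [← map_sub]
    refine (norm_expandCLM_le _).trans ((norm_F₁_sub_le hK hM B η φ ψ).trans ?_)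
    rw [mul_assoc]
    refine mul_le_mul_of_nonneg_left ((hB _ _).trans ?_) K.coe_nonneg
    exact mul_le_mul_of_nonneg_left (norm_sub_le_norm_sub_add_norm_sub _ _ _) hLB.le
  refine ⟨_, K * LB * (1 + L),
    fun φ => (norm_expandCLM_le _).trans (norm_F₁_le hK.continuous hM B η φ), ?_, ?_⟩
  · intro φ ψ φ₀ ψ₀ κ D hφ hψ e1 e2 hκ hLip h1 h2
    have hD : 0 ≤ D := (norm_nonneg _).trans h2
    refine (hF φ ψ).trans ?_
    have h3 := hLip (negPt (η φ)) (negPt (η ψ))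
    rw [abs_negPt_sub] at h3
    have h4 := mul_le_mul_of_nonneg_left (hη φ ψ φ₀ ψ₀ D hD hφ hψ e1 e2 h1 h2) hκ
    have h5 := h1 (negPt (η ψ))
    rw [show K * LB * (1 + L) * (1 + κ) * D = K * LB * ((1 + L) * (1 + κ) * D) by ring]
    refine mul_le_mul_of_nonneg_left ?_ (by positivity)
    nlinarith [mul_nonneg hL hD, mul_nonneg hκ hD]
  · intro φ φ₀ hφ e1 ε hε
    have hKL : 0 < K * LB + 1 := by positivity
    obtain ⟨ρ, hρ, hφρ⟩ := Metric.uniformContinuous_iff.1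
      (CompactSpace.uniformContinuous_of_continuous hφ) (ε / (4 * (K * LB + 1))) (by positivity)
    refine ⟨min (ρ / (2 * (L + 1))) (ε / (4 * (K * LB + 1))), by positivity,
      fun ψ ψ₀ hψ e2 h1 h2 => ?_⟩
    set δ := min (ρ / (2 * (L + 1))) (ε / (4 * (K * LB + 1))) with hδ
    have hδ0 : 0 ≤ δ := (norm_nonneg _).trans h2
    have h3 := hη φ ψ φ₀ ψ₀ δ hδ0 hφ hψ e1 e2 h1 h2
    have h4 : L * δ < ρ := by
      have : δ * (2 * (L + 1)) ≤ ρ := (le_div_iff₀ (by positivity)).1 (min_le_left _ _)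
      nlinarith [mul_nonneg hL hδ0]
    have h5 : ‖φ (negPt (η φ)) - φ (negPt (η ψ))‖ < ε / (4 * (K * LB + 1)) := by
      rw [← dist_eq_norm]
      refine hφρ ?_
      rw [Subtype.dist_eq, Real.dist_eq, abs_negPt_sub]
      exact h3.trans_lt h4
    have h6 : ‖φ (negPt (η ψ)) - ψ (negPt (η ψ))‖ ≤ ε / (4 * (K * LB + 1)) :=
      (h1 _).trans (min_le_right _ _)
    refine (hF φ ψ).trans_lt ?_
    calc K * LB * (‖φ (negPt (η φ)) - φ (negPt (η ψ))‖ + ‖φ (negPt (η ψ)) - ψ (negPt (η ψ))‖)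
        ≤ (K * LB + 1) * (ε / (4 * (K * LB + 1)) + ε / (4 * (K * LB + 1))) := by
          gcongr
          linarith
      _ = ε / 2 := by field_simp; norm_num
      _ < ε := half_lt_self hε

end Nemytskii

section Dynamics

variable {H : Type*} [NormedAddCommGroup H] [InnerProductSpace ℝ H] [CompleteSpace H]
variable {A : PosOp H} {r : ℝ≥0} {d : ℝ}

/-! ### Continuously differentiable histories -/

/-- The history `φ`, extended to the real line by its boundary values. -/
def C1Hist.fnExt (φ : C1Hist A r) : ℝ → Scale A (-(1 / 2)) :=
  IccExtend (neg_nonpos.2 r.coe_nonneg) φ.fn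

/-- The derivative of the history `φ`, extended to the real line by its boundary values. -/
def C1Hist.derivExt (φ : C1Hist A r) : ℝ → Scale A (-(1 / 2)) :=
  IccExtend (neg_nonpos.2 r.coe_nonneg) φ.deriv

theorem C1Hist.continuous_fnExt (φ : C1Hist A r) : Continuous φ.fnExt := φ.fn.continuous.Icc_extend'

theorem C1Hist.continuous_derivExt (φ : C1Hist A r) : Continuous φ.derivExt :=
  φ.deriv.continuous.Icc_extend'

theorem C1Hist.fnExt_coe (φ : C1Hist A r) (θ : Icc (-(r : ℝ)) 0) : φ.fnExt θ = φ.fn θ :=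
  IccExtend_val _ _ θ

theorem C1Hist.derivExt_coe (φ : C1Hist A r) (θ : Icc (-(r : ℝ)) 0) : φ.derivExt θ = φ.deriv θ :=
  IccExtend_val _ _ θ

theorem C1Hist.fnExt_of_nonneg (φ : C1Hist A r) {t : ℝ} (ht : 0 ≤ t) :
    φ.fnExt t = φ.fn (zeroPt r) := IccExtend_of_right_le _ _ ht

theorem C1Hist.derivExt_of_nonneg (φ : C1Hist A r) {t : ℝ} (ht : 0 ≤ t) :
    φ.derivExt t = φ.deriv (zeroPt r) := IccExtend_of_right_le _ _ ht

theorem C1Hist.incl_init (φ : C1Hist A r) (h : (-(1 / 2) : ℝ) ≤ 1 / 2) :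
    Scale.incl A h φ.init = φ.fn (zeroPt r) :=
  Scale.formal_injective (by rw [Scale.formal_incl, φ.init_eq])

theorem C1Hist.extend_eq_fnExt (φ : C1Hist A r) {t : ℝ} (ht : t ∈ Icc (-(r : ℝ)) 0) :
    Function.extend Subtype.val φ.fn 0 t = φ.fnExt t := by
  have h := Subtype.val_injective.extend_apply φ.fn 0 (⟨t, ht⟩ : Icc (-(r : ℝ)) 0)
  exact h.trans (φ.fnExt_coe ⟨t, ht⟩).symm

theorem C1Hist.integral_derivExt (φ : C1Hist A r) {a b : ℝ} (ha : -(r : ℝ) ≤ a) (hab : a ≤ b)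
    (hb : b ≤ 0) : ∫ s in a..b, φ.derivExt s = φ.fnExt b - φ.fnExt a := by
  refine intervalIntegral.integral_eq_sub_of_hasDerivAt_of_le hab φ.continuous_fnExt.continuousOn
    (fun t ht => ?_) (φ.continuous_derivExt.intervalIntegrable _ _)
  have ht' : t ∈ Ioo (-(r : ℝ)) 0 := ⟨ha.trans_lt ht.1, ht.2.trans_le hb⟩
  have hnhds : Icc (-(r : ℝ)) 0 ∈ 𝓝 t := Icc_mem_nhds ht'.1 ht'.2
  have h := (φ.hasDeriv ⟨t, ht'.1.le, ht'.2.le⟩).hasDerivAt hnhds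
  rw [← C1Hist.derivExt_coe] at h
  refine h.congr_of_eventuallyEq ?_
  filter_upwards [hnhds] with s hs
  exact (φ.extend_eq_fnExt hs).symm

theorem C1Hist.norm_fnExt_sub_le (φ : C1Hist A r) (s t : ℝ) :
    ‖φ.fnExt t - φ.fnExt s‖ ≤ ‖φ.deriv‖ * |t - s| := by
  have key (a b : Icc (-(r : ℝ)) 0) (hab : a ≤ b) :
      ‖φ.fn b - φ.fn a‖ ≤ ‖φ.deriv‖ * |(b : ℝ) - a| := by
    rw [← φ.fnExt_coe, ← φ.fnExt_coe, ← φ.integral_derivExt a.2.1 hab b.2.2]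
    refine intervalIntegral.norm_integral_le_of_norm_le_const fun x _ => ?_
    exact φ.deriv.norm_coe_le_norm _
  have h1 : |(projIcc (-(r : ℝ)) 0 (neg_nonpos.2 r.coe_nonneg) t : ℝ) -
      projIcc (-(r : ℝ)) 0 (neg_nonpos.2 r.coe_nonneg) s| ≤ |t - s| := by
    have := (LipschitzWith.projIcc (neg_nonpos.2 r.coe_nonneg : -(r : ℝ) ≤ 0)).dist_le_mul t s
    simpa [Subtype.dist_eq, Real.dist_eq] using this
  refine le_trans ?_ (mul_le_mul_of_nonneg_left h1 (norm_nonneg _))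
  rcases le_total (projIcc (-(r : ℝ)) 0 (neg_nonpos.2 r.coe_nonneg) s)
    (projIcc (-(r : ℝ)) 0 (neg_nonpos.2 r.coe_nonneg) t) with h | h
  · exact key _ _ h
  · rw [norm_sub_rev, abs_sub_comm]
    exact key _ _ h

/-- A continuously differentiable curve on the line, in the integrated form, restricts to a
history. -/
theorem hasDerivWithinAt_extend_of_integral {E : Type*} [NormedAddCommGroup E] [NormedSpace ℝ E]
    [CompleteSpace E] {g g' : ℝ → E} (hg' : Continuous g')
    (h : ∀ t ∈ Icc (-(r : ℝ)) 0, g t = g (-r) + ∫ s in (-(r : ℝ))..t, g' s)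
    (θ : Icc (-(r : ℝ)) 0) :
    HasDerivWithinAt (Function.extend Subtype.val (fun θ : Icc (-(r : ℝ)) 0 => g θ) 0) (g' θ)
      (Icc (-(r : ℝ)) 0) (θ : ℝ) := by
  have h1 : HasDerivAt (fun t => g (-r) + ∫ s in (-(r : ℝ))..t, g' s) (g' θ) θ :=
    (intervalIntegral.integral_hasDerivAt_right (hg'.intervalIntegrable _ _)
      (hg'.stronglyMeasurableAtFilter _ _) hg'.continuousAt).const_add _
  have h2 (t : ℝ) (ht : t ∈ Icc (-(r : ℝ)) 0) :
      Function.extend Subtype.val (fun θ : Icc (-(r : ℝ)) 0 => g θ) 0 t =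
        g (-r) + ∫ s in (-(r : ℝ))..t, g' s := by
    rw [← h t ht]
    exact Subtype.val_injective.extend_apply (fun θ : Icc (-(r : ℝ)) 0 => g θ) 0 ⟨t, ht⟩
  exact h1.hasDerivWithinAt.congr h2 (h2 _ θ.2)

theorem C1Hist.dist_def (φ ψ : C1Hist A r) :
    dist φ ψ = ‖φ.fn - ψ.fn‖ + ‖φ.deriv - ψ.deriv‖ + ‖φ.init - ψ.init‖ := rfl

theorem C1Hist.norm_fn_sub_le (φ ψ : C1Hist A r) : ‖φ.fn - ψ.fn‖ ≤ dist φ ψ := by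
  rw [C1Hist.dist_def]
  linarith [norm_nonneg (φ.deriv - ψ.deriv), norm_nonneg (φ.init - ψ.init)]

theorem C1Hist.norm_deriv_sub_le (φ ψ : C1Hist A r) : ‖φ.deriv - ψ.deriv‖ ≤ dist φ ψ := by
  rw [C1Hist.dist_def]
  linarith [norm_nonneg (φ.fn - ψ.fn), norm_nonneg (φ.init - ψ.init)]

theorem C1Hist.norm_init_sub_le (φ ψ : C1Hist A r) : ‖φ.init - ψ.init‖ ≤ dist φ ψ := by
  rw [C1Hist.dist_def]
  linarith [norm_nonneg (φ.fn - ψ.fn), norm_nonneg (φ.deriv - ψ.deriv)]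

theorem C1Hist.norm_fnExt_sub_fnExt_le (φ ψ : C1Hist A r) (t : ℝ) :
    ‖φ.fnExt t - ψ.fnExt t‖ ≤ dist φ ψ :=
  ((φ.fn - ψ.fn).norm_coe_le_norm _).trans (φ.norm_fn_sub_le ψ)

theorem C1Hist.norm_derivExt_sub_le (φ ψ : C1Hist A r) (t : ℝ) :
    ‖φ.derivExt t - ψ.derivExt t‖ ≤ dist φ ψ :=
  ((φ.deriv - ψ.deriv).norm_coe_le_norm _).trans (φ.norm_deriv_sub_le ψ)

/-! ### Bounds for the linear equation -/

theorem sol_max (hd : 0 ≤ d) (x : Scale A (1 / 2)) (f : C(ℝ, Scale A 0)) (t : ℝ) :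
    sol d x f (max t 0) = sol d x f t :=
  Scale.formal_injective (by rw [formal_sol' hd, formal_sol' hd, max_eq_left (le_max_right _ _)])

theorem norm_sol_sub_sq_le (hd : 0 ≤ d) (x y : Scale A (1 / 2)) (f g : C(ℝ, Scale A 0)) {τ t : ℝ}
    (ht : 0 ≤ t) (hτ : τ ≤ t) :
    ‖sol d x f τ - sol d y g τ‖ ^ 2 ≤ ‖x - y‖ ^ 2 + ∫ s in (0 : ℝ)..t, ‖f s - g s‖ ^ 2 := by
  rw [← sol_max hd x f τ, ← sol_max hd y g τ, ← sol_sub hd]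
  refine (norm_sol_sq_le hd _ _ (le_max_right _ _)).trans (add_le_add_right ?_ _)
  refine intervalIntegral.integral_mono_interval le_rfl (le_max_right _ _) (max_le hτ ht)
    (Eventually.of_forall fun s => sq_nonneg _) ?_
  exact Continuous.intervalIntegrable (by fun_prop) _ _

theorem exists_norm_solDeriv_le (hd : 0 ≤ d) (x : Scale A (1 / 2)) {T : ℝ} (M : ℝ) :
    ∃ K, 0 ≤ K ∧ ∀ f : C(ℝ, Scale A 0), (∀ s ∈ Icc 0 T, ‖f s‖ ≤ M) →
      ∀ t ∈ Icc 0 T, ‖solDeriv d x f t‖ ≤ K := by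
  set R := √(‖x‖ ^ 2 + M ^ 2 * T)
  refine ⟨‖Scale.opA A (by norm_num : (1 / 2 : ℝ) = -(1 / 2) + 1)‖ * R +
    d * (‖Scale.incl A (by norm_num : (-(1 / 2) : ℝ) ≤ 1 / 2)‖ * R) +
    ‖Scale.incl A (by norm_num : (-(1 / 2) : ℝ) ≤ 0)‖ * |M|, by positivity, fun f hf t ht => ?_⟩
  have hR : ‖sol d x f t‖ ≤ R := by
    refine Real.le_sqrt_of_sq_le ((norm_sol_sq_le hd x f ht.1).trans (add_le_add_right ?_ _))
    have h1 : ∫ s in (0 : ℝ)..t, ‖f s‖ ^ 2 ≤ ∫ s in (0 : ℝ)..t, M ^ 2 := by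
      refine intervalIntegral.integral_mono_on ht.1
        (Continuous.intervalIntegrable (by fun_prop) _ _) intervalIntegrable_const fun s hs => ?_
      exact pow_le_pow_left₀ (norm_nonneg _) (hf s ⟨hs.1, hs.2.trans ht.2⟩) 2
    rw [intervalIntegral.integral_const, sub_zero, smul_eq_mul] at h1
    nlinarith [sq_nonneg M, ht.2]
  rw [solDeriv, solNeg]
  refine (norm_add_le _ _).trans (add_le_add ((norm_sub_le _ _).trans (add_le_add ?_ ?_)) ?_)
  · rw [norm_neg]
    exact ContinuousLinearMap.le_of_opNorm_le_of_le _ le_rfl hR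
  · rw [norm_smul, Real.norm_of_nonneg hd]
    exact mul_le_mul_of_nonneg_left (ContinuousLinearMap.le_of_opNorm_le_of_le _ le_rfl hR) hd
  · exact ContinuousLinearMap.le_of_opNorm_le_of_le _ le_rfl ((hf t ht).trans (le_abs_self M))

theorem integral_solDeriv (hd : 0 ≤ d) (x : Scale A (1 / 2)) (f : C(ℝ, Scale A 0)) {a b : ℝ}
    (ha : 0 ≤ a) (hb : 0 ≤ b) :
    ∫ s in a..b, solDeriv d x f s = solNeg d x f b - solNeg d x f a := by
  have hc := continuous_solDeriv hd x f
  rw [solNeg_eq_integral hd x f ha, solNeg_eq_integral hd x f hb, add_sub_add_left_eq_sub,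
    intervalIntegral.integral_interval_sub_left (hc.intervalIntegrable _ _)
      (hc.intervalIntegrable _ _)]

/-! ### Trajectories -/

/-- The curve that follows the history `φ` up to time `0`, and then the mild solution of the linear
equation with right-hand side `f`. -/
def traj (d : ℝ) (φ : C1Hist A r) (f : C(ℝ, Scale A 0)) (t : ℝ) : Scale A (-(1 / 2)) :=
  φ.fnExt t + (solNeg d φ.init f t - solNeg d φ.init f 0)

theorem continuous_traj (hd : 0 ≤ d) (φ : C1Hist A r) (f : C(ℝ, Scale A 0)) :
    Continuous (traj d φ f) :=
  φ.continuous_fnExt.add ((continuous_solNeg hd _ _).sub continuous_const)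

theorem traj_of_nonpos (hd : 0 ≤ d) (φ : C1Hist A r) (f : C(ℝ, Scale A 0)) {t : ℝ} (ht : t ≤ 0) :
    traj d φ f t = φ.fnExt t := by
  rw [traj, solNeg, solNeg, sol_of_nonpos hd _ _ ht, sol_of_nonpos hd _ _ le_rfl, sub_self,
    add_zero]

theorem traj_of_nonneg (hd : 0 ≤ d) (φ : C1Hist A r) (f : C(ℝ, Scale A 0)) {t : ℝ} (ht : 0 ≤ t) :
    traj d φ f t = solNeg d φ.init f t := by
  rw [traj, φ.fnExt_of_nonneg ht, solNeg, solNeg, sol_of_nonpos hd _ _ le_rfl, φ.incl_init,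
    add_sub_cancel]

theorem formal_traj (hd : 0 ≤ d) (φ : C1Hist A r) (f : C(ℝ, Scale A 0)) {t : ℝ} (ht : 0 ≤ t) :
    (traj d φ f t).formal = (sol d φ.init f t).formal := by
  rw [traj_of_nonneg hd φ f ht, formal_solNeg]

theorem traj_congr (hd : 0 ≤ d) (φ : C1Hist A r) {f g : C(ℝ, Scale A 0)} {t : ℝ}
    (h : ∀ s ∈ Icc 0 t, f s = g s) : traj d φ f t = traj d φ g t := by
  rw [traj, traj, solNeg, solNeg, solNeg, solNeg, sol_congr hd _ h, sol_of_nonpos hd _ _ le_rfl,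
    sol_of_nonpos hd _ _ le_rfl]

/-- Trajectories with bounded forcing are Lipschitz in time, with a constant that depends only on
the history and the bound. -/
theorem exists_norm_traj_sub_le (hd : 0 ≤ d) (φ : C1Hist A r) (T M : ℝ) :
    ∃ K, 0 ≤ K ∧ ∀ f : C(ℝ, Scale A 0), (∀ s ∈ Icc 0 T, ‖f s‖ ≤ M) →
      ∀ s ≤ T, ∀ t ≤ T, ‖traj d φ f t - traj d φ f s‖ ≤ K * |t - s| := by
  obtain ⟨K, hK, h⟩ := exists_norm_solDeriv_le hd φ.init (T := T) M
  refine ⟨‖φ.deriv‖ + K, by positivity, fun f hf s hs t ht => ?_⟩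
  have h1 : ‖solNeg d φ.init f t - solNeg d φ.init f s‖ ≤ K * |t - s| := by
    rcases lt_or_ge T 0 with hT | hT
    · rw [solNeg, solNeg, sol_of_nonpos hd _ _ (ht.trans hT.le),
        sol_of_nonpos hd _ _ (hs.trans hT.le), sub_self, norm_zero]
      positivity
    rw [solNeg, solNeg, ← sol_max hd _ _ t, ← sol_max hd _ _ s]
    change ‖solNeg d φ.init f (max t 0) - solNeg d φ.init f (max s 0)‖ ≤ _
    rw [← integral_solDeriv hd _ _ (le_max_right _ _) (le_max_right _ _)]
    refine (intervalIntegral.norm_integral_le_of_norm_le_const (C := K) fun x hx => ?_).trans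
      (mul_le_mul_of_nonneg_left (abs_max_sub_max_le_abs _ _ _) hK)
    refine h f hf x ⟨?_, ?_⟩
    · exact (le_min (le_max_right _ _) (le_max_right _ _)).trans (mem_uIoc.1 hx |>.elim
        (fun h => (min_le_left _ _).trans h.1.le) (fun h => (min_le_right _ _).trans h.1.le))
    · exact (mem_uIoc.1 hx).elim (fun h => h.2.trans (max_le ht hT))
        (fun h => h.2.trans (max_le hs hT))
  rw [traj, traj, add_sub_add_comm, sub_sub_sub_cancel_right, add_mul]
  exact (norm_add_le _ _).trans (add_le_add (φ.norm_fnExt_sub_le s t) h1)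

theorem norm_traj_sub_le (hd : 0 ≤ d) (φ ψ : C1Hist A r) (f g : C(ℝ, Scale A 0)) {τ t : ℝ}
    (ht : 0 ≤ t) (hτ : τ ≤ t) : ‖traj d φ f τ - traj d ψ g τ‖ ≤
      (1 + ‖Scale.incl A (by norm_num : (-(1 / 2) : ℝ) ≤ 1 / 2)‖) *
        √(dist φ ψ ^ 2 + ∫ s in (0 : ℝ)..t, ‖f s - g s‖ ^ 2) := by
  have hI : 0 ≤ ∫ s in (0 : ℝ)..t, ‖f s - g s‖ ^ 2 :=
    intervalIntegral.integral_nonneg ht fun s _ => sq_nonneg _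
  have hS := Real.sqrt_nonneg (dist φ ψ ^ 2 + ∫ s in (0 : ℝ)..t, ‖f s - g s‖ ^ 2)
  rcases le_total τ 0 with h0 | h0
  · rw [traj_of_nonpos hd _ _ h0, traj_of_nonpos hd _ _ h0]
    refine (φ.norm_fnExt_sub_fnExt_le ψ τ).trans ?_
    have h1 : dist φ ψ ≤ √(dist φ ψ ^ 2 + ∫ s in (0 : ℝ)..t, ‖f s - g s‖ ^ 2) :=
      Real.le_sqrt_of_sq_le (by linarith)
    nlinarith [norm_nonneg (Scale.incl A (by norm_num : (-(1 / 2) : ℝ) ≤ 1 / 2))]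
  · rw [traj_of_nonneg hd _ _ h0, traj_of_nonneg hd _ _ h0, solNeg, solNeg, ← map_sub]
    have h1 : ‖sol d φ.init f τ - sol d ψ.init g τ‖ ≤
        √(dist φ ψ ^ 2 + ∫ s in (0 : ℝ)..t, ‖f s - g s‖ ^ 2) := by
      refine Real.le_sqrt_of_sq_le ((norm_sol_sub_sq_le hd _ _ f g ht hτ).trans ?_)
      exact add_le_add_left (pow_le_pow_left₀ (norm_nonneg _) (φ.norm_init_sub_le ψ) 2) _
    refine (ContinuousLinearMap.le_of_opNorm_le_of_le _ le_rfl h1).trans ?_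
    nlinarith

/-- The segment `u_t` of a continuous curve `u`, as a continuous function. -/
def segC (r : ℝ≥0) (u : C(ℝ, Scale A (-(1 / 2)))) (t : ℝ) :
    C(Icc (-(r : ℝ)) 0, Scale A (-(1 / 2))) :=
  ⟨seg r u t, u.continuous.comp (continuous_const.add continuous_subtype_val)⟩

theorem continuous_segC (u : C(ℝ, Scale A (-(1 / 2)))) : Continuous (segC r u) :=
  ContinuousMap.continuous_of_continuous_uncurry _
    (u.continuous.comp (by fun_prop : Continuous fun p : ℝ × Icc (-(r : ℝ)) 0 => p.1 + p.2))

theorem seg_zeroPt (u : ℝ → Scale A (-(1 / 2))) (t : ℝ) : seg r u t (zeroPt r) = u t := by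
  simp [seg, zeroPt]

end Dynamics

section Picard

variable {H : Type*} [NormedAddCommGroup H] [InnerProductSpace ℝ H] [CompleteSpace H]
variable {A : PosOp H} {r : ℝ≥0} {d : ℝ} {Φ : Hist A r → Scale A 0} {M C : ℝ}

/-! ### Existence and uniqueness of the forcing term -/

theorem IsDelayForcing.bound_nonneg (hΦ : IsDelayForcing Φ M C) : 0 ≤ M :=
  (norm_nonneg _).trans (hΦ.bound 0)

/-- The Lipschitz estimate for the map that sends a right-hand side `f` of the linear equation to
the nonlinearity along the resulting trajectory. It depends only on the past of `f`. -/
theorem IsDelayForcing.exists_sub_sq_le (hd : 0 ≤ d) (hΦ : IsDelayForcing Φ M C) (φ : C1Hist A r)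
    (T : ℝ) : ∃ L > 0, ∀ (f : C(ℝ, Scale A 0)) (ψ : C1Hist A r) (g : C(ℝ, Scale A 0)),
      (∀ s ∈ Icc 0 T, ‖f s‖ ≤ M) → ∀ t ∈ Icc 0 T,
      ‖Φ (seg r (traj d φ f) t) - Φ (seg r (traj d ψ g) t)‖ ^ 2 ≤
        L * (dist φ ψ ^ 2 + ∫ s in (0 : ℝ)..t, ‖f s - g s‖ ^ 2) := by
  obtain ⟨K, hK, hLip⟩ := exists_norm_traj_sub_le hd φ T M
  set c := 1 + ‖Scale.incl A (by norm_num : (-(1 / 2) : ℝ) ≤ 1 / 2)‖ with hc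
  have hc1 : 1 ≤ c := by simp [hc]
  refine ⟨(C * (1 + K) * c) ^ 2 + 1, by positivity, fun f ψ g hf t ht => ?_⟩
  have hI : 0 ≤ ∫ s in (0 : ℝ)..t, ‖f s - g s‖ ^ 2 :=
    intervalIntegral.integral_nonneg ht.1 fun s _ => sq_nonneg _
  set E := dist φ ψ ^ 2 + ∫ s in (0 : ℝ)..t, ‖f s - g s‖ ^ 2 with hE
  have hE0 : 0 ≤ E := by positivity
  have hmem (θ : Icc (-(r : ℝ)) 0) : t + θ ≤ t := by linarith [θ.2.2]
  have hseg (ψ : C1Hist A r) (g : C(ℝ, Scale A 0)) : Continuous (seg r (traj d ψ g) t) :=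
    (continuous_traj hd ψ g).comp (continuous_const.add continuous_subtype_val)
  have hform (ψ : C1Hist A r) (g : C(ℝ, Scale A 0)) :
      (sol d ψ.init g t).formal = (seg r (traj d ψ g) t (zeroPt r)).formal := by
    rw [seg_zeroPt, formal_traj hd ψ g ht.1]
  have h1 : ‖sol d φ.init f t - sol d ψ.init g t‖ ≤ √E := by
    refine Real.le_sqrt_of_sq_le ((norm_sol_sub_sq_le hd _ _ f g ht.1 le_rfl).trans ?_)
    exact add_le_add_left (pow_le_pow_left₀ (norm_nonneg _) (φ.norm_init_sub_le ψ) 2) _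
  have h2 := hΦ.lipschitz (seg r (traj d φ f) t) (seg r (traj d ψ g) t) (sol d φ.init f t)
    (sol d ψ.init g t) K (c * √E) (hseg _ _) (hseg _ _) (hform _ _) (hform _ _) hK
    (fun θ θ' => by
      have := hLip f hf (t + θ') ((hmem θ').trans ht.2) (t + θ) ((hmem θ).trans ht.2)
      rwa [add_sub_add_left_eq_sub] at this)
    (fun θ => norm_traj_sub_le hd φ ψ f g ht.1 (hmem θ))
    (h1.trans (le_mul_of_one_le_left (Real.sqrt_nonneg _) hc1))
  calc ‖Φ (seg r (traj d φ f) t) - Φ (seg r (traj d ψ g) t)‖ ^ 2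
      ≤ (C * (1 + K) * (c * √E)) ^ 2 := pow_le_pow_left₀ (norm_nonneg _) h2 2
    _ = (C * (1 + K) * c) ^ 2 * √E ^ 2 := by ring
    _ = (C * (1 + K) * c) ^ 2 * E := by rw [Real.sq_sqrt hE0]
    _ ≤ ((C * (1 + K) * c) ^ 2 + 1) * E := by nlinarith

/-- Gronwall's inequality in integral form. -/
theorem le_mul_exp_of_le_integral {h : ℝ → ℝ} (hh : Continuous h) {L a T : ℝ} (hL : 0 ≤ L)
    (hle : ∀ t ∈ Icc 0 T, h t ≤ L * (a + ∫ s in (0 : ℝ)..t, h s)) {t : ℝ} (ht : t ∈ Icc 0 T) :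
    h t ≤ L * (a * Real.exp (L * t)) := by
  have hder (t : ℝ) : HasDerivAt (fun t => Real.exp (-(L * t)) * (a + ∫ s in (0 : ℝ)..t, h s))
      (Real.exp (-(L * t)) * (h t - L * (a + ∫ s in (0 : ℝ)..t, h s))) t := by
    have h1 : HasDerivAt (fun t => a + ∫ s in (0 : ℝ)..t, h s) (h t) t :=
      (intervalIntegral.integral_hasDerivAt_right (hh.intervalIntegrable _ _)
        (hh.stronglyMeasurableAtFilter _ _) hh.continuousAt).const_add _
    have h2 : HasDerivAt (fun t => Real.exp (-(L * t))) (Real.exp (-(L * t)) * -L) t := by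
      have h := ((hasDerivAt_id t).const_mul L).neg.exp
      simpa using h
    exact (h2.mul h1).congr_deriv (by ring)
  -- `exp (-L t) (a + ∫ h)` decreases.
  have hanti : AntitoneOn (fun t => Real.exp (-(L * t)) * (a + ∫ s in (0 : ℝ)..t, h s))
      (Icc 0 T) := by
    refine antitoneOn_of_deriv_nonpos (convex_Icc _ _)
      (fun t _ => (hder t).continuousAt.continuousWithinAt)
      (fun t _ => (hder t).differentiableAt.differentiableWithinAt) fun t ht => ?_
    rw [interior_Icc] at ht
    rw [(hder t).deriv]
    refine mul_nonpos_of_nonneg_of_nonpos (Real.exp_pos _).le ?_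
    linarith [hle t ⟨ht.1.le, ht.2.le⟩]
  have h3 := hanti ⟨le_rfl, ht.1.trans ht.2⟩ ht ht.1
  simp only [mul_zero, neg_zero, Real.exp_zero, intervalIntegral.integral_same, add_zero,
    one_mul] at h3
  refine (hle t ht).trans (mul_le_mul_of_nonneg_left ?_ hL)
  rw [Real.exp_neg, inv_mul_eq_div, div_le_iff₀ (Real.exp_pos _)] at h3
  exact h3

/-- `f` is the nonlinearity along the trajectory that it generates, on `[0,T]`. -/
def IsForcing (d : ℝ) (Φ : Hist A r → Scale A 0) (φ : C1Hist A r) (f : C(ℝ, Scale A 0)) (T : ℝ) :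
    Prop :=
  ∀ t ∈ Icc 0 T, f t = Φ (seg r (traj d φ f) t)

theorem IsForcing.norm_le (hΦ : IsDelayForcing Φ M C) {φ : C1Hist A r} {f : C(ℝ, Scale A 0)} {T : ℝ}
    (h : IsForcing d Φ φ f T) : ∀ s ∈ Icc 0 T, ‖f s‖ ≤ M :=
  fun s hs => by rw [h s hs]; exact hΦ.bound _

/-- The forcing term depends on the history in a Lipschitz way. -/
theorem IsDelayForcing.exists_forcing_sub_le (hd : 0 ≤ d) (hΦ : IsDelayForcing Φ M C)
    (φ : C1Hist A r) (T : ℝ) : ∃ L, 0 ≤ L ∧ ∀ (f : C(ℝ, Scale A 0)) (ψ : C1Hist A r)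
      (g : C(ℝ, Scale A 0)), IsForcing d Φ φ f T → IsForcing d Φ ψ g T →
      ∀ t ∈ Icc 0 T, ‖f t - g t‖ ≤ L * dist φ ψ := by
  obtain ⟨L, hL, h⟩ := hΦ.exists_sub_sq_le hd φ T
  refine ⟨√(L * Real.exp (L * T)), Real.sqrt_nonneg _, fun f ψ g hf hg t ht => ?_⟩
  have h1 := le_mul_exp_of_le_integral (h := fun s => ‖f s - g s‖ ^ 2) (by fun_prop) hL.le
    (a := dist φ ψ ^ 2) (T := T) (fun s hs => by
      have := h f ψ g (hf.norm_le hΦ) s hs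
      rwa [← hf s hs, ← hg s hs] at this) ht
  have h2 : Real.exp (L * t) ≤ Real.exp (L * T) :=
    Real.exp_le_exp.2 (mul_le_mul_of_nonneg_left ht.2 hL.le)
  refine (sq_le_sq₀ (norm_nonneg _) (by positivity)).1 (h1.trans ?_)
  rw [mul_pow, Real.sq_sqrt (by positivity)]
  calc L * (dist φ ψ ^ 2 * Real.exp (L * t)) = L * dist φ ψ ^ 2 * Real.exp (L * t) := by ring
    _ ≤ L * dist φ ψ ^ 2 * Real.exp (L * T) := mul_le_mul_of_nonneg_left h2 (by positivity)
    _ = _ := by ring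

/-- Uniqueness of the forcing term. -/
theorem IsForcing.eq_of_isForcing (hd : 0 ≤ d) (hΦ : IsDelayForcing Φ M C) {φ : C1Hist A r}
    {f g : C(ℝ, Scale A 0)} {T : ℝ} (hf : IsForcing d Φ φ f T) (hg : IsForcing d Φ φ g T) :
    ∀ t ∈ Icc 0 T, f t = g t := by
  obtain ⟨L, -, h⟩ := hΦ.exists_forcing_sub_le hd φ T
  intro t ht
  have := h f φ g hf hg t ht
  rw [dist_self, mul_zero] at this
  exact sub_eq_zero.1 (norm_eq_zero.1 (this.antisymm (norm_nonneg _)))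

theorem IsDelayForcing.continuous_seg (hΦ : IsDelayForcing Φ M C) {u : ℝ → Scale A (-(1 / 2))}
    {w : ℝ → Scale A (1 / 2)} (hu : Continuous u) (hw : Continuous w) {Y : Type*}
    [TopologicalSpace Y] {τ : Y → ℝ} (hτ : Continuous τ)
    (h : ∀ y, (w (τ y)).formal = (u (τ y)).formal) : Continuous fun y => Φ (seg r u (τ y)) :=
  hΦ.continuous_comp (p := fun y => segC r ⟨u, hu⟩ (τ y)) (p₀ := fun y => w (τ y))
    ((continuous_segC ⟨u, hu⟩).comp hτ) (hw.comp hτ) fun y => by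
      rw [h y]; exact congrArg Scale.formal (seg_zeroPt u (τ y)).symm

/-- The nonlinearity along the trajectory with right-hand side `f`, frozen for negative times. -/
def picardMap (hd : 0 ≤ d) (hΦ : IsDelayForcing Φ M C) (φ : C1Hist A r) (f : C(ℝ, Scale A 0)) :
    C(ℝ, Scale A 0) :=
  ⟨fun t => Φ (seg r (traj d φ f) (max t 0)),
    hΦ.continuous_seg (continuous_traj hd φ f) (continuous_sol hd φ.init f) (by fun_prop)
      fun _ => (formal_traj hd φ f (le_max_right _ _)).symm⟩

theorem picardMap_apply (hd : 0 ≤ d) (hΦ : IsDelayForcing Φ M C) (φ : C1Hist A r)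
    (f : C(ℝ, Scale A 0)) {t : ℝ} (ht : 0 ≤ t) :
    picardMap hd hΦ φ f t = Φ (seg r (traj d φ f) t) := by
  change Φ (seg r (traj d φ f) (max t 0)) = _
  rw [max_eq_left ht]

theorem norm_picardMap_iterate_le (hd : 0 ≤ d) (hΦ : IsDelayForcing Φ M C) (φ : C1Hist A r)
    (n : ℕ) (t : ℝ) : ‖(picardMap hd hΦ φ)^[n] 0 t‖ ≤ M := by
  cases n with
  | zero => simpa using hΦ.bound_nonneg
  | succ n =>
    rw [Function.iterate_succ_apply']
    exact hΦ.bound _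

theorem picardMap_iterate_max (hd : 0 ≤ d) (hΦ : IsDelayForcing Φ M C) (φ : C1Hist A r)
    (n : ℕ) (t : ℝ) :
    (picardMap hd hΦ φ)^[n] 0 (max t 0) = (picardMap hd hΦ φ)^[n] 0 t := by
  cases n with
  | zero => simp
  | succ n =>
    rw [Function.iterate_succ_apply']
    change Φ _ = Φ _
    rw [max_eq_left (le_max_right _ _)]

/-- The increments of the Picard iteration decay geometrically on `[0,T]`: in the norm weighted by
`exp (-2 L t)` the Picard map halves distances. -/
theorem exists_picardMap_iterate_sub_le (hd : 0 ≤ d) (hΦ : IsDelayForcing Φ M C) (φ : C1Hist A r)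
    (T : ℝ) : ∃ K, ∀ (n : ℕ), ∀ t ∈ Icc 0 T,
      ‖(picardMap hd hΦ φ)^[n + 1] 0 t - (picardMap hd hΦ φ)^[n] 0 t‖ ≤ K * (1 / 2) ^ n := by
  obtain ⟨L, hL, h⟩ := hΦ.exists_sub_sq_le hd φ T
  have key (n : ℕ) : ∀ t ∈ Icc 0 T,
      ‖(picardMap hd hΦ φ)^[n + 1] 0 t - (picardMap hd hΦ φ)^[n] 0 t‖ ^ 2 ≤
        M ^ 2 * (1 / 4) ^ n * Real.exp (4 * L * t) := by
    induction n with
    | zero =>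
      intro t ht
      have h1 : ‖(picardMap hd hΦ φ)^[0 + 1] 0 t - (picardMap hd hΦ φ)^[0] 0 t‖ ≤ M := by
        rw [Function.iterate_zero_apply, ContinuousMap.zero_apply, sub_zero]
        exact norm_picardMap_iterate_le hd hΦ φ (0 + 1) t
      have h2 : 1 ≤ Real.exp (4 * L * t) := Real.one_le_exp (by have := ht.1; positivity)
      rw [pow_zero, mul_one]
      exact (pow_le_pow_left₀ (norm_nonneg _) h1 2).trans (le_mul_of_one_le_right (sq_nonneg _) h2)
    | succ n ih =>
      intro t ht
      rw [Function.iterate_succ_apply' _ (n + 1), Function.iterate_succ_apply' _ n,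
        picardMap_apply hd hΦ φ _ ht.1, picardMap_apply hd hΦ φ _ ht.1]
      rw [← Function.iterate_succ_apply' (picardMap hd hΦ φ) n]
      refine (h _ φ _ (fun s _ => norm_picardMap_iterate_le hd hΦ φ _ s) t ht).trans ?_
      have h1 : ∫ s in (0 : ℝ)..t,
          ‖(picardMap hd hΦ φ)^[n + 1] 0 s - (picardMap hd hΦ φ)^[n] 0 s‖ ^ 2 ≤
          ∫ s in (0 : ℝ)..t, M ^ 2 * (1 / 4) ^ n * Real.exp (4 * L * s) := by
        refine intervalIntegral.integral_mono_on ht.1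
          (Continuous.intervalIntegrable (by fun_prop) _ _)
          (Continuous.intervalIntegrable (by fun_prop) _ _) fun s hs => ?_
        exact ih s ⟨hs.1, hs.2.trans ht.2⟩
      have h2 : ∫ s in (0 : ℝ)..t, Real.exp (4 * L * s) = (Real.exp (4 * L * t) - 1) / (4 * L) := by
        have h3 (s : ℝ) : HasDerivAt (fun s => Real.exp (4 * L * s) / (4 * L))
            (Real.exp (4 * L * s)) s := by
          have h4 := (((hasDerivAt_id s).const_mul (4 * L)).exp).div_const (4 * L)
          refine h4.congr_deriv ?_
          simp only [id, mul_one]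
          field_simp
        rw [intervalIntegral.integral_eq_sub_of_hasDerivAt (fun s _ => h3 s)
          (Continuous.intervalIntegrable (by fun_prop) _ _), mul_zero, Real.exp_zero, sub_div]
      rw [intervalIntegral.integral_const_mul, h2] at h1
      rw [dist_self]
      calc L * (0 ^ 2 + ∫ s in (0 : ℝ)..t,
            ‖(picardMap hd hΦ φ)^[n + 1] 0 s - (picardMap hd hΦ φ)^[n] 0 s‖ ^ 2)
          ≤ L * (M ^ 2 * (1 / 4) ^ n * ((Real.exp (4 * L * t) - 1) / (4 * L))) := by
            refine mul_le_mul_of_nonneg_left ?_ hL.le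
            linarith
        _ = M ^ 2 * (1 / 4) ^ (n + 1) * (Real.exp (4 * L * t) - 1) := by
            rw [pow_succ (1 / 4 : ℝ) n]
            generalize (1 / 4 : ℝ) ^ n = a
            field_simp
        _ ≤ M ^ 2 * (1 / 4) ^ (n + 1) * Real.exp (4 * L * t) :=
            mul_le_mul_of_nonneg_left (by linarith) (by positivity)
  refine ⟨M * Real.exp (2 * L * T), fun n t ht => ?_⟩
  have hM := hΦ.bound_nonneg
  refine (sq_le_sq₀ (norm_nonneg _) (by positivity)).1 ((key n t ht).trans ?_)
  have e1 : Real.exp (2 * L * T) ^ 2 = Real.exp (4 * L * T) := by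
    rw [← Real.exp_nat_mul]; congr 1; push_cast; ring
  have e2 : ((1 / 2 : ℝ) ^ n) ^ 2 = (1 / 4) ^ n := by
    rw [← pow_mul, mul_comm, pow_mul]; norm_num
  rw [mul_pow, mul_pow, e1, e2, mul_right_comm]
  have e3 : Real.exp (4 * L * t) ≤ Real.exp (4 * L * T) :=
    Real.exp_le_exp.2 (mul_le_mul_of_nonneg_left ht.2 (by positivity))
  gcongr

theorem exists_isForcing (hd : 0 ≤ d) (hΦ : IsDelayForcing Φ M C) (φ : C1Hist A r) :
    ∃ f : C(ℝ, Scale A 0), ∀ T, IsForcing d Φ φ f T := by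
  set p : ℕ → C(ℝ, Scale A 0) := fun n => (picardMap hd hΦ φ)^[n] 0 with hp
  let F : ℝ → Scale A 0 := fun t => ∑' n, (p (n + 1) t - p n t)
  have hgeo (K : ℝ) : Summable fun n : ℕ => K * (1 / 2 : ℝ) ^ n :=
    (summable_geometric_of_lt_one (by norm_num) (by norm_num)).mul_left K
  have hcont (T : ℝ) : ContinuousOn F (Icc 0 T) := by
    obtain ⟨K, hK⟩ := exists_picardMap_iterate_sub_le hd hΦ φ T
    exact continuousOn_tsum (fun n => ((p (n + 1)).continuous.sub (p n).continuous).continuousOn)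
      (hgeo K) fun n t ht => hK n t ht
  have hlim {t : ℝ} (ht : 0 ≤ t) : Tendsto (fun n => p n t) atTop (𝓝 (F t)) := by
    obtain ⟨K, hK⟩ := exists_picardMap_iterate_sub_le hd hΦ φ t
    have hs : Summable fun n => p (n + 1) t - p n t :=
      Summable.of_norm_bounded (hgeo K) fun n => hK n t ⟨ht, le_rfl⟩
    have h := hs.hasSum.tendsto_sum_nat
    simp only [Finset.sum_range_sub (fun n => p n t)] at h
    rwa [show p 0 t = 0 from rfl, funext fun n => sub_zero (p n t)] at h
  have hFc : Continuous fun t => F (max t 0) := by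
    have h1 : ContinuousOn F (Ici 0) := by
      intro t ht
      refine (hcont (t + 1) t ⟨ht, by linarith⟩).mono_of_mem_nhdsWithin ?_
      exact mem_nhdsWithin.2 ⟨Iio (t + 1), isOpen_Iio, lt_add_one t, fun s hs => ⟨hs.2, hs.1.le⟩⟩
    exact h1.comp_continuous (by fun_prop) fun t => mem_Ici.2 (le_max_right _ _)
  let f : C(ℝ, Scale A 0) := ⟨fun t => F (max t 0), hFc⟩
  have hflim (t : ℝ) : Tendsto (fun n => p n t) atTop (𝓝 (f t)) :=
    (hlim (le_max_right t 0)).congr fun n => picardMap_iterate_max hd hΦ φ n t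
  have hfM (t : ℝ) : ‖f t‖ ≤ M :=
    le_of_tendsto (hflim t).norm (Eventually.of_forall fun n =>
      norm_picardMap_iterate_le hd hΦ φ n t)
  refine ⟨f, fun T t ht => ?_⟩
  obtain ⟨L, hL, h⟩ := hΦ.exists_sub_sq_le hd φ T
  have hint : Tendsto (fun n => ∫ s in (0 : ℝ)..t, ‖f s - p n s‖ ^ 2) atTop
      (𝓝 (∫ s in (0 : ℝ)..t, (0 : ℝ))) := by
    refine intervalIntegral.tendsto_integral_filter_of_dominated_convergence
      (fun _ => (M + M) ^ 2) (Eventually.of_forall fun n => ?_)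
      (Eventually.of_forall fun n => Eventually.of_forall fun s _ => ?_)
      intervalIntegrable_const (Eventually.of_forall fun s _ => ?_)
    · exact Continuous.aestronglyMeasurable (by fun_prop)
    · rw [Real.norm_of_nonneg (sq_nonneg _)]
      exact pow_le_pow_left₀ (norm_nonneg _) ((norm_sub_le _ _).trans
        (add_le_add (hfM s) (norm_picardMap_iterate_le hd hΦ φ n s))) 2
    · have := ((hflim s).const_sub (f s)).norm.pow 2
      simpa using this
  rw [intervalIntegral.integral_zero] at hint
  have hsq : Tendsto (fun n => ‖Φ (seg r (traj d φ f) t) - p (n + 1) t‖ ^ 2) atTop (𝓝 0) := by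
    refine squeeze_zero (fun n => sq_nonneg _) (fun n => ?_)
      (by simpa using hint.const_mul L)
    have h1 := h f φ (p n) (fun s _ => hfM s) t ht
    rw [dist_self, zero_pow two_ne_zero, zero_add] at h1
    simp only [hp, Function.iterate_succ_apply', picardMap_apply hd hΦ φ _ ht.1]
    exact h1
  have hlim2 : Tendsto (fun n => p (n + 1) t) atTop (𝓝 (Φ (seg r (traj d φ f) t))) := by
    rw [tendsto_iff_norm_sub_tendsto_zero]
    have h1 := hsq.sqrt
    simp only [Real.sqrt_sq (norm_nonneg _), Real.sqrt_zero] at h1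
    exact h1.congr fun n => norm_sub_rev _ _
  exact tendsto_nhds_unique ((hflim t).comp (tendsto_add_atTop_nat 1)) hlim2

end Picard

section Semigroup

variable {H : Type*} [NormedAddCommGroup H] [InnerProductSpace ℝ H] [CompleteSpace H]
variable {A : PosOp H} {r : ℝ≥0} {d : ℝ} {Φ : Hist A r → Scale A 0} {M C : ℝ}

/-! ### The space of continuously differentiable histories -/

theorem C1Hist.lipschitzWith_fn : LipschitzWith 1 (C1Hist.fn (A := A) (r := r)) :=
  LipschitzWith.of_dist_le_mul fun φ ψ => by
    rw [NNReal.coe_one, one_mul, dist_eq_norm]; exact φ.norm_fn_sub_le ψ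

theorem C1Hist.lipschitzWith_deriv : LipschitzWith 1 (C1Hist.deriv (A := A) (r := r)) :=
  LipschitzWith.of_dist_le_mul fun φ ψ => by
    rw [NNReal.coe_one, one_mul, dist_eq_norm]; exact φ.norm_deriv_sub_le ψ

theorem C1Hist.lipschitzWith_init : LipschitzWith 1 (C1Hist.init (A := A) (r := r)) :=
  LipschitzWith.of_dist_le_mul fun φ ψ => by
    rw [NNReal.coe_one, one_mul, dist_eq_norm]; exact φ.norm_init_sub_le ψ

theorem C1Hist.tendsto_of_tendsto {α : Type*} {𝓕 : Filter α} {p : α → C1Hist A r} {φ : C1Hist A r}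
    (h1 : Tendsto (fun a => (p a).fn) 𝓕 (𝓝 φ.fn))
    (h2 : Tendsto (fun a => (p a).deriv) 𝓕 (𝓝 φ.deriv))
    (h3 : Tendsto (fun a => (p a).init) 𝓕 (𝓝 φ.init)) : Tendsto p 𝓕 (𝓝 φ) := by
  rw [tendsto_iff_dist_tendsto_zero]
  have := ((tendsto_iff_norm_sub_tendsto_zero.1 h1).add
    (tendsto_iff_norm_sub_tendsto_zero.1 h2)).add (tendsto_iff_norm_sub_tendsto_zero.1 h3)
  simpa only [C1Hist.dist_def, add_zero] using this

/-- A history is determined by its values, since `[-r,0]` is not a single point. -/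
theorem C1Hist.eq_of_fn_eq (hr : 0 < r) {φ ψ : C1Hist A r} (h : ∀ θ, φ.fn θ = ψ.fn θ) : φ = ψ := by
  have hfn : φ.fn = ψ.fn := ContinuousMap.ext h
  refine C1Hist.ext hfn (ContinuousMap.ext fun θ => ?_) ?_
  · have h1 := φ.hasDeriv θ
    rw [hfn] at h1
    exact ((uniqueDiffOn_Icc (neg_lt_zero.2 (NNReal.coe_pos.2 hr))) θ θ.2).eq_deriv _ h1
      (ψ.hasDeriv θ)
  · exact Scale.formal_injective (by rw [φ.init_eq, ψ.init_eq, hfn])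

instance : CompleteSpace (C1Hist A r) := by
  refine Metric.complete_of_cauchySeq_tendsto fun u hu => ?_
  obtain ⟨f, hf⟩ := cauchySeq_tendsto_of_complete
    (C1Hist.lipschitzWith_fn.uniformContinuous.comp_cauchySeq hu)
  obtain ⟨g, hg⟩ := cauchySeq_tendsto_of_complete
    (C1Hist.lipschitzWith_deriv.uniformContinuous.comp_cauchySeq hu)
  obtain ⟨i, hi⟩ := cauchySeq_tendsto_of_complete
    (C1Hist.lipschitzWith_init.uniformContinuous.comp_cauchySeq hu)
  have hr0 : -(r : ℝ) ≤ 0 := neg_nonpos.2 r.coe_nonneg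
  have hev (t : ℝ) : Tendsto (fun n => (u n).fnExt t) atTop (𝓝 (IccExtend hr0 f t)) :=
    ((continuous_eval_const _).tendsto f).comp hf
  have hint (t : ℝ) : Continuous fun g : C(Icc (-(r : ℝ)) 0, Scale A (-(1 / 2))) =>
      ∫ s in (-(r : ℝ))..t, IccExtend hr0 g s :=
    intervalIntegral.continuous_parametric_intervalIntegral_of_continuous'
      (f := fun (g : C(Icc (-(r : ℝ)) 0, Scale A (-(1 / 2)))) s => IccExtend hr0 g s)
      (by
        change Continuous fun p : C(Icc (-(r : ℝ)) 0, Scale A (-(1 / 2))) × ℝ =>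
          p.1 (projIcc (-(r : ℝ)) 0 hr0 p.2)
        fun_prop) _ _
  have hf_eq (t : ℝ) (ht : t ∈ Icc (-(r : ℝ)) 0) : IccExtend hr0 f t =
      IccExtend hr0 f (-r) + ∫ s in (-(r : ℝ))..t, IccExtend hr0 g s := by
    refine tendsto_nhds_unique (hev t) ?_
    refine ((hev (-r)).add (((hint t).tendsto g).comp hg)).congr fun n => ?_
    change (u n).fnExt (-r) + ∫ s in (-(r : ℝ))..t, (u n).derivExt s = _
    rw [(u n).integral_derivExt le_rfl ht.1 ht.2, add_sub_cancel]
  have hder := hasDerivWithinAt_extend_of_integral (r := r) g.continuous.Icc_extend' hf_eq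
  have hcoe (θ : Icc (-(r : ℝ)) 0) : IccExtend hr0 f θ = f θ := IccExtend_val _ _ θ
  have hcoe' (θ : Icc (-(r : ℝ)) 0) : IccExtend hr0 g θ = g θ := IccExtend_val _ _ θ
  simp only [hcoe, hcoe'] at hder
  have hinit : i.formal = (f (zeroPt r)).formal := by
    funext l
    refine tendsto_nhds_unique (((Scale.comp A _ l).continuous.tendsto i).comp hi) ?_
    refine ((((Scale.comp A _ l).continuous.comp
      (continuous_eval_const (zeroPt r))).tendsto f).comp hf).congr fun n => ?_
    exact congrFun (u n).init_eq.symm l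
  exact ⟨⟨f, g, i, hder, hinit⟩, C1Hist.tendsto_of_tendsto hf hg hi⟩

/-- The abstract form of the set `X`, for the nonlinearity `Φ`. -/
def compatSet (d : ℝ) (Φ : Hist A r → Scale A 0) : Set (C1Hist A r) :=
  {φ | (φ.deriv (zeroPt r)).formal + powA A 1 (φ.fn (zeroPt r)).formal
      + d • (φ.fn (zeroPt r)).formal = (Φ φ.fn).formal}

theorem mem_compatSet {φ : C1Hist A r} : φ ∈ compatSet d Φ ↔ ∀ l : Ioi (0 : ℝ),
    (φ.deriv (zeroPt r)).formal l + (l : ℝ) • (φ.init).formal l + d • φ.init.formal l =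
      (Φ φ.fn).formal l := by
  rw [compatSet, mem_ofPred_eq, funext_iff]
  refine forall_congr' fun l => ?_
  rw [← φ.init_eq]
  simp only [Pi.add_apply, Pi.smul_apply, powA, LinearMap.coe_mk, AddHom.coe_mk, Real.rpow_one]

/-- The condition is closed in every component; the metric of `C1Hist` controls both `φ'(0)` and
`φ(0)` in `D(A^(1/2))`. -/
theorem isClosed_compatSet (hΦ : IsDelayForcing Φ M C) : IsClosed (compatSet d Φ) := by
  have h1 : compatSet d Φ = ⋂ l : Ioi (0 : ℝ), {φ | (φ.deriv (zeroPt r)).formal l +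
      (l : ℝ) • (φ.init).formal l + d • φ.init.formal l = (Φ φ.fn).formal l} := by
    ext φ
    rw [mem_compatSet, mem_iInter]
    rfl
  rw [h1]
  refine isClosed_iInter fun l => isClosed_eq ?_ ?_
  · have h2 : Continuous fun φ : C1Hist A r => φ.deriv (zeroPt r) :=
      (continuous_eval_const _).comp C1Hist.lipschitzWith_deriv.continuous
    have h3 := Scale.continuous_formal (C1Hist.lipschitzWith_init (A := A) (r := r)).continuous l
    exact ((Scale.continuous_formal h2 l).add (h3.const_smul (l : ℝ))).add (h3.const_smul d)
  · exact Scale.continuous_formal (hΦ.continuous_comp C1Hist.lipschitzWith_fn.continuous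
      C1Hist.lipschitzWith_init.continuous fun φ => φ.init_eq) l

theorem completeSpace_compatSet (hΦ : IsDelayForcing Φ M C) : CompleteSpace (compatSet d Φ) :=
  (isClosed_compatSet hΦ).completeSpace_coe

/-! ### The time derivative of a trajectory -/

theorem seg_traj_zero (hd : 0 ≤ d) (φ : C1Hist A r) (f : C(ℝ, Scale A 0)) :
    seg r (traj d φ f) 0 = φ.fn := by
  funext θ
  rw [seg, zero_add, traj_of_nonpos hd φ f θ.2.2, φ.fnExt_coe]

/-- The time derivative of a trajectory, when `φ'(0)` is the right derivative at `0`. -/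
def trajDeriv (d : ℝ) (φ : C1Hist A r) (f : C(ℝ, Scale A 0)) (t : ℝ) : Scale A (-(1 / 2)) :=
  φ.derivExt t + (solDeriv d φ.init f (max t 0) - solDeriv d φ.init f 0)

theorem continuous_trajDeriv (hd : 0 ≤ d) (φ : C1Hist A r) (f : C(ℝ, Scale A 0)) :
    Continuous (trajDeriv d φ f) :=
  φ.continuous_derivExt.add
    (((continuous_solDeriv hd φ.init f).comp (by fun_prop)).sub continuous_const)

theorem trajDeriv_of_nonpos (φ : C1Hist A r) (f : C(ℝ, Scale A 0)) {t : ℝ} (ht : t ≤ 0) :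
    trajDeriv d φ f t = φ.derivExt t := by
  rw [trajDeriv, max_eq_right ht, sub_self, add_zero]

theorem formal_solDeriv_eq (hd : 0 ≤ d) (x : Scale A (1 / 2)) (f : C(ℝ, Scale A 0)) {t : ℝ}
    (ht : 0 ≤ t) (l : Ioi (0 : ℝ)) :
    (solDeriv d x f t).formal l + (l : ℝ) • (sol d x f t).formal l +
      d • (sol d x f t).formal l = (f t).formal l := by
  rw [formal_solDeriv hd x f ht, formal_sol hd x f ht, mildFormal, add_smul]
  abel

theorem solDeriv_zero (hd : 0 ≤ d) {φ : C1Hist A r} (hφ : φ ∈ compatSet d Φ) {f : C(ℝ, Scale A 0)}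
    {T : ℝ} (hT : 0 ≤ T) (hf : IsForcing d Φ φ f T) :
    solDeriv d φ.init f 0 = φ.deriv (zeroPt r) := by
  refine Scale.ext_formal fun l => ?_
  have h1 := formal_solDeriv_eq hd φ.init f le_rfl l
  rw [sol_of_nonpos hd _ _ le_rfl, hf 0 ⟨le_rfl, hT⟩, seg_traj_zero hd] at h1
  have h2 := mem_compatSet.1 hφ l
  rw [← h1, add_assoc, add_assoc, add_left_inj] at h2
  exact h2.symm

theorem trajDeriv_of_nonneg (hd : 0 ≤ d) {φ : C1Hist A r} (hφ : φ ∈ compatSet d Φ)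
    {f : C(ℝ, Scale A 0)} {T : ℝ} (hT : 0 ≤ T) (hf : IsForcing d Φ φ f T) {t : ℝ} (ht : 0 ≤ t) :
    trajDeriv d φ f t = solDeriv d φ.init f t := by
  rw [trajDeriv, max_eq_left ht, solDeriv_zero hd hφ hT hf, φ.derivExt_of_nonneg ht, add_sub_cancel]

/-- The two pieces of the derivative match at time `0` by the compatibility condition. -/
theorem integral_trajDeriv (hd : 0 ≤ d) {φ : C1Hist A r} (hφ : φ ∈ compatSet d Φ)
    {f : C(ℝ, Scale A 0)} {T : ℝ} (hT : 0 ≤ T) (hf : IsForcing d Φ φ f T) {t : ℝ}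
    (ht : -(r : ℝ) ≤ t) :
    ∫ s in (-(r : ℝ))..t, trajDeriv d φ f s = traj d φ f t - traj d φ f (-r) := by
  have hr0 : -(r : ℝ) ≤ 0 := neg_nonpos.2 r.coe_nonneg
  have hneg {τ : ℝ} (hτ : -(r : ℝ) ≤ τ) (hτ0 : τ ≤ 0) :
      ∫ s in (-(r : ℝ))..τ, trajDeriv d φ f s = traj d φ f τ - traj d φ f (-r) := by
    rw [traj_of_nonpos hd φ f hτ0, traj_of_nonpos hd φ f hr0, ← φ.integral_derivExt le_rfl hτ hτ0]
    refine intervalIntegral.integral_congr fun s hs => ?_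
    rw [uIcc_of_le hτ] at hs
    exact trajDeriv_of_nonpos φ f (hs.2.trans hτ0)
  rcases le_total t 0 with h0 | h0
  · exact hneg ht h0
  have hc := continuous_trajDeriv hd φ f
  have hpos : ∫ s in (0 : ℝ)..t, trajDeriv d φ f s = traj d φ f t - traj d φ f 0 := by
    rw [traj_of_nonneg hd φ f h0, traj_of_nonneg hd φ f le_rfl,
      ← integral_solDeriv hd _ _ le_rfl h0]
    refine intervalIntegral.integral_congr fun s hs => ?_
    rw [uIcc_of_le h0] at hs
    exact trajDeriv_of_nonneg hd hφ hT hf hs.1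
  rw [← intervalIntegral.integral_add_adjacent_intervals (hc.intervalIntegrable _ 0)
    (hc.intervalIntegrable _ _), hneg hr0 le_rfl, hpos]
  abel

/-! ### The semigroup -/

/-- The state `u_t` of the trajectory `u` at time `t`. -/
def evolve (hd : 0 ≤ d) {φ : C1Hist A r} (hφ : φ ∈ compatSet d Φ) {f : C(ℝ, Scale A 0)} {T : ℝ}
    (hT : 0 ≤ T) (hf : IsForcing d Φ φ f T) {t : ℝ} (ht : 0 ≤ t) : C1Hist A r where
  fn := segC r ⟨traj d φ f, continuous_traj hd φ f⟩ t
  deriv := segC r ⟨trajDeriv d φ f, continuous_trajDeriv hd φ f⟩ t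
  init := sol d φ.init f t
  hasDeriv θ := by
    have hc := continuous_trajDeriv hd φ f
    refine hasDerivWithinAt_extend_of_integral (g := fun s => traj d φ f (t + s))
      (g' := fun s => trajDeriv d φ f (t + s)) (hc.comp (by fun_prop)) (fun s hs => ?_) θ
    have h1 : -(r : ℝ) ≤ t + -r := by linarith
    have h2 : -(r : ℝ) ≤ t + s := by linarith [hs.1]
    rw [intervalIntegral.integral_comp_add_left (fun s => trajDeriv d φ f s) t,
      ← intervalIntegral.integral_interval_sub_left (a := -(r : ℝ)) (hc.intervalIntegrable _ _)
        (hc.intervalIntegrable _ _), integral_trajDeriv hd hφ hT hf h1,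
      integral_trajDeriv hd hφ hT hf h2]
    abel
  init_eq := by
    change _ = (seg r (traj d φ f) t (zeroPt r)).formal
    rw [seg_zeroPt, formal_traj hd φ f ht]

/-- The compatibility condition for `u_t` is the differential equation at time `t`. -/
theorem evolve_mem (hd : 0 ≤ d) {φ : C1Hist A r} (hφ : φ ∈ compatSet d Φ) {f : C(ℝ, Scale A 0)}
    {T : ℝ} (hT : 0 ≤ T) (hf : IsForcing d Φ φ f T) {t : ℝ} (ht : t ∈ Icc 0 T) :
    evolve hd hφ hT hf ht.1 ∈ compatSet d Φ := by
  refine mem_compatSet.2 fun l => ?_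
  have h1 : (evolve hd hφ hT hf ht.1).deriv (zeroPt r) = solDeriv d φ.init f t := by
    rw [← trajDeriv_of_nonneg hd hφ hT hf ht.1]
    exact seg_zeroPt (trajDeriv d φ f) t
  rw [h1]
  refine (formal_solDeriv_eq hd φ.init f ht.1 l).trans ?_
  rw [hf t ht]
  rfl

/-- A solution of the fixed-point equation for the forcing term, for all times. -/
def forcing (hd : 0 ≤ d) (hΦ : IsDelayForcing Φ M C) (φ : C1Hist A r) : C(ℝ, Scale A 0) :=
  (exists_isForcing hd hΦ φ).choose

theorem isForcing_forcing (hd : 0 ≤ d) (hΦ : IsDelayForcing Φ M C) (φ : C1Hist A r) (T : ℝ) :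
    IsForcing d Φ φ (forcing hd hΦ φ) T :=
  (exists_isForcing hd hΦ φ).choose_spec T

/-- The semigroup `φ ↦ u_t`. -/
def semiflow (hd : 0 ≤ d) (hΦ : IsDelayForcing Φ M C) (t : ℝ≥0) (φ : compatSet d Φ) :
    compatSet d Φ :=
  ⟨evolve hd φ.2 t.2 (isForcing_forcing hd hΦ φ.1 t) t.2,
    evolve_mem hd φ.2 t.2 (isForcing_forcing hd hΦ φ.1 t) ⟨t.2, le_rfl⟩⟩

theorem semiflow_fn (hd : 0 ≤ d) (hΦ : IsDelayForcing Φ M C) (t : ℝ≥0) (φ : compatSet d Φ) :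
    ((semiflow hd hΦ t φ).1.fn : Hist A r) = seg r (traj d φ.1 (forcing hd hΦ φ.1)) t := rfl

theorem semiflow_init (hd : 0 ≤ d) (hΦ : IsDelayForcing Φ M C) (t : ℝ≥0) (φ : compatSet d Φ) :
    (semiflow hd hΦ t φ).1.init = sol d φ.1.init (forcing hd hΦ φ.1) t := rfl

theorem semiflow_zero (hr : 0 < r) (hd : 0 ≤ d) (hΦ : IsDelayForcing Φ M C) (φ : compatSet d Φ) :
    semiflow hd hΦ 0 φ = φ := by
  refine Subtype.ext (C1Hist.eq_of_fn_eq hr fun θ => ?_)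
  rw [semiflow_fn, NNReal.coe_zero, seg_traj_zero hd]

/-- The shifted forcing term `f(t + ·)` is a forcing term for the history `u_t`, hence the one
selected by uniqueness. -/
theorem semiflow_add (hr : 0 < r) (hd : 0 ≤ d) (hΦ : IsDelayForcing Φ M C) (s t : ℝ≥0)
    (φ : compatSet d Φ) : semiflow hd hΦ (s + t) φ = semiflow hd hΦ s (semiflow hd hΦ t φ) := by
  set ψ := semiflow hd hΦ t φ with hψ
  set f := forcing hd hΦ φ.1 with hf
  let g : C(ℝ, Scale A 0) := ⟨fun τ => f (t + τ), by fun_prop⟩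
  have htraj {τ : ℝ} (hτ : -(r : ℝ) ≤ τ) : traj d ψ.1 g τ = traj d φ.1 f (t + τ) := by
    rcases le_total τ 0 with h0 | h0
    · rw [traj_of_nonpos hd ψ.1 g h0]
      exact (ψ.1.fnExt_coe ⟨τ, hτ, h0⟩).trans (by rw [hψ, semiflow_fn]; rfl)
    · rw [traj_of_nonneg hd ψ.1 g h0, traj_of_nonneg hd φ.1 f (add_nonneg t.coe_nonneg h0),
        solNeg, solNeg, sol_add_time hd φ.1.init f g t.coe_nonneg h0 fun _ _ => rfl, hψ,
        semiflow_init]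
  have hseg {τ : ℝ} (hτ : 0 ≤ τ) : seg r (traj d ψ.1 g) τ = seg r (traj d φ.1 f) (t + τ) := by
    funext θ
    rw [seg, seg, htraj (by linarith [θ.2.1]), add_assoc]
  have hg : IsForcing d Φ ψ.1 g s := fun τ hτ => by
    rw [hseg hτ.1]
    exact isForcing_forcing hd hΦ φ.1 (t + τ) _ ⟨add_nonneg t.coe_nonneg hτ.1, le_rfl⟩
  have hfg := (isForcing_forcing hd hΦ ψ.1 s).eq_of_isForcing hd hΦ hg
  refine Subtype.ext (C1Hist.eq_of_fn_eq hr fun θ => ?_)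
  rw [semiflow_fn, semiflow_fn, ← hf, NNReal.coe_add, add_comm (s : ℝ), ← hseg s.coe_nonneg]
  refine (traj_congr hd ψ.1 fun τ hτ => hfg τ ⟨hτ.1, hτ.2.trans ?_⟩).symm
  have := θ.2.2
  linarith

theorem continuous_semiflow_time (hd : 0 ≤ d) (hΦ : IsDelayForcing Φ M C) (φ : compatSet d Φ) :
    Continuous fun t => semiflow hd hΦ t φ := by
  refine Continuous.subtype_mk (f := fun t => (semiflow hd hΦ t φ).1) ?_ _
  rw [continuous_iff_continuousAt]
  intro t
  have hc : Continuous fun t : ℝ≥0 => (t : ℝ) := NNReal.continuous_coe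
  exact C1Hist.tendsto_of_tendsto (((continuous_segC _).comp hc).tendsto t)
    (((continuous_segC _).comp hc).tendsto t) (((continuous_sol hd _ _).comp hc).tendsto t)

theorem norm_solDeriv_sub_le (hd : 0 ≤ d) (x y : Scale A (1 / 2)) (f g : C(ℝ, Scale A 0)) (t : ℝ) :
    ‖solDeriv d x f t - solDeriv d y g t‖ ≤
      (‖Scale.opA A (by norm_num : (1 / 2 : ℝ) = -(1 / 2) + 1)‖ +
        d * ‖Scale.incl A (by norm_num : (-(1 / 2) : ℝ) ≤ 1 / 2)‖) * ‖sol d x f t - sol d y g t‖ +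
      ‖Scale.incl A (by norm_num : (-(1 / 2) : ℝ) ≤ 0)‖ * ‖f t - g t‖ := by
  have h : solDeriv d x f t - solDeriv d y g t =
      -(Scale.opA A (by norm_num : (1 / 2 : ℝ) = -(1 / 2) + 1) (sol d x f t - sol d y g t)) -
      d • Scale.incl A (by norm_num : (-(1 / 2) : ℝ) ≤ 1 / 2) (sol d x f t - sol d y g t) +
      Scale.incl A (by norm_num : (-(1 / 2) : ℝ) ≤ 0) (f t - g t) := by
    rw [solDeriv, solDeriv, solNeg, solNeg, map_sub, map_sub, map_sub, smul_sub]
    abel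
  rw [h, add_mul, mul_assoc]
  refine (norm_add_le _ _).trans (add_le_add ((norm_sub_le _ _).trans (add_le_add ?_ ?_)) ?_)
  · rw [norm_neg]
    exact ContinuousLinearMap.le_opNorm _ _
  · rw [norm_smul, Real.norm_of_nonneg hd]
    exact mul_le_mul_of_nonneg_left (ContinuousLinearMap.le_opNorm _ _) hd
  · exact ContinuousLinearMap.le_opNorm _ _

/-- Lipschitz dependence at each `φ`; the constant depends on `φ`, through its Lipschitz constant
in time. -/
theorem exists_dist_semiflow_le (hd : 0 ≤ d) (hΦ : IsDelayForcing Φ M C) (t : ℝ≥0)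
    (φ : compatSet d Φ) : ∃ K, ∀ ψ : compatSet d Φ,
      dist (semiflow hd hΦ t φ) (semiflow hd hΦ t ψ) ≤ K * dist φ ψ := by
  obtain ⟨L, hL, h⟩ := hΦ.exists_forcing_sub_le hd φ.1 t
  set R := √(1 + t * L ^ 2) with hR
  set a := ‖Scale.opA A (by norm_num : (1 / 2 : ℝ) = -(1 / 2) + 1)‖ +
    d * ‖Scale.incl A (by norm_num : (-(1 / 2) : ℝ) ≤ 1 / 2)‖ with ha
  set b := ‖Scale.incl A (by norm_num : (-(1 / 2) : ℝ) ≤ 0)‖ with hb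
  set c := 1 + ‖Scale.incl A (by norm_num : (-(1 / 2) : ℝ) ≤ 1 / 2)‖ with hc
  have ha0 : 0 ≤ a := by positivity
  have hb0 : 0 ≤ b := norm_nonneg _
  refine ⟨c * R + (1 + (a * R + b * L)) + R, fun ψ => ?_⟩
  set f := forcing hd hΦ φ.1 with hf
  set g := forcing hd hΦ ψ.1 with hg
  have hfF := isForcing_forcing hd hΦ φ.1 t
  have hgF := isForcing_forcing hd hΦ ψ.1 t
  rw [← hf] at hfF
  rw [← hg] at hgF
  have hfg := h f ψ.1 g hfF hgF
  have hdist : dist φ ψ = dist φ.1 ψ.1 := rfl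
  have hD : 0 ≤ dist φ.1 ψ.1 := dist_nonneg
  have hI : ∫ s in (0 : ℝ)..t, ‖f s - g s‖ ^ 2 ≤ t * (L * dist φ.1 ψ.1) ^ 2 := by
    have h1 : ∫ s in (0 : ℝ)..t, ‖f s - g s‖ ^ 2 ≤ ∫ s in (0 : ℝ)..t, (L * dist φ.1 ψ.1) ^ 2 := by
      refine intervalIntegral.integral_mono_on t.2
        (Continuous.intervalIntegrable (by fun_prop) _ _) intervalIntegrable_const fun s hs => ?_
      exact pow_le_pow_left₀ (norm_nonneg _) (hfg s hs) 2
    rwa [intervalIntegral.integral_const, sub_zero, smul_eq_mul] at h1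
  have hsqrt : √(dist φ.1 ψ.1 ^ 2 + ∫ s in (0 : ℝ)..t, ‖f s - g s‖ ^ 2) ≤ R * dist φ.1 ψ.1 := by
    refine Real.sqrt_le_iff.2 ⟨by positivity, ?_⟩
    rw [mul_pow, hR, Real.sq_sqrt (by positivity)]
    nlinarith
  have hsol {τ : ℝ} (hτ : τ ≤ t) :
      ‖sol d φ.1.init f τ - sol d ψ.1.init g τ‖ ≤ R * dist φ.1 ψ.1 := by
    refine le_trans (Real.le_sqrt_of_sq_le
      ((norm_sol_sub_sq_le hd _ _ f g t.2 hτ).trans ?_)) hsqrt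
    exact add_le_add_left (pow_le_pow_left₀ (norm_nonneg _) (φ.1.norm_init_sub_le ψ.1) 2) _
  rw [hdist]
  change ‖(semiflow hd hΦ t φ).1.fn - (semiflow hd hΦ t ψ).1.fn‖ +
    ‖(semiflow hd hΦ t φ).1.deriv - (semiflow hd hΦ t ψ).1.deriv‖ +
    ‖(semiflow hd hΦ t φ).1.init - (semiflow hd hΦ t ψ).1.init‖ ≤ _
  rw [add_mul, add_mul]
  refine add_le_add (add_le_add ?_ ?_) ?_
  · refine (ContinuousMap.norm_le _ (by positivity)).2 fun θ => ?_
    have hθ : (t : ℝ) + θ ≤ t := by linarith [θ.2.2]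
    refine (norm_traj_sub_le hd φ.1 ψ.1 f g t.2 hθ).trans ?_
    rw [mul_assoc]
    exact mul_le_mul_of_nonneg_left hsqrt (by positivity)
  · refine (ContinuousMap.norm_le _ (by positivity)).2 fun θ => ?_
    have hθ : (t : ℝ) + θ ≤ t := by linarith [θ.2.2]
    change ‖trajDeriv d φ.1 f (t + θ) - trajDeriv d ψ.1 g (t + θ)‖ ≤ _
    have hab : 0 ≤ a * R + b * L := by positivity
    rcases le_total ((t : ℝ) + θ) 0 with h0 | h0
    · rw [trajDeriv_of_nonpos _ _ h0, trajDeriv_of_nonpos _ _ h0]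
      refine (φ.1.norm_derivExt_sub_le ψ.1 _).trans (le_mul_of_one_le_left hD ?_)
      linarith
    · rw [trajDeriv_of_nonneg hd φ.2 t.2 hfF h0, trajDeriv_of_nonneg hd ψ.2 t.2 hgF h0]
      refine (norm_solDeriv_sub_le hd _ _ f g _).trans ?_
      have h1 := mul_le_mul_of_nonneg_left (hsol hθ) ha0
      have h2 := mul_le_mul_of_nonneg_left (hfg _ ⟨h0, hθ⟩) hb0
      nlinarith
  · exact hsol le_rfl

theorem continuous_semiflow (hd : 0 ≤ d) (hΦ : IsDelayForcing Φ M C) (t : ℝ≥0) :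
    Continuous (semiflow (d := d) hd hΦ t) := by
  rw [continuous_iff_continuousAt]
  intro φ
  obtain ⟨K, hK⟩ := exists_dist_semiflow_le hd hΦ t φ
  rw [ContinuousAt, tendsto_iff_dist_tendsto_zero]
  refine squeeze_zero (fun _ => dist_nonneg) (fun ψ => ?_) (g := fun ψ => K * dist φ ψ) ?_
  · rw [dist_comm]; exact hK ψ
  · have : Continuous fun ψ => K * dist φ ψ := by fun_prop
    have h := this.tendsto φ
    rwa [dist_self, mul_zero] at h

theorem isDynamicalSystem_semiflow (hr : 0 < r) (hd : 0 ≤ d) (hΦ : IsDelayForcing Φ M C) :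
    IsDynamicalSystem (semiflow (d := d) hd hΦ) where
  complete := completeSpace_compatSet hΦ
  zero := semiflow_zero hr hd hΦ
  add := semiflow_add hr hd hΦ
  continuous_state := continuous_semiflow hd hΦ
  continuous_time := continuous_semiflow_time hd hΦ

end Semigroup

section StrongSolutions

/-! ### Strong solutions -/

variable {n : ℕ} {Ω : Set (EuclideanSpace ℝ (Fin n))} {A : PosOp (L2 Ω)} {r : ℝ≥0} {d : ℝ}
  {b : ℝ → ℝ} {B : Scale A (-(1 / 2)) → L2 Ω} {η : Hist A r → Icc (0 : ℝ) r} {M C : ℝ}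

instance : TopologicalSpace.SeparableSpace (L2 Ω) :=
  have : Fact ((2 : ℝ≥0∞) ≠ ∞) := ⟨ENNReal.ofNat_ne_top⟩
  inferInstance

theorem hasTimeDeriv_traj {H : Type*} [NormedAddCommGroup H] [InnerProductSpace ℝ H]
    [CompleteSpace H] {A : PosOp H} (hd : 0 ≤ d) (φ : C1Hist A r) (f : C(ℝ, Scale A 0)) (T : ℝ) :
    HasTimeDeriv T (traj d φ f) (solDeriv d φ.init f) := fun t ht => by
  rw [traj_of_nonneg hd φ f ht.1, traj_of_nonneg hd φ f le_rfl]
  exact solNeg_eq_integral hd φ.init f ht.1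

/-- A trajectory that is generated by the nonlinearity along itself is a strong solution. -/
theorem IsForcing.isStrongSolution (hd : 0 ≤ d) {φ : C1Hist A r} {f : C(ℝ, Scale A 0)} {T : ℝ}
    (hT : 0 ≤ T) (hf : IsForcing d (fun φ => expandCLM A (F₁ b B η φ)) φ f T) :
    IsStrongSolution d b B η T φ.fn (traj d φ f) where
  continuousOn := (continuous_traj hd φ f).continuousOn
  continuousOn_half := ⟨sol d φ.init f, (continuous_sol hd φ.init f).continuousOn,
    fun _ ht => (formal_traj hd φ f ht.1).symm⟩
  memLp_one := by
    obtain ⟨w, hw, hwu⟩ := exists_memLp_scale_one hd φ.init f hT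
    refine ⟨w, hw, ?_⟩
    filter_upwards [hwu, ae_restrict_mem measurableSet_Ioc] with t ht ht0
    rw [ht, formal_traj hd φ f ht0.1.le]
  deriv_bounded := ⟨solDeriv d φ.init f, (continuous_solDeriv hd φ.init f).memLp_restrict_Ioc _ _ _,
    hasTimeDeriv_traj hd φ f T⟩
  initial θ := by rw [traj_of_nonpos hd φ f θ.2.2, φ.fnExt_coe]
  weak v w w' hv hw' hw hvw hwT := by
    have h := isWeakSolution_sol hd φ.init f hT v w w' hv hw' hw hvw hwT
    have htraj {t : ℝ} (ht : t ∈ uIcc 0 T) :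
        (traj d φ f t).formal = (sol d φ.init f t).formal := by
      rw [uIcc_of_le hT] at ht
      exact formal_traj hd φ f ht.1
    rw [← φ.init_eq]
    convert h using 2
    · congr 1
      exact intervalIntegral.integral_congr fun t ht => by simp only [htraj ht]
    · exact intervalIntegral.integral_congr fun t ht => by simp only [htraj ht]
    · refine intervalIntegral.integral_congr fun t ht => ?_
      have h1 := ht
      rw [uIcc_of_le hT] at h1
      simp only [htraj ht, hf t h1, formal_expandCLM]

/-- Every strong solution is the trajectory that it generates: the nonlinearity along it is a
continuous function of time, so uniqueness for the linear weak equation applies. -/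
theorem IsStrongSolution.exists_isForcing (hd : 0 ≤ d)
    (hΦ : IsDelayForcing (fun φ => expandCLM A (F₁ b B η φ)) M C) {φ : C1Hist A r} {T : ℝ}
    (hT : 0 < T) {u : ℝ → Scale A (-(1 / 2))} (hu : IsStrongSolution d b B η T φ.fn u) :
    ∃ f : C(ℝ, Scale A 0), IsForcing d (fun φ => expandCLM A (F₁ b B η φ)) φ f T ∧
      EqOn u (traj d φ f) (Icc (-(r : ℝ)) T) := by
  obtain ⟨w, hw, hwu⟩ := hu.continuousOn_half
  have hr0 : -(r : ℝ) ≤ 0 := neg_nonpos.2 r.coe_nonneg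
  have hrT : -(r : ℝ) ≤ T := hr0.trans hT.le
  -- Continuous extensions of the two representatives to the real line.
  set u₁ : ℝ → Scale A (-(1 / 2)) := fun t => u (projIcc (-(r : ℝ)) T hrT t) with hu₁
  set w₁ : ℝ → Scale A (1 / 2) := fun t => w (projIcc 0 T hT.le t) with hw₁
  have hu₁c : Continuous u₁ := hu.continuousOn.comp_continuous
    (continuous_subtype_val.comp continuous_projIcc) fun t => (projIcc (-(r : ℝ)) T hrT t).2
  have hw₁c : Continuous w₁ := hw.comp_continuous
    (continuous_subtype_val.comp continuous_projIcc) fun t => (projIcc 0 T hT.le t).2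
  have hu₁e {t : ℝ} (ht : t ∈ Icc (-(r : ℝ)) T) : u₁ t = u t := by
    rw [hu₁]; simp only [projIcc_of_mem hrT ht]
  have hw₁e {t : ℝ} (ht : t ∈ Icc 0 T) : w₁ t = w t := by
    rw [hw₁]; simp only [projIcc_of_mem hT.le ht]
  have hsub {t : ℝ} (ht : t ∈ Icc 0 T) : t ∈ Icc (-(r : ℝ)) T := ⟨hr0.trans ht.1, ht.2⟩
  let f : C(ℝ, Scale A 0) :=
    ⟨fun t => expandCLM A (F₁ b B η (seg r u₁ (projIcc 0 T hT.le t))),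
      hΦ.continuous_seg hu₁c hw₁c (continuous_subtype_val.comp continuous_projIcc) fun t => by
        have ht := (projIcc 0 T hT.le t).2
        rw [hu₁e (hsub ht), hw₁e ht, hwu _ ht]⟩
  have hseg {v : ℝ → Scale A (-(1 / 2))} (hv : EqOn u v (Icc (-(r : ℝ)) T)) {t : ℝ}
      (ht : t ∈ Icc 0 T) : seg r u t = seg r v t := by
    funext θ
    exact hv ⟨by linarith [θ.2.1, ht.1], by linarith [θ.2.2, ht.2]⟩
  have hfe {t : ℝ} (ht : t ∈ Icc 0 T) : f t = expandCLM A (F₁ b B η (seg r u t)) := by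
    change expandCLM A (F₁ b B η (seg r u₁ (projIcc 0 T hT.le t))) = _
    rw [projIcc_of_mem hT.le ht, hseg (fun s hs => (hu₁e hs).symm) ht]
  have hweak : IsWeakSolution A d T φ.init.formal (fun t => (f t).formal)
      fun t => (u t).formal := by
    intro v z z' hv hz' hz hvz hzT
    have h := hu.weak v z z' hv hz' hz hvz hzT
    rw [← φ.init_eq] at h
    refine h.trans ?_
    congr 1
    refine intervalIntegral.integral_congr fun t ht => ?_
    rw [uIcc_of_le hT.le] at ht
    simp only [hfe ht, formal_expandCLM]
  have hsol {t : ℝ} (ht : t ∈ Icc 0 T) : (u t).formal = (sol d φ.init f t).formal :=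
    hweak.eq_sol hd hT (fun l => (Scale.continuous_formal hu₁c l).continuousOn.congr fun s hs => by
      simp only [hu₁e (hsub hs)]) ht
  have heq : EqOn u (traj d φ f) (Icc (-(r : ℝ)) T) := by
    intro t ht
    rcases le_total t 0 with h0 | h0
    · rw [traj_of_nonpos hd φ f h0]
      exact (hu.initial ⟨t, ht.1, h0⟩).trans (φ.fnExt_coe ⟨t, ht.1, h0⟩).symm
    · exact Scale.formal_injective (by rw [formal_traj hd φ f h0, hsol ⟨h0, ht.2⟩])
  exact ⟨f, fun t ht => by rw [hfe ht, hseg heq ht], heq⟩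

theorem IsStrongSolution.eqOn_traj_forcing (hd : 0 ≤ d)
    (hΦ : IsDelayForcing (fun φ => expandCLM A (F₁ b B η φ)) M C) {φ : C1Hist A r} {T : ℝ}
    (hT : 0 < T) {u : ℝ → Scale A (-(1 / 2))} (hu : IsStrongSolution d b B η T φ.fn u) :
    EqOn u (traj d φ (forcing hd hΦ φ)) (Icc (-(r : ℝ)) T) := by
  obtain ⟨f, hf, huf⟩ := hu.exists_isForcing hd hΦ hT
  intro t ht
  have hfg := hf.eq_of_isForcing hd hΦ (isForcing_forcing hd hΦ φ T)
  exact (huf ht).trans (traj_congr hd φ fun s hs => hfg s ⟨hs.1, hs.2.trans ht.2⟩)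

theorem hasDerivWithinAt_traj {H : Type*} [NormedAddCommGroup H] [InnerProductSpace ℝ H]
    [CompleteSpace H] {A : PosOp H} (hd : 0 ≤ d) (φ : C1Hist A r) (f : C(ℝ, Scale A 0)) {T t : ℝ}
    (ht : t ∈ Icc 0 T) :
    HasDerivWithinAt (traj d φ f) (solDeriv d φ.init f t) (Icc 0 T) t := by
  have hc := continuous_solDeriv hd φ.init f
  have h1 : HasDerivAt (fun t => traj d φ f 0 + ∫ s in (0 : ℝ)..t, solDeriv d φ.init f s)
      (solDeriv d φ.init f t) t :=
    (intervalIntegral.integral_hasDerivAt_right (hc.intervalIntegrable _ _)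
      (hc.stronglyMeasurableAtFilter _ _) hc.continuousAt).const_add _
  exact h1.hasDerivWithinAt.congr (hasTimeDeriv_traj hd φ f T) (hasTimeDeriv_traj hd φ f T t ht)

end StrongSolutions
end DelayPDE

end

open DelayPDE
theorem lemma3 {n : ℕ} (Ω : Set (EuclideanSpace ℝ (Fin n))) (hΩ : IsOpen Ω)
    (hΩb : Bornology.IsBounded Ω) (A : PosOp (L2 Ω)) (r : ℝ≥0) (hr : 0 < r)
    (d : ℝ) (hd : 0 ≤ d) (b : ℝ → ℝ) (hb : ∃ K : ℝ≥0, LipschitzWith K b)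
    (hbM : ∃ M : ℝ, ∀ s, |b s| ≤ M)
    (B : Scale A (-(1 / 2)) → L2 Ω)
    (hB : ∃ L > (0 : ℝ), ∀ u v, ‖B u - B v‖ ≤ L * ‖u - v‖)
    (η : Hist A r → Icc (0 : ℝ) r) (hη : HypDelay η) :
    -- existence, uniqueness and continuity of the time derivative
    (∀ φ : C1Hist A r, ∀ T > (0 : ℝ), ∃ u : ℝ → Scale A (-(1 / 2)),
      IsStrongSolution d b B η T φ.fn u ∧
      (∀ v, IsStrongSolution d b B η T φ.fn v → EqOn v u (Icc (-(r : ℝ)) T)) ∧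
      ∃ u' : ℝ → Scale A (-(1 / 2)), ContinuousOn u' (Icc 0 T) ∧
        ∀ t ∈ Icc 0 T, HasDerivWithinAt u (u' t) (Icc 0 T) t) ∧
    -- the segments of solutions stay in `X` and define a dynamical system there
    ∃ S : ℝ≥0 → X d b B η → X d b B η,
      (∀ (φ : X d b B η) (T : ℝ) (u : ℝ → Scale A (-(1 / 2))), 0 < T →
        IsStrongSolution d b B η T φ.1.fn u →
        ∀ t : ℝ≥0, (t : ℝ) ≤ T → ((S t φ).1.fn : Hist A r) = seg r u t) ∧
      IsDynamicalSystem S := by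
  obtain ⟨M, C, hΦ⟩ := exists_isDelayForcing hΩb hb hbM hB hη
  refine ⟨fun φ T hT => ⟨traj d φ (forcing hd hΦ φ),
    (isForcing_forcing hd hΦ φ T).isStrongSolution hd hT.le,
    fun v hv => hv.eqOn_traj_forcing hd hΦ hT, solDeriv d φ.init (forcing hd hΦ φ),
    (continuous_solDeriv hd _ _).continuousOn, fun t ht => hasDerivWithinAt_traj hd _ _ ht⟩,
    semiflow (d := d) hd hΦ, fun φ T u hT hu t ht => ?_, isDynamicalSystem_semiflow hr hd hΦ⟩
  refine (semiflow_fn hd hΦ t φ).trans ?_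
  funext θ
  have h1 : -(r : ℝ) ≤ t + θ := by linarith [θ.2.1, t.coe_nonneg]
  have h2 : (t : ℝ) + θ ≤ T := by linarith [θ.2.2]
  exact (hu.eqOn_traj_forcing hd hΦ hT ⟨h1, h2⟩).symm
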